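/- Consider the asymptotic end $\{r>R\}$ of a spatial slice with Cartesian coordinates $x^i$, spherical coordinates $(r,x^A)$, the unit round metric $\bar\gamma_{AB}$ on $S^2$ and its Levi-Civita derivative $\bar D_A$. Barred quantities, $b,f,W,T,Y^A,I^A$ are smooth functions, tensors or tensor densities on $S^2$, with indices moved by $\bar\gamma$. Let $g_{ij}$ be a spatial metric and $\pi^{ij}$ its conjugate momentum (a density), with $g_{rr}=1+\frac1r\bar h_{rr}+\frac1{r^2}h^{(2)}_{rr}+o(r^{-2})$, $g_{rA}=\frac1rh^{(2)}_{rA}+o(r^{-1})$, $g_{AB}=r^2\bar\gamma_{AB}+r\bar h_{AB}+h^{(2)}_{AB}+o(1)$, $\pi^{rr}=\bar\pi^{rr}+\frac1r\pi^{(2)rr}+o(r^{-1})$, $\pi^{rA}=\frac1r\bar\pi^{rA}+\frac1{r^2}\pi^{(2)rA}+o(r^{-2})$, $\pi^{AB}=\frac1{r^2}\bar\pi^{AB}+\frac1{r^3}\pi^{(2)AB}+o(r^{-3})$, where remainders are smooth and may be differentiated (a radial derivative gains a factor $1/r$). Put $\bar\lambda=\frac12\bar h_{rr}$, $\bar k_{AB}=\frac12\bar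 h_{AB}+\bar\lambda\bar\gamma_{AB}$, $\bar k=\bar k^A_A$, $\bar\pi=\bar\pi^A_A$, $\bar p=2(\bar\pi^{rr}-\bar\pi)$. The *new boundary conditions* are these expansions together with the parity conditions ($\bar\lambda,\bar\pi^{AB}$ even; $\bar p,\bar k_{AB},\bar\pi^{rA}$ odd, for components in coordinates where the antipodal map is $x^A\mapsto-x^A$) and the constraint fall-off $\mathcal H=o(r^{-1})$, $\mathcal H_r=o(r^{-1})$, $\mathcal H_A=o(1)$, where $\mathcal H=g^{-1/2}(\pi^{ij}\pi_{ij}-\frac12\pi^2)-g^{1/2}R$ and $\mathcal H_i=-2\pi_i{}^j{}_{|j}$ (in these formulas and the next two $\pi=g_{ij}\pi^{ij}$). A surface deformation $(\xi,\xi^i)$ acts by $\delta_\xi g_{ij}=2\xi g^{-1/2}(\pi_{ij}-\frac12g_{ij}\pi)+\mathcal L_\xi g_{ij}$ and $\delta_\xi\pi^{ij}=-\xi g^{1/2}(R^{ij}-\frac12g^{ij}R)+\frac12\xi g^{-1/2}g^{ij}(\pi_{mn}\pi^{mn}-\frac12\pi^2)-2\xi g^{-1/2}(\pi^{im}\pi_m{}^j-\frac12\pi^{ij}\pi)+g^{1/2}(\xi^{|ij}-g^{ij}\xi^{|m}{}_{|m})+\mathcal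 L_\xi\pi^{ij}$. Let $\xi=rb+f+O(r^{-1})$, $\xi^r=W+O(r^{-1})$, $\xi^A=Y^A+\frac1rI^A+O(r^{-2})$ with $\bar D_A\bar D_Bb+\bar\gamma_{AB}b=0$, $\mathcal L_Y\bar\gamma_{AB}=0$, $I^A=\frac{2b}{\sqrt{\bar\gamma}}\bar\pi^{rA}+\bar D^AW$, where each $O$-term is a term of that order with coefficient on $S^2$ plus a remainder of smaller order. The deformation *preserves* the boundary conditions at $(g,\pi)$ if $(\delta_\xi g,\delta_\xi\pi)$ obeys the linearized conditions: the fall-off of $(g_{ij}-\delta_{ij},\pi^{ij})$, with vanishing $O(1)$ term in $\delta_\xi g_{rA}$, the same parities of $\delta_\xi\bar\lambda,\delta_\xi\bar k_{AB},\delta_\xi\bar p,\delta_\xi\bar\pi^{rA},\delta_\xi\bar\pi^{AB}$, and $\delta_\xi\mathcal H=o(r^{-1})$, $\delta_\xi\mathcal H_r=o(r^{-1})$, $\delta_\xi\mathcal H_A=o(1)$. **(1)** At every $(g,\pi)$ satisfying the new boundary conditions, such a deformation preserves them if and only if $f=-b\bar\lambda-b\bar k+T$ with $T$ even, and $W$ is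 odd. **(2)** For every such deformation (no parity of $W$ or $T:=f+b\bar\lambda+b\bar k$ being assumed), $(\delta_\xi g,\delta_\xi\pi)$ has the above fall-off, and $$\delta_\xi\bar\lambda=\tfrac{b}{4\sqrt{\bar\gamma}}\bar p+Y^C\partial_C\bar\lambda,$$ $$\delta_\xi\bar k_{AB}=\mathcal L_Y\bar k_{AB}+\bar D_A\bar D_BW+W\bar\gamma_{AB}+\tfrac{b}{\sqrt{\bar\gamma}}(\bar\pi_{AB}-\bar\gamma_{AB}\bar\pi)+\tfrac1{\sqrt{\bar\gamma}}\bar D_A(b\bar\pi^{rC}\bar\gamma_{CB})+\tfrac1{\sqrt{\bar\gamma}}\bar D_B(b\bar\pi^{rC}\bar\gamma_{CA}),$$ $$\delta_\xi\bar p=\mathcal L_Y\bar p+\sqrt{\bar\gamma}\,(4b\bar D_C\bar D^C\bar\lambda+4\bar D^Cb\,\partial_C\bar\lambda+12b\bar\lambda),$$ $$\delta_\xi\bar\pi^{rA}=\mathcal L_Y\bar\pi^{rA}+\sqrt{\bar\gamma}\,(\bar D_B(b\bar k^{BA})+\bar D^Ab\,\bar k-\bar D^AT),$$ $$\begin{aligned}\delta_\xi\bar\pi^{AB}={}&\mathcal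 L_Y\bar\pi^{AB}+\sqrt{\bar\gamma}(\bar D^A\bar D^BT-\bar\gamma^{AB}\bar D_C\bar D^CT)+3b\sqrt{\bar\gamma}(\bar k^{AB}-\bar\gamma^{AB}\bar k)\\&+\sqrt{\bar\gamma}\,b\,(\bar\gamma^{AB}\bar D_C\bar D^C\bar k+\bar D_C\bar D^C\bar k^{AB}-\bar D_C\bar D^A\bar k^{CB}-\bar D_C\bar D^B\bar k^{CA})\\&+\sqrt{\bar\gamma}\,\big(-\bar D^Ab\bar D^B\bar k-\bar D^Bb\bar D^A\bar k+\bar\gamma^{AB}\bar D_Cb\bar D^C\bar k+2\bar\gamma^{AB}\bar D^D\bar k^C_D\partial_Cb\\&\qquad-\bar D^A\bar k^{BC}\partial_Cb-\bar D^B\bar k^{AC}\partial_Cb+\bar D^C\bar k^{AB}\partial_Cb\big).\end{aligned}$$ If $T$ is even and $W$ is odd, these variations have the parities required by the new boundary conditions. **(3)** For all real $m$ and $a$, the Schwarzschild data (on slices of constant Schwarzschild time) and the Kerr data (on slices of constant Boyer–Lindquist time) satisfy the new boundary conditions once the usual radial coordinate is replaced by $r-m$ (so the new coordinate $r$ is the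 old one plus $m$); then $\bar k_{AB}=0$ for both, and $\bar\pi^{rA}=0$. -/

import Mathlib

open scoped ContDiff

noncomputable section

namespace AsympFlat

/-- Euclidean three-space. The points `x` with `‖x‖` large form the asymptotic end of the spatial
slice; the Cartesian coordinates are `x 0`, `x 1`, `x 2` and `r = ‖x‖`. -/
abbrev E : Type := EuclideanSpace ℝ (Fin 3)

/-- Cartesian components of a vector field (on the end, or tangent to the unit sphere). -/
abbrev VecField : Type := Fin 3 → E → ℝ

/-- Cartesian components of a field with two indices (on the end, or tangent to the sphere). -/
abbrev Field2 : Type := Fin 3 → Fin 3 → E → ℝ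

/-- Cartesian components of a field with three indices. -/
abbrev Field3 : Type := Fin 3 → Fin 3 → Fin 3 → E → ℝ

/-- Kronecker delta. -/
def kd (i j : Fin 3) : ℝ := if i = j then 1 else 0

/-- The partial derivative `∂ᵢ u` in Cartesian coordinates. -/
def pd (i : Fin 3) (u : E → ℝ) (x : E) : ℝ := fderiv ℝ u x (EuclideanSpace.single i 1)

/-- The radial unit vector `n = x / r`. -/
def nrm (i : Fin 3) (x : E) : ℝ := x i / ‖x‖

/-- The projector `δᵢⱼ - nᵢ nⱼ` on the tangent space of the sphere through `x`. On the unit sphere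
these are the Cartesian components of the round unit metric `γ̄`. -/
def proj (i j : Fin 3) (x : E) : ℝ := kd i j - nrm i x * nrm j x

/-! ### Functions and tensors on the unit sphere

A function on the unit sphere is identified with its extension to `x ≠ 0` that is constant along
rays. A tensor field on the sphere is given by the Cartesian components (in `ℝ³`) of a tangential
tensor; contractions over tangential indices are then ordinary sums and index positions
(with respect to `γ̄`) do not matter. A density on the sphere is given by its quotient by
the density `√γ̄` of the unit round metric.

Parity: use coordinates `x^A` near `n` and near `-n` such that the antipodal map is `x^A ↦ -x^A`.
The embedding `X` of the sphere then satisfies `X(-x) = -X(x)`, so that `∂_A X` is the same vector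
of `ℝ³` at `n` and at `-n`, and `√γ̄` takes the same value. Hence a tensor (density) has even or odd
components in these coordinates exactly when its Cartesian components are even or odd functions on
the sphere. -/

/-- A smooth function on the unit sphere, extended to be constant along rays. -/
structure IsSphereFn (u : E → ℝ) : Prop where
  smooth : ContDiffOn ℝ ∞ u {x | x ≠ 0}
  homogeneous : ∀ (t : ℝ) (x : E), 0 < t → u (t • x) = u x

/-- A smooth vector field tangent to the unit sphere. -/
structure IsSphereVec (V : VecField) : Prop where
  sphereFn : ∀ a, IsSphereFn (V a)
  tangent : ∀ x : E, x ≠ 0 → ∑ a, nrm a x * V a x = 0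

/-- A smooth symmetric two-tensor on the unit sphere. -/
structure IsSphereSym (k : Field2) : Prop where
  sphereFn : ∀ a c, IsSphereFn (k a c)
  symm : ∀ a c (x : E), x ≠ 0 → k a c x = k c a x
  tangent : ∀ c (x : E), x ≠ 0 → ∑ a, nrm a x * k a c x = 0

/-- Even under the antipodal map. -/
def IsEven (u : E → ℝ) : Prop := ∀ x : E, x ≠ 0 → u (-x) = u x

/-- Odd under the antipodal map. -/
def IsOdd (u : E → ℝ) : Prop := ∀ x : E, x ≠ 0 → u (-x) = -u x

/-- The gradient `D̄_a u` of a function on the unit sphere. -/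
def D0 (u : E → ℝ) : VecField := fun a x => ‖x‖ * ∑ i, proj a i x * pd i u x

/-- `D1 V c a = D̄_c V_a`: the Levi-Civita derivative of the unit round metric, i.e. the tangential
projection of the derivative of the Cartesian components along the sphere. -/
def D1 (V : VecField) : Field2 := fun c a x => ∑ i, proj a i x * D0 (V i) c x

/-- `D2 k c a b = D̄_c k_{ab}`. -/
def D2 (k : Field2) : Field3 := fun c a b x =>
  ∑ i, ∑ j, proj a i x * proj b j x * D0 (k i j) c x

/-- `D3 t d c a b = D̄_d t_{cab}`. -/
def D3 (t : Field3) : Fin 3 → Field3 := fun d c a b x =>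
  ∑ i, ∑ j, ∑ l, proj c i x * proj a j x * proj b l x * D0 (t i j l) d x

/-- The trace `γ̄^{AB} k_{AB}` of a tensor on the unit sphere. -/
def trS (k : Field2) (x : E) : ℝ := ∑ a, k a a x

/-- The Laplacian `D̄_C D̄^C u`. -/
def lapS (u : E → ℝ) (x : E) : ℝ := ∑ a, D1 (D0 u) a a x

/-- Lie derivative along `Y` of a function on the sphere. -/
def lieFn (Y : VecField) (u : E → ℝ) (x : E) : ℝ := ∑ c, Y c x * D0 u c x

/-- Divergence `D̄_C Y^C`. -/
def divS (Y : VecField) (x : E) : ℝ := ∑ c, D1 Y c c x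

/-- Lie derivative along `Y` of a covariant two-tensor on the sphere. -/
def lieCov (Y : VecField) (k : Field2) : Field2 := fun a b x =>
  ∑ c, (Y c x * D2 k c a b x + k c b x * D1 Y a c x + k a c x * D1 Y b c x)

/-- Lie derivative along `Y` of a scalar density on the sphere (divided by `√γ̄`). -/
def lieDens (Y : VecField) (u : E → ℝ) (x : E) : ℝ := lieFn Y u x + divS Y x * u x

/-- Lie derivative along `Y` of a vector density on the sphere (divided by `√γ̄`). -/
def lieVecDens (Y : VecField) (V : VecField) : VecField := fun a x =>
  ∑ c, (Y c x * D1 V c a x - V c x * D1 Y c a x) + divS Y x * V a x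

/-- Lie derivative along `Y` of a contravariant two-tensor density on the sphere (divided by
`√γ̄`). -/
def lieConDens (Y : VecField) (q : Field2) : Field2 := fun a b x =>
  ∑ c, (Y c x * D2 q c a b x - q c b x * D1 Y c a x - q a c x * D1 Y c b x)
    + divS Y x * q a b x

/-! ### Asymptotic expansions at spatial infinity -/

/-- `R = o(r^k)` at infinity, in the sense that may be differentiated: `R` is smooth near infinity,
and its derivatives of order `n` in Cartesian coordinates are `o(r^{k-n})` (each `∂_r` gains a power
of `1/r`, derivatives along the sphere preserve the order). -/
def IsRemainder (R : E → ℝ) (k : ℤ) : Prop :=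
  (∃ ρ : ℝ, 0 < ρ ∧ ContDiffOn ℝ ∞ R {x | ρ < ‖x‖}) ∧
    ∀ n : ℕ, (fun x => iteratedFDeriv ℝ n R x) =o[Bornology.cobounded E]
      fun x => ‖x‖ ^ (k - (n : ℤ))

/-- `F = r^k F₁ + r^{k-1} F₂ + o(r^{k-1})` for some function `F₂` on the sphere. -/
def HasExpansion (F : E → ℝ) (k : ℤ) (F₁ : E → ℝ) : Prop :=
  ∃ F₂ : E → ℝ, IsSphereFn F₂ ∧
    IsRemainder (fun x => F x - ‖x‖ ^ k * F₁ x - ‖x‖ ^ (k - 1) * F₂ x) (k - 1)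

/-! ### Spherical components

The coordinate vector fields `∂/∂x^A` at radius `r` are `r` times those of the unit sphere, and the
Cartesian components of a density of weight one are multiplied by `r² √γ̄` in spherical coordinates;
the factor `√γ̄` is divided out below. -/

/-- `q_{rr}` for a covariant field `q`. -/
def covRR (q : Field2) (x : E) : ℝ := ∑ i, ∑ j, nrm i x * nrm j x * q i j x

/-- `q_{rA}` for a covariant field `q`. -/
def covRA (q : Field2) : VecField := fun a x => ‖x‖ * ∑ i, ∑ j, proj a i x * nrm j x * q i j x

/-- `q_{AB}` for a covariant field `q`. -/
def covAB (q : Field2) : Field2 := fun a b x =>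
  ‖x‖ ^ 2 * ∑ i, ∑ j, proj a i x * proj b j x * q i j x

/-- `p^{rr} / √γ̄` for a contravariant density `p`. -/
def conRR (p : Field2) (x : E) : ℝ := ‖x‖ ^ 2 * ∑ i, ∑ j, nrm i x * nrm j x * p i j x

/-- `p^{rA} / √γ̄` for a contravariant density `p`. -/
def conRA (p : Field2) : VecField := fun a x =>
  ‖x‖ * ∑ i, ∑ j, proj a i x * nrm j x * p i j x

/-- `p^{AB} / √γ̄` for a contravariant density `p`. -/
def conAB (p : Field2) : Field2 := fun a b x =>
  ∑ i, ∑ j, proj a i x * proj b j x * p i j x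

/-- Leading coefficients `h̄_{rr}`, `h̄_{AB}`, `π̄^{rr}/√γ̄`, `π̄^{rA}/√γ̄`, `π̄^{AB}/√γ̄`. -/
structure BoundaryData where
  hrr : E → ℝ
  hAB : Field2
  prr : E → ℝ
  prA : VecField
  pAB : Field2

/-- The leading coefficients are smooth functions, vectors and symmetric tensors on the sphere. -/
structure BoundaryData.IsSmooth (d : BoundaryData) : Prop where
  hrr : IsSphereFn d.hrr
  hAB : IsSphereSym d.hAB
  prr : IsSphereFn d.prr
  prA : IsSphereVec d.prA
  pAB : IsSphereSym d.pAB

/-- `λ̄ = h̄_{rr} / 2`. -/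
def BoundaryData.lam (d : BoundaryData) (x : E) : ℝ := d.hrr x / 2

/-- `k̄_{AB} = h̄_{AB} / 2 + λ̄ γ̄_{AB}`. -/
def BoundaryData.k (d : BoundaryData) : Field2 := fun a b x =>
  d.hAB a b x / 2 + d.lam x * proj a b x

/-- `p̄ = 2 (π̄^{rr} - π̄^A_A)`, divided by `√γ̄`. -/
def BoundaryData.p (d : BoundaryData) (x : E) : ℝ := 2 * (d.prr x - trS d.pAB x)

/-- Fall-off of the deviation `q` of the metric from the flat metric and of the momentum `p`,
with leading coefficients `d`; the leading term of the mixed components of the metric vanishes. -/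
structure HasFalloff (q p : Field2) (d : BoundaryData) : Prop where
  symm_metric : ∀ᶠ x in Bornology.cobounded E, ∀ i j, q i j x = q j i x
  symm_momentum : ∀ᶠ x in Bornology.cobounded E, ∀ i j, p i j x = p j i x
  smooth : d.IsSmooth
  rr : HasExpansion (covRR q) (-1) d.hrr
  rA : ∀ a, HasExpansion (covRA q a) 0 (fun _ => 0)
  AB : ∀ a b, HasExpansion (covAB q a b) 1 (d.hAB a b)
  prr : HasExpansion (conRR p) 0 d.prr
  prA : ∀ a, HasExpansion (conRA p a) (-1) (d.prA a)
  pAB : ∀ a b, HasExpansion (conAB p a b) (-2) (d.pAB a b)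

/-- The new parity conditions: `λ̄ ∼ π̄^{AB}` even and `p̄ ∼ k̄_{AB} ∼ π̄^{rA}` odd. -/
structure NewParity (d : BoundaryData) : Prop where
  lam : IsEven d.lam
  pAB : ∀ a b, IsEven (d.pAB a b)
  p : IsOdd d.p
  k : ∀ a b, IsOdd (d.k a b)
  prA : ∀ a, IsOdd (d.prA a)

/-! ### The canonical formalism in Cartesian coordinates -/

/-- The inverse metric. -/
def invMetric (g : Field2) : Field2 := fun i j x => (Matrix.of fun k l => g k l x)⁻¹ i j

/-- The density `√(det g)`. -/
def sqrtDet (g : Field2) (x : E) : ℝ := Real.sqrt (Matrix.of fun k l => g k l x).det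

/-- Christoffel symbols: `christoffel g k i j` is `Γ^k_{ij}`. -/
def christoffel (g : Field2) : Field3 := fun k i j x =>
  (1 / 2) * ∑ l, invMetric g k l x * (pd i (g l j) x + pd j (g i l) x - pd l (g i j) x)

/-- The Ricci tensor `R_{ij}`. -/
def ricci (g : Field2) : Field2 := fun i j x =>
  ∑ k, (pd k (christoffel g k i j) x - pd j (christoffel g k i k) x)
    + ∑ k, ∑ l, (christoffel g k k l x * christoffel g l i j x
        - christoffel g k j l x * christoffel g l i k x)

/-- Raising both indices. -/
def raise (g q : Field2) : Field2 := fun i j x =>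
  ∑ k, ∑ l, invMetric g i k x * invMetric g j l x * q k l x

/-- Lowering both indices. -/
def lower (g p : Field2) : Field2 := fun i j x => ∑ k, ∑ l, g i k x * g j l x * p k l x

/-- Trace of a covariant field. -/
def trCov (g q : Field2) (x : E) : ℝ := ∑ i, ∑ j, invMetric g i j x * q i j x

/-- Trace of a contravariant field. -/
def trCon (g p : Field2) (x : E) : ℝ := ∑ i, ∑ j, g i j x * p i j x

/-- The square `p_{ij} p^{ij}`. -/
def sqCon (g p : Field2) (x : E) : ℝ := ∑ i, ∑ j, lower g p i j x * p i j x

/-- The scalar curvature. -/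
def scalarCurv (g : Field2) (x : E) : ℝ := trCov g (ricci g) x

/-- The covariant Hessian `ξ_{|ij}`. -/
def hess (g : Field2) (ξ : E → ℝ) : Field2 := fun i j x =>
  pd i (pd j ξ) x - ∑ k, christoffel g k i j x * pd k ξ x

/-- The Lie derivative of a covariant field along `X`. -/
def lieMetric (X : VecField) (g : Field2) : Field2 := fun i j x =>
  ∑ m, (X m x * pd m (g i j) x + g m j x * pd i (X m) x + g i m x * pd j (X m) x)

/-- The Lie derivative of a contravariant density of weight one along `X`. -/
def lieMomentum (X : VecField) (p : Field2) : Field2 := fun i j x =>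
  ∑ m, (pd m (fun y => p i j y * X m y) x - pd m (X i) x * p m j x - pd m (X j) x * p i m x)

/-- The variation `δ_ξ g_{ij}` under the surface deformation with normal component `ξ` and
tangential components `X`. -/
def deltaMetric (g p : Field2) (ξ : E → ℝ) (X : VecField) : Field2 := fun i j x =>
  2 * ξ x * (sqrtDet g x)⁻¹ * (lower g p i j x - (1 / 2) * g i j x * trCon g p x)
    + lieMetric X g i j x

/-- The variation `δ_ξ π^{ij}` under the surface deformation with normal component `ξ` and
tangential components `X`. -/
def deltaMomentum (g p : Field2) (ξ : E → ℝ) (X : VecField) : Field2 := fun i j x =>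
  -(ξ x * sqrtDet g x * (raise g (ricci g) i j x - (1 / 2) * invMetric g i j x * scalarCurv g x))
    + (1 / 2) * ξ x * (sqrtDet g x)⁻¹ * invMetric g i j x
        * (sqCon g p x - (1 / 2) * trCon g p x ^ 2)
    - 2 * ξ x * (sqrtDet g x)⁻¹
        * ((∑ m, ∑ l, p i m x * g m l x * p l j x) - (1 / 2) * p i j x * trCon g p x)
    + sqrtDet g x * (raise g (hess g ξ) i j x - invMetric g i j x * trCov g (hess g ξ) x)
    + lieMomentum X p i j x

/-- The Hamiltonian constraint `𝓗`. -/
def hamConstraint (g p : Field2) (x : E) : ℝ :=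
  (sqrtDet g x)⁻¹ * (sqCon g p x - (1 / 2) * trCon g p x ^ 2) - sqrtDet g x * scalarCurv g x

/-- The momentum constraint `𝓗_i = -2 π_i^j_{|j}`. -/
def momConstraint (g p : Field2) : VecField := fun i x =>
  -2 * ∑ k, g i k x * ((∑ j, pd j (p k j) x) + ∑ j, ∑ l, christoffel g k j l x * p j l x)

/-- `𝓗 = o(r⁻¹)`, `𝓗_r = o(r⁻¹)`, `𝓗_A = o(1)` in spherical coordinates, for constraint
densities with Cartesian components `H` and `M`. -/
structure ConstraintFalloff (H : E → ℝ) (M : VecField) : Prop where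
  ham : (fun x => ‖x‖ ^ 2 * H x) =o[Bornology.cobounded E] fun x => ‖x‖⁻¹
  rad : (fun x => ‖x‖ ^ 2 * ∑ i, nrm i x * M i x) =o[Bornology.cobounded E] fun x => ‖x‖⁻¹
  ang : ∀ a, (fun x => ‖x‖ ^ 3 * ∑ i, proj a i x * M i x) =o[Bornology.cobounded E]
    fun _ => (1 : ℝ)

/-- The complete set of new boundary conditions for the spatial metric `g` and its conjugate
momentum `p`, with leading coefficients `d`. (The flat metric has the spherical components
`1`, `0`, `r² γ̄_{AB}`.) -/
structure NewBoundaryConditions (g p : Field2) (d : BoundaryData) : Prop where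
  falloff : HasFalloff (fun i j x => g i j x - kd i j) p d
  parity : NewParity d
  constraints : ConstraintFalloff (hamConstraint g p) (momConstraint g p)

/-- First variation at `(g, p)` of the Hamiltonian constraint in the direction `(dg, dp)`. -/
def varHam (g p dg dp : Field2) (x : E) : ℝ :=
  deriv (fun s : ℝ => hamConstraint (fun i j y => g i j y + s * dg i j y)
    (fun i j y => p i j y + s * dp i j y) x) 0

/-- First variation at `(g, p)` of the momentum constraint in the direction `(dg, dp)`. -/
def varMom (g p dg dp : Field2) : VecField := fun m x =>
  deriv (fun s : ℝ => momConstraint (fun i j y => g i j y + s * dg i j y)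
    (fun i j y => p i j y + s * dp i j y) m x) 0

/-- The infinitesimal deformation `(ξ, X)` preserves the new boundary conditions at `(g, p)`: the
variation of the fields satisfies the linearized boundary conditions (same fall-off, same parity
conditions on its leading coefficients, same fall-off of the variation of the constraints). -/
def PreservesNewBoundaryConditions (g p : Field2) (ξ : E → ℝ) (X : VecField) : Prop :=
  (∃ d' : BoundaryData, HasFalloff (deltaMetric g p ξ X) (deltaMomentum g p ξ X) d' ∧
      NewParity d') ∧
    ConstraintFalloff (varHam g p (deltaMetric g p ξ X) (deltaMomentum g p ξ X))
      (varMom g p (deltaMetric g p ξ X) (deltaMomentum g p ξ X))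

/-- `I^A = (2 b / √γ̄) π̄^{rA} + D̄^A W`. -/
def mixedCorrection (d : BoundaryData) (b W : E → ℝ) : VecField := fun a x =>
  2 * b x * d.prA a x + D0 W a x

/-- Surface deformations `ξ = r b + f + O(r⁻¹)`, `ξ^r = W + O(r⁻¹)`,
`ξ^A = Y^A + I^A / r + O(r⁻²)`, with `b` a boost, `Y` a rotation and `I` as above. The `O`-terms
consist of a term of the indicated order with a coefficient on the sphere, and a remainder of
smaller order. -/
structure IsDeformation (d : BoundaryData) (b f W : E → ℝ) (Y : VecField)
    (ξ : E → ℝ) (X : VecField) : Prop where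
  b_smooth : IsSphereFn b
  f_smooth : IsSphereFn f
  W_smooth : IsSphereFn W
  Y_smooth : IsSphereVec Y
  boost : ∀ a c (x : E), x ≠ 0 → D1 (D0 b) a c x + proj a c x * b x = 0
  killing : ∀ a c (x : E), x ≠ 0 → D1 Y a c x + D1 Y c a x = 0
  normal : HasExpansion (fun x => ξ x - ‖x‖ * b x) 0 f
  radial : HasExpansion (fun x => ∑ i, nrm i x * X i x) 0 W
  angular : ∀ a, HasExpansion (fun x => ‖x‖⁻¹ * (∑ i, proj a i x * X i x) - Y a x) (-1)
    (mixedCorrection d b W a)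

/-- The transformation laws: `d'` is the variation of the leading coefficients `d` (densities are
divided by `√γ̄`). -/
structure TransformationLaws (d : BoundaryData) (b W T : E → ℝ) (Y : VecField)
    (d' : BoundaryData) : Prop where
  lam : ∀ x : E, x ≠ 0 → d'.lam x = b x / 4 * d.p x + ∑ c, Y c x * D0 d.lam c x
  k : ∀ a c (x : E), x ≠ 0 → d'.k a c x =
    lieCov Y d.k a c x + D1 (D0 W) a c x + W x * proj a c x
      + b x * (d.pAB a c x - proj a c x * trS d.pAB x)
      + D1 (fun e y => b y * d.prA e y) a c x + D1 (fun e y => b y * d.prA e y) c a x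
  p : ∀ x : E, x ≠ 0 → d'.p x =
    lieDens Y d.p x + (4 * b x * lapS d.lam x + 4 * ∑ c, D0 b c x * D0 d.lam c x
      + 12 * b x * d.lam x)
  prA : ∀ a (x : E), x ≠ 0 → d'.prA a x =
    lieVecDens Y d.prA a x
      + ((∑ c, D2 (fun e m y => b y * d.k e m y) c c a x) + D0 b a x * trS d.k x - D0 T a x)
  pAB : ∀ a c (x : E), x ≠ 0 → d'.pAB a c x =
    lieConDens Y d.pAB a c x
      + (D1 (D0 T) a c x - proj a c x * lapS T x)
      + 3 * b x * (d.k a c x - proj a c x * trS d.k x)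
      + b x * (proj a c x * lapS (trS d.k) x
          + ∑ m, (D3 (D2 d.k) m m a c x - D3 (D2 d.k) m a m c x - D3 (D2 d.k) m c m a x))
      + (-(D0 b a x * D0 (trS d.k) c x) - D0 b c x * D0 (trS d.k) a x
          + proj a c x * ∑ m, D0 b m x * D0 (trS d.k) m x
          + 2 * proj a c x * ∑ m, ∑ e, D2 d.k e m e x * D0 b m x
          - ∑ m, D2 d.k a c m x * D0 b m x
          - ∑ m, D2 d.k c a m x * D0 b m x
          + ∑ m, D2 d.k m a c x * D0 b m x)

/-! ### Schwarzschild and Kerr -/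

/-- The Schwarzschild metric on the slices of constant time,
`(1 - 2m/R)⁻¹ dR² + R² dΩ²`, with the Schwarzschild radial coordinate `R = r - m`. -/
def schwarzschildMetric (m : ℝ) : Field2 := fun i j x =>
  (1 - 2 * m / (‖x‖ - m))⁻¹ * (nrm i x * nrm j x) + ((‖x‖ - m) / ‖x‖) ^ 2 * proj i j x

/-- `Σ = R² + a² cos² θ` with `R = r - m`. -/
def kerrSigma (m a : ℝ) (x : E) : ℝ := (‖x‖ - m) ^ 2 + a ^ 2 * nrm 2 x ^ 2

/-- `Δ = R² - 2 m R + a²` with `R = r - m`. -/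
def kerrDelta (m a : ℝ) (x : E) : ℝ := (‖x‖ - m) ^ 2 - 2 * m * (‖x‖ - m) + a ^ 2

/-- `A = (R² + a²)² - a² Δ sin² θ` with `R = r - m`. -/
def kerrA (m a : ℝ) (x : E) : ℝ :=
  ((‖x‖ - m) ^ 2 + a ^ 2) ^ 2 - a ^ 2 * kerrDelta m a x * (1 - nrm 2 x ^ 2)

/-- The generator `∂/∂φ` of rotations about the third axis. -/
def axialField : VecField := fun i x => ![-(x 1), x 0, 0] i

/-- The Kerr metric on the slices of constant Boyer-Lindquist time,
`(Σ/Δ) dR² + Σ dθ² + (A/Σ) sin²θ dφ²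
  = (Σ/Δ) dR² + Σ (dθ² + sin²θ dφ²) + a² (1 + 2mR/Σ) (sin²θ dφ)²`,
with Boyer-Lindquist radial coordinate `R = r - m`; note `r² sin²θ dφ = x dy - y dx`. -/
def kerrMetric (m a : ℝ) : Field2 := fun i j x =>
  kerrSigma m a x / kerrDelta m a x * (nrm i x * nrm j x)
    + kerrSigma m a x / ‖x‖ ^ 2 * proj i j x
    + a ^ 2 * (1 + 2 * m * (‖x‖ - m) / kerrSigma m a x)
        * (axialField i x / ‖x‖ ^ 2) * (axialField j x / ‖x‖ ^ 2)

/-- The lapse `√(Σ Δ / A)` of the Boyer-Lindquist slices. -/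
def kerrLapse (m a : ℝ) (x : E) : ℝ :=
  Real.sqrt (kerrSigma m a x * kerrDelta m a x / kerrA m a x)

/-- The shift `-(2 m a R / A) ∂/∂φ` of the Boyer-Lindquist slices. -/
def kerrShift (m a : ℝ) : VecField := fun i x =>
  -(2 * m * a * (‖x‖ - m) / kerrA m a x) * axialField i x

/-- The momentum of a slice of a stationary spacetime with spatial metric `g`, lapse `N` and shift
`β`: the solution `π` of `0 = 2 N g^{-1/2} (π_{ij} - g_{ij} π / 2) + 𝓛_β g_{ij}`. -/
def stationaryMomentum (g : Field2) (N : E → ℝ) (β : VecField) : Field2 := fun i j x =>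
  -(sqrtDet g x / (2 * N x)) *
    (raise g (lieMetric β g) i j x - invMetric g i j x * trCov g (lieMetric β g) x)

/-- The momentum of the Boyer-Lindquist slices of the Kerr spacetime. -/
def kerrMomentum (m a : ℝ) : Field2 :=
  stationaryMomentum (kerrMetric m a) (kerrLapse m a) (kerrShift m a)

end AsympFlat

end

open AsympFlat

/-! In Cartesian components every field in the theorem has an expansion at infinity whose terms are
smooth homogeneous functions on the punctured space. The metric deviation has degree -1 and the
momentum has degree -2, and fall-off, parity, transformation laws and the order of the constraints
are all decided by the leading homogeneous terms. These form a commutative ring `SF` with three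
commuting derivations, so once expansions are known to be stable under products, derivatives,
inverses and square roots (`Exp`, and `FExp` for families differentiated in a parameter), what
remains is algebra in that ring.

At leading order the constraints are linear: the double divergence of the metric deviation minus the
Laplacian of its trace, and the divergence of the momentum (`constraints_iff`,
`varConstraints_iff`). A boost is a function $rb$ with zero Hessian and a rotation $rY$ is a flat
Killing field. The terms of too high order in $\delta g$ and $\delta\pi$ therefore vanish, and the
leading terms `leadMetric` and `leadMomentum` solve the linearized constraints again, by gauge
invariance, invariance under rotations and the linearized Bianchi identity (`leadHam_leadMetric`,
`leadDiv_leadMomentum`).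

For the transformation laws, symmetric tensors are split into tangential, mixed and radial parts. In
$\delta g$ the prescribed $I^A$ cancels the mixed part (`leadMetric_eq`). In $\delta\pi$ the mixed
part is found by contraction with the radial direction, the tangential part is computed modulo
normal terms, and the radial part follows from the trace and the Hamiltonian constraint
(`leadMomentum_eq`). The shift $-b\bar\lambda-b\bar k$ in $f$ removes $\bar\lambda$ from the mixed
and tangential momentum.

For parity, $b$ and the Cartesian components of $Y$ are odd, because $rb$ and $rY$ have zero
Hessian. All terms without $T$ and $W$ then have the required parity. The conditions on $T$ and $W$
are necessary as well (`HasParity.variation_iff`): the odd part of $T$ has zero gradient, hence is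
constant, hence vanishes; the even part of $W$ solves the boost equation, hence is odd, hence
vanishes.

For the examples, the shift of the radius by $m$ gives $\bar\lambda=m$ and $\bar
h_{AB}=-2m\bar\gamma_{AB}$, so $\bar k=0$. The Kerr parameter $a$ and the Kerr momentum enter only
at lower orders (`newBoundaryConditions_of_exp`). -/

noncomputable section
namespace AsympFlat

open Filter Asymptotics Bornology Topology

/-! ### Symbol classes at spatial infinity -/

theorem eventually_far (ρ : ℝ) : ∀ᶠ x in cobounded E, ρ < ‖x‖ :=
  tendsto_norm_cobounded_atTop.eventually_gt_atTop ρ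

theorem isOpen_far (ρ : ℝ) : IsOpen {x : E | ρ < ‖x‖} := isOpen_lt continuous_const continuous_norm

theorem isOpen_punctured : IsOpen {x : E | x ≠ 0} := isOpen_ne

/-- The symbol classes: like `IsRemainder`, with `O` in place of `o`. -/
def IsSymbol (R : E → ℝ) (k : ℤ) : Prop :=
  (∃ ρ : ℝ, 0 < ρ ∧ ContDiffOn ℝ ∞ R {x | ρ < ‖x‖}) ∧
    ∀ n : ℕ, (fun x => iteratedFDeriv ℝ n R x) =O[cobounded E] fun x => ‖x‖ ^ (k - (n : ℤ))

theorem contDiffOn_far_common {F G : E → ℝ}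
    (hF : ∃ ρ : ℝ, 0 < ρ ∧ ContDiffOn ℝ ∞ F {x | ρ < ‖x‖})
    (hG : ∃ ρ : ℝ, 0 < ρ ∧ ContDiffOn ℝ ∞ G {x | ρ < ‖x‖}) :
    ∃ ρ : ℝ, 0 < ρ ∧ ContDiffOn ℝ ∞ F {x | ρ < ‖x‖} ∧ ContDiffOn ℝ ∞ G {x | ρ < ‖x‖} := by
  obtain ⟨a, ha, h1⟩ := hF
  obtain ⟨b, hb, h2⟩ := hG
  exact ⟨max a b, lt_max_of_lt_left ha, h1.mono fun x hx => (le_max_left a b).trans_lt hx,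
    h2.mono fun x hx => (le_max_right a b).trans_lt hx⟩

theorem contDiffAt_eventually {F : E → ℝ} (hF : ∃ ρ : ℝ, 0 < ρ ∧ ContDiffOn ℝ ∞ F {x | ρ < ‖x‖}) :
    ∀ᶠ x in cobounded E, ContDiffAt ℝ ∞ F x := by
  obtain ⟨a, -, h⟩ := hF
  filter_upwards [eventually_far a] with x hx
  exact h.contDiffAt ((isOpen_far a).mem_nhds hx)

/-- A set in the filter `cobounded E` contains the exterior of a ball, which is open. Agreement near
infinity thus passes to germs, and so to all derivatives. -/
theorem iteratedFDeriv_congr_far {F G : E → ℝ} (h : ∀ᶠ x in cobounded E, F x = G x) (n : ℕ) :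
    (fun x => iteratedFDeriv ℝ n F x) =ᶠ[cobounded E] fun x => iteratedFDeriv ℝ n G x := by
  obtain ⟨ρ, -, hρ⟩ := (hasBasis_cobounded_norm (E := E)).eventually_iff.1 h
  filter_upwards [eventually_far ρ] with x hx
  have : F =ᶠ[𝓝 x] G := by
    filter_upwards [(isOpen_far ρ).mem_nhds hx] with y hy
    exact hρ (le_of_lt hy)
  exact this.iteratedFDeriv ℝ n |>.eq_of_nhds

theorem contDiffOn_congr_far {F G : E → ℝ} (h : ∀ᶠ x in cobounded E, F x = G x)
    (hF : ∃ ρ : ℝ, 0 < ρ ∧ ContDiffOn ℝ ∞ F {x | ρ < ‖x‖}) :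
    ∃ ρ : ℝ, 0 < ρ ∧ ContDiffOn ℝ ∞ G {x | ρ < ‖x‖} := by
  obtain ⟨ρ, -, hρ⟩ := (hasBasis_cobounded_norm (E := E)).eventually_iff.1 h
  obtain ⟨a, ha, h1⟩ := hF
  refine ⟨max a ρ, lt_max_of_lt_left ha, (h1.mono fun x hx => ?_).congr fun x hx => ?_⟩
  · exact (le_max_left a ρ).trans_lt hx
  · exact (hρ ((le_max_right a ρ).trans (le_of_lt hx))).symm

theorem IsSymbol.congr {F G : E → ℝ} {k : ℤ} (hF : IsSymbol F k)
    (h : ∀ᶠ x in cobounded E, F x = G x) : IsSymbol G k :=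
  ⟨contDiffOn_congr_far h hF.1, fun n => (hF.2 n).congr' (iteratedFDeriv_congr_far h n) .rfl⟩

theorem IsRemainder.congr {F G : E → ℝ} {k : ℤ} (hF : IsRemainder F k)
    (h : ∀ᶠ x in cobounded E, F x = G x) : IsRemainder G k :=
  ⟨contDiffOn_congr_far h hF.1, fun n => (hF.2 n).congr' (iteratedFDeriv_congr_far h n) .rfl⟩

theorem IsRemainder.isSymbol {F : E → ℝ} {k : ℤ} (hF : IsRemainder F k) : IsSymbol F k :=
  ⟨hF.1, fun n => (hF.2 n).isBigO⟩

theorem zpow_isLittleO {k l : ℤ} (h : k < l) :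
    (fun x : E => ‖x‖ ^ k) =o[cobounded E] fun x => ‖x‖ ^ l := by
  have h1 : (fun r : ℝ => r ^ k) =o[atTop] fun r => r ^ l := by
    refine (isLittleO_iff_tendsto' ?_).2 ?_
    · filter_upwards [eventually_gt_atTop 0] with r hr h0
      exact absurd h0 (zpow_ne_zero _ hr.ne')
    · have h2 : Tendsto (fun r : ℝ => r ^ (k - l)) atTop (𝓝 0) := by
        obtain ⟨n, hn⟩ := Int.eq_ofNat_of_zero_le (by omega : 0 ≤ l - k)
        have hn0 : n ≠ 0 := by omega
        have := tendsto_pow_neg_atTop (𝕜 := ℝ) hn0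
        refine this.congr fun r => ?_
        rw [← hn]; congr 1; omega
      refine h2.congr' ?_
      filter_upwards [eventually_gt_atTop 0] with r hr
      rw [zpow_sub₀ hr.ne']
  exact h1.comp_tendsto tendsto_norm_cobounded_atTop

/-- A gain of one integer order turns `O` into `o`. Lower-order terms are discarded in this way
throughout. -/
theorem IsSymbol.isRemainder {F : E → ℝ} {k l : ℤ} (hF : IsSymbol F k) (h : k < l) :
    IsRemainder F l :=
  ⟨hF.1, fun n => (hF.2 n).trans_isLittleO (zpow_isLittleO (by omega))⟩

theorem iteratedFDeriv_add_far {F G : E → ℝ}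
    (hF : ∃ ρ : ℝ, 0 < ρ ∧ ContDiffOn ℝ ∞ F {x | ρ < ‖x‖})
    (hG : ∃ ρ : ℝ, 0 < ρ ∧ ContDiffOn ℝ ∞ G {x | ρ < ‖x‖}) (n : ℕ) :
    (fun x => iteratedFDeriv ℝ n F x + iteratedFDeriv ℝ n G x) =ᶠ[cobounded E]
      fun x => iteratedFDeriv ℝ n (fun y => F y + G y) x := by
  filter_upwards [contDiffAt_eventually hF, contDiffAt_eventually hG] with x h1 h2
  exact (iteratedFDeriv_add_apply (h1.of_le (mod_cast le_top)) (h2.of_le (mod_cast le_top))).symm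

theorem contDiffOn_add_far {F G : E → ℝ}
    (hF : ∃ ρ : ℝ, 0 < ρ ∧ ContDiffOn ℝ ∞ F {x | ρ < ‖x‖})
    (hG : ∃ ρ : ℝ, 0 < ρ ∧ ContDiffOn ℝ ∞ G {x | ρ < ‖x‖}) :
    ∃ ρ : ℝ, 0 < ρ ∧ ContDiffOn ℝ ∞ (fun x => F x + G x) {x | ρ < ‖x‖} := by
  obtain ⟨ρ, h0, h1, h2⟩ := contDiffOn_far_common hF hG
  exact ⟨ρ, h0, h1.add h2⟩

theorem IsSymbol.add {F G : E → ℝ} {k : ℤ} (hF : IsSymbol F k) (hG : IsSymbol G k) :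
    IsSymbol (fun x => F x + G x) k :=
  ⟨contDiffOn_add_far hF.1 hG.1, fun n =>
    ((hF.2 n).add (hG.2 n)).congr' (iteratedFDeriv_add_far hF.1 hG.1 n) .rfl⟩

theorem IsRemainder.add {F G : E → ℝ} {k : ℤ} (hF : IsRemainder F k) (hG : IsRemainder G k) :
    IsRemainder (fun x => F x + G x) k :=
  ⟨contDiffOn_add_far hF.1 hG.1, fun n =>
    ((hF.2 n).add (hG.2 n)).congr' (iteratedFDeriv_add_far hF.1 hG.1 n) .rfl⟩

/-- Leibniz's rule as a single estimate, shared by the `O` and the `o` version of the product rule.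
-/
theorem norm_iteratedFDeriv_mul_far {F G : E → ℝ}
    (hF : ∃ ρ : ℝ, 0 < ρ ∧ ContDiffOn ℝ ∞ F {x | ρ < ‖x‖})
    (hG : ∃ ρ : ℝ, 0 < ρ ∧ ContDiffOn ℝ ∞ G {x | ρ < ‖x‖}) (n : ℕ) :
    (fun x => iteratedFDeriv ℝ n (fun y => F y * G y) x) =O[cobounded E]
      fun x => ∑ i ∈ Finset.range (n + 1), (n.choose i : ℝ) * ‖iteratedFDeriv ℝ i F x‖ *
        ‖iteratedFDeriv ℝ (n - i) G x‖ := by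
  obtain ⟨ρ, h0, h1, h2⟩ := contDiffOn_far_common hF hG
  refine IsBigO.of_bound 1 ?_
  filter_upwards [eventually_far ρ] with x hx
  have := norm_iteratedFDerivWithin_mul_le h1 h2 (isOpen_far ρ).uniqueDiffOn hx
    (n := n) (mod_cast le_top)
  simp only [iteratedFDerivWithin_of_isOpen _ (isOpen_far ρ) hx] at this
  rw [one_mul]
  exact this.trans (le_abs_self _)

theorem contDiffOn_mul_far {F G : E → ℝ}
    (hF : ∃ ρ : ℝ, 0 < ρ ∧ ContDiffOn ℝ ∞ F {x | ρ < ‖x‖})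
    (hG : ∃ ρ : ℝ, 0 < ρ ∧ ContDiffOn ℝ ∞ G {x | ρ < ‖x‖}) :
    ∃ ρ : ℝ, 0 < ρ ∧ ContDiffOn ℝ ∞ (fun x => F x * G x) {x | ρ < ‖x‖} := by
  obtain ⟨ρ, h0, h1, h2⟩ := contDiffOn_far_common hF hG
  exact ⟨ρ, h0, h1.mul h2⟩

theorem zpow_mul_far (k l : ℤ) {n i : ℕ} (hi : i ∈ Finset.range (n + 1)) :
    (fun x : E => ‖x‖ ^ (k - i) * ‖x‖ ^ (l - (n - i : ℕ))) =ᶠ[cobounded E]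
      fun x => ‖x‖ ^ (k + l - n) := by
  filter_upwards [eventually_far 0] with x hx
  rw [← zpow_add₀ hx.ne']
  congr 1
  have := Finset.mem_range.1 hi
  push_cast [Nat.cast_sub (Nat.lt_succ_iff.1 this)]
  ring

theorem IsSymbol.mul {F G : E → ℝ} {k l : ℤ} (hF : IsSymbol F k) (hG : IsSymbol G l) :
    IsSymbol (fun x => F x * G x) (k + l) := by
  refine ⟨contDiffOn_mul_far hF.1 hG.1, fun n =>
    (norm_iteratedFDeriv_mul_far hF.1 hG.1 n).trans (IsBigO.fun_sum fun i hi => ?_)⟩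
  exact (((hF.2 i).norm_left.const_mul_left _).mul (hG.2 (n - i)).norm_left).congr' .rfl
    (zpow_mul_far k l hi)

theorem IsRemainder.mul {F G : E → ℝ} {k l : ℤ} (hF : IsRemainder F k) (hG : IsSymbol G l) :
    IsRemainder (fun x => F x * G x) (k + l) := by
  refine ⟨contDiffOn_mul_far hF.1 hG.1, fun n =>
    (norm_iteratedFDeriv_mul_far hF.1 hG.1 n).trans_isLittleO (IsLittleO.fun_sum fun i hi => ?_)⟩
  exact (((hF.2 i).norm_left.const_mul_left _).mul_isBigO (hG.2 (n - i)).norm_left).congr' .rfl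
    (zpow_mul_far k l hi)

theorem contDiffAt_pd {F : E → ℝ} {x : E} (h : ContDiffAt ℝ ∞ F x) (i : Fin 3) :
    ContDiffAt ℝ ∞ (pd i F) x :=
  (h.fderiv_right (m := ∞) le_rfl).clm_apply contDiffAt_const

theorem contDiffOn_pd_far {F : E → ℝ} (hF : ∃ ρ : ℝ, 0 < ρ ∧ ContDiffOn ℝ ∞ F {x | ρ < ‖x‖})
    (i : Fin 3) : ∃ ρ : ℝ, 0 < ρ ∧ ContDiffOn ℝ ∞ (pd i F) {x | ρ < ‖x‖} := by
  obtain ⟨ρ, h0, h⟩ := hF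
  exact ⟨ρ, h0, fun x hx =>
    (contDiffAt_pd (h.contDiffAt ((isOpen_far ρ).mem_nhds hx)) i).contDiffWithinAt⟩

theorem iteratedFDeriv_pd_isBigO {F : E → ℝ}
    (hF : ∃ ρ : ℝ, 0 < ρ ∧ ContDiffOn ℝ ∞ F {x | ρ < ‖x‖}) (i : Fin 3) (n : ℕ) :
    (fun x => iteratedFDeriv ℝ n (pd i F) x) =O[cobounded E]
      fun x => iteratedFDeriv ℝ (n + 1) F x := by
  refine IsBigO.of_bound 1 ?_
  filter_upwards [contDiffAt_eventually hF] with x hx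
  have := norm_iteratedFDeriv_clm_apply_const (c := (EuclideanSpace.single i (1 : ℝ) : E))
    (hx.fderiv_right (m := ∞) le_rfl) (n := n) (mod_cast le_top)
  rw [norm_iteratedFDeriv_fderiv] at this
  rw [PiLp.norm_single, norm_one] at this
  exact this

theorem IsRemainder.pd {F : E → ℝ} {k : ℤ} (hF : IsRemainder F k) (i : Fin 3) :
    IsRemainder (pd i F) (k - 1) := by
  refine ⟨contDiffOn_pd_far hF.1 i, fun n => ((iteratedFDeriv_pd_isBigO hF.1 i n).trans_isLittleO
    (hF.2 (n + 1))).congr_right fun x => ?_⟩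
  congr 1; push_cast; ring

theorem contDiffOn_far_of_punctured {u : E → ℝ} (hu : ContDiffOn ℝ ∞ u {x | x ≠ 0}) :
    ∃ ρ : ℝ, 0 < ρ ∧ ContDiffOn ℝ ∞ u {x | ρ < ‖x‖} :=
  ⟨1, one_pos, hu.mono fun x (hx : 1 < ‖x‖) => norm_pos_iff.1 (one_pos.trans hx)⟩

/-- A smooth function that is homogeneous of degree `k` is a symbol of order `k`. -/
theorem isSymbol_of_homogeneous {u : E → ℝ} {k : ℤ} (hu : ContDiffOn ℝ ∞ u {x | x ≠ 0})
    (hom : ∀ (t : ℝ) (x : E), 0 < t → x ≠ 0 → u (t • x) = t ^ k * u x) : IsSymbol u k := by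
  refine ⟨contDiffOn_far_of_punctured hu, fun n => ?_⟩
  -- Differentiating $u(tx)=t^ku(x)$ repeatedly in $x$ shows that the norm of the $n$th derivative
  -- is homogeneous of degree $k-n$.
  have key : ∀ (t : ℝ) (x : E), 0 < t → x ≠ 0 →
      t ^ n * ‖iteratedFDeriv ℝ n u (t • x)‖ = t ^ k * ‖iteratedFDeriv ℝ n u x‖ := by
    intro t x ht hx
    set g : E →L[ℝ] E := t • ContinuousLinearMap.id ℝ E with hg
    have hgx : ∀ y, g y = t • y := fun y => by simp [hg]
    have hpre : IsOpen (g ⁻¹' {x : E | x ≠ 0}) := isOpen_punctured.preimage g.continuous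
    have hx' : g x ≠ 0 := by rw [hgx]; exact smul_ne_zero ht.ne' hx
    have h1 := g.iteratedFDerivWithin_comp_right hu isOpen_punctured.uniqueDiffOn
      hpre.uniqueDiffOn hx' (i := n) (mod_cast le_top)
    rw [iteratedFDerivWithin_of_isOpen n hpre hx',
      iteratedFDerivWithin_of_isOpen n isOpen_punctured hx'] at h1
    have h2 : u ∘ g =ᶠ[𝓝 x] fun y => t ^ k • u y := by
      filter_upwards [isOpen_punctured.mem_nhds hx] with y hy
      simp only [Function.comp, hgx, hom t y ht hy, smul_eq_mul]
    rw [(h2.iteratedFDeriv ℝ n).eq_of_nhds,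
      iteratedFDeriv_const_smul_apply' (((hu.contDiffAt (isOpen_punctured.mem_nhds hx)).of_le
        (mod_cast le_top))), hgx] at h1
    have h3 : (iteratedFDeriv ℝ n u (t • x)).compContinuousLinearMap (fun _ => g) =
        t ^ n • iteratedFDeriv ℝ n u (t • x) := by
      ext m
      simp only [ContinuousMultilinearMap.compContinuousLinearMap_apply, hgx,
        _root_.smul_apply]
      rw [ContinuousMultilinearMap.map_smul_univ]
      simp
    rw [h3] at h1
    have h4 := congrArg norm h1
    rw [norm_smul, norm_smul, Real.norm_of_nonneg (zpow_nonneg ht.le k),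
      Real.norm_of_nonneg (pow_nonneg ht.le n)] at h4
    exact h4.symm
  -- By homogeneity a bound on the compact unit sphere is enough.
  have hcont : ContinuousOn (fun x => ‖iteratedFDeriv ℝ n u x‖) (Metric.sphere (0 : E) 1) := by
    intro x hx
    have hx0 : x ≠ 0 := by
      rintro rfl
      simp at hx
    exact ((hu.contDiffAt (isOpen_punctured.mem_nhds hx0)).continuousAt_iteratedFDeriv
      (k := n) (mod_cast le_top)).norm.continuousWithinAt
  obtain ⟨C, hC⟩ := (isCompact_sphere (0 : E) 1).bddAbove_image hcont
  refine IsBigO.of_bound C ?_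
  filter_upwards [eventually_far 0] with x hx
  have hx0 : x ≠ 0 := norm_pos_iff.1 hx
  have hy : ‖(‖x‖⁻¹ • x)‖ = 1 := by
    rw [norm_smul, norm_inv, norm_norm, inv_mul_cancel₀ hx.ne']
  have h1 := key ‖x‖ (‖x‖⁻¹ • x) hx (by rw [← norm_pos_iff, hy]; exact one_pos)
  rw [smul_inv_smul₀ hx.ne'] at h1
  have h2 : ‖iteratedFDeriv ℝ n u (‖x‖⁻¹ • x)‖ ≤ C :=
    hC ⟨_, by simpa using hy, rfl⟩
  rw [Real.norm_of_nonneg (zpow_nonneg hx.le _), zpow_sub₀ hx.ne', zpow_natCast]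
  have h5 : ‖iteratedFDeriv ℝ n u x‖ =
      ‖x‖ ^ k * ‖iteratedFDeriv ℝ n u (‖x‖⁻¹ • x)‖ / ‖x‖ ^ n := by
    rw [← h1]; field_simp
  rw [h5, mul_comm C, div_mul_eq_mul_div]
  have := zpow_nonneg hx.le k
  gcongr

theorem isSymbol_const (c : ℝ) : IsSymbol (fun _ => c) 0 :=
  isSymbol_of_homogeneous contDiffOn_const (by simp)

/-- Smooth functions of symbols of order zero that have a limit are symbols of order zero. -/
theorem IsSymbol.comp {F : E → ℝ} (hF : IsSymbol F 0) {c : ℝ}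
    (hc : Tendsto F (cobounded E) (𝓝 c)) {φ : ℝ → ℝ} {t : Set ℝ} (ht : IsOpen t) (hct : c ∈ t)
    (hφ : ContDiffOn ℝ ∞ φ t) : IsSymbol (fun x => φ (F x)) 0 := by
  have hev : ∀ᶠ x in cobounded E, F x ∈ t := hc (ht.mem_nhds hct)
  obtain ⟨ρ₁, -, hρ₁⟩ := (hasBasis_cobounded_norm (E := E)).eventually_iff.1 hev
  obtain ⟨ρ₂, hρ₂, hs⟩ := hF.1
  set ρ := max ρ₁ ρ₂
  have hs' : ContDiffOn ℝ ∞ F {x | ρ < ‖x‖} :=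
    hs.mono fun x (hx : ρ < ‖x‖) => (le_max_right ρ₁ ρ₂).trans_lt hx
  have hmaps : Set.MapsTo F {x | ρ < ‖x‖} t := fun x (hx : ρ < ‖x‖) =>
    hρ₁ ((le_max_left ρ₁ ρ₂).trans hx.le)
  refine ⟨⟨ρ, lt_max_of_lt_right hρ₂, hφ.comp hs' hmaps⟩, fun n => ?_⟩
  -- The derivatives of `φ` at `F x` stay bounded because `F x` tends to `c`, where `φ` is smooth.
  have hC : ∀ i : ℕ, ∃ C : ℝ, 0 ≤ C ∧ ∀ᶠ x in cobounded E, ‖iteratedFDeriv ℝ i φ (F x)‖ ≤ C := by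
    intro i
    refine ⟨‖iteratedFDeriv ℝ i φ c‖ + 1, by positivity, ?_⟩
    have h1 : Tendsto (fun y => ‖iteratedFDeriv ℝ i φ y‖) (𝓝 c) (𝓝 ‖iteratedFDeriv ℝ i φ c‖) :=
      ((hφ.contDiffAt (ht.mem_nhds hct)).continuousAt_iteratedFDeriv (k := i)
        (mod_cast le_top)).norm
    exact (h1.comp hc).eventually (eventually_le_nhds (lt_add_one _))
  choose C hC0 hC using hC
  have hD : ∀ i : ℕ, ∃ K : ℝ, 0 ≤ K ∧ ∀ᶠ x in cobounded E,
      ‖iteratedFDeriv ℝ i F x‖ ≤ K * ‖x‖ ^ (-(i : ℤ)) := by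
    intro i
    obtain ⟨K, hK, hb⟩ := (hF.2 i).exists_nonneg
    refine ⟨K, hK, hb.bound.mono fun x hx => ?_⟩
    rwa [Real.norm_of_nonneg (zpow_nonneg (norm_nonneg x) _), zero_sub] at hx
  choose K hK0 hK using hD
  set C' := ∑ i ∈ Finset.range (n + 1), C i
  -- The composition estimate wants the $i$th derivative of `F` bounded by $D^i$ with one $D$ for
  -- all $i$. With $K'\ge 1$ one has $K_i\le K'^i$, and $D=K'/\|x\|$ works.
  set K' := 1 + ∑ i ∈ Finset.range (n + 1), K i
  have hK' : 1 ≤ K' := le_add_of_nonneg_right (Finset.sum_nonneg fun i _ => hK0 i)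
  refine IsBigO.of_bound (n.factorial * C' * K' ^ n) ?_
  have e1 : ∀ᶠ x in cobounded E, ∀ i ∈ Finset.range (n + 1),
      ‖iteratedFDeriv ℝ i φ (F x)‖ ≤ C i ∧ ‖iteratedFDeriv ℝ i F x‖ ≤ K i * ‖x‖ ^ (-(i : ℤ)) :=
    (Finset.eventually_all _).2 fun i _ => (hC i).and (hK i)
  filter_upwards [e1, eventually_far ρ, eventually_far 0] with x h1 hx hx0
  have h2 := norm_iteratedFDerivWithin_comp_le hφ hs' (n := n) (mod_cast le_top)
    ht.uniqueDiffOn (isOpen_far ρ).uniqueDiffOn hmaps hx (C := C') (D := K' * ‖x‖⁻¹) ?_ ?_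
  · rw [iteratedFDerivWithin_of_isOpen _ (isOpen_far ρ) hx] at h2
    refine h2.trans_eq ?_
    rw [Real.norm_of_nonneg (zpow_nonneg (norm_nonneg x) _), zero_sub, zpow_neg, zpow_natCast,
      mul_pow, inv_pow, mul_assoc]
    ring
  · intro i hi
    rw [iteratedFDerivWithin_of_isOpen _ ht (hmaps hx)]
    have hi' : i ∈ Finset.range (n + 1) := Finset.mem_range.2 (Nat.lt_succ_of_le hi)
    exact (h1 i hi').1.trans (Finset.single_le_sum (f := C) (fun j _ => hC0 j) hi')
  · intro i hi1 hi
    rw [iteratedFDerivWithin_of_isOpen _ (isOpen_far ρ) hx]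
    have hi' : i ∈ Finset.range (n + 1) := Finset.mem_range.2 (Nat.lt_succ_of_le hi)
    refine (h1 i hi').2.trans ?_
    rw [mul_pow, inv_pow, zpow_neg, zpow_natCast]
    have h3 : K i ≤ K' := by
      have := Finset.single_le_sum (f := K) (fun j _ => hK0 j) hi'
      simp only [K']; linarith
    have h4 : K i ≤ K' ^ i := h3.trans (le_self_pow₀ hK' (by omega))
    gcongr

end AsympFlat
end

/-! ### The ring of smooth functions on the punctured space and its derivations -/

noncomputable section
namespace AsympFlat

open Filter Asymptotics Bornology Topology

/-- Extension by zero of a function on the punctured space. -/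
def extZero (f : {x : E // x ≠ 0} → ℝ) : E → ℝ := fun x => if h : x ≠ 0 then f ⟨x, h⟩ else 0

theorem extZero_of_ne {f : {x : E // x ≠ 0} → ℝ} {x : E} (h : x ≠ 0) : extZero f x = f ⟨x, h⟩ :=
  dif_pos h

/-- The algebra of smooth functions on the punctured space. -/
def smoothSubalgebra : Subalgebra ℝ ({x : E // x ≠ 0} → ℝ) where
  carrier := {f | ContDiffOn ℝ ∞ (extZero f) {x | x ≠ 0}}
  mul_mem' {f g} hf hg := (hf.mul hg).congr fun x hx => by simp [extZero_of_ne hx]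
  add_mem' {f g} hf hg := (hf.add hg).congr fun x hx => by simp [extZero_of_ne hx]
  algebraMap_mem' c := (contDiffOn_const (c := c)).congr fun x hx => by
    simp [extZero_of_ne hx]

/-- The ring of smooth functions on the punctured space. -/
def SF : Type := smoothSubalgebra

instance : CommRing SF := inferInstanceAs (CommRing smoothSubalgebra)
instance : Algebra ℝ SF := inferInstanceAs (Algebra ℝ smoothSubalgebra)

namespace SF

/-- Evaluation, with value `0` at the origin. -/
def eval (u : SF) : E → ℝ := extZero (show smoothSubalgebra from u).1

instance : CoeFun SF fun _ => E → ℝ := ⟨eval⟩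

theorem eval_of_ne (u : SF) {x : E} (h : x ≠ 0) : u x = (show smoothSubalgebra from u).1 ⟨x, h⟩ :=
  dif_pos h

theorem eval_zero (u : SF) {x : E} (h : ¬x ≠ 0) : u x = 0 := dif_neg h

theorem smooth (u : SF) : ContDiffOn ℝ ∞ u {x | x ≠ 0} := u.2

theorem contDiffAt (u : SF) {x : E} (hx : x ≠ 0) : ContDiffAt ℝ ∞ u x :=
  u.smooth.contDiffAt (isOpen_punctured.mem_nhds hx)

theorem differentiableAt (u : SF) {x : E} (hx : x ≠ 0) : DifferentiableAt ℝ u x :=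
  (u.contDiffAt hx).differentiableAt (by simp)

theorem ext' {u v : SF} (h : ∀ x : E, x ≠ 0 → u x = v x) : u = v :=
  Subtype.ext <| funext fun x => by
    have := h x.1 x.2
    rwa [eval_of_ne _ x.2, eval_of_ne _ x.2] at this

theorem add_apply (u v : SF) (x : E) : (u + v) x = u x + v x := by
  by_cases h : x ≠ 0
  · simp only [eval_of_ne _ h]; rfl
  · simp [eval_zero _ h]

theorem mul_apply (u v : SF) (x : E) : (u * v) x = u x * v x := by
  by_cases h : x ≠ 0
  · simp only [eval_of_ne _ h]; rfl
  · simp [eval_zero _ h]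

theorem neg_apply (u : SF) (x : E) : (-u) x = -u x := by
  by_cases h : x ≠ 0
  · simp only [eval_of_ne _ h]; rfl
  · simp [eval_zero _ h]

theorem sub_apply (u v : SF) (x : E) : (u - v) x = u x - v x := by
  rw [sub_eq_add_neg, add_apply, neg_apply, sub_eq_add_neg]

theorem smul_apply (c : ℝ) (u : SF) (x : E) : (c • u) x = c * u x := by
  by_cases h : x ≠ 0
  · simp only [eval_of_ne _ h]; rfl
  · simp [eval_zero _ h]

theorem zero_apply (x : E) : (0 : SF) x = 0 := by
  by_cases h : x ≠ 0
  · simp only [eval_of_ne _ h]; rfl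
  · simp [eval_zero _ h]

theorem one_apply {x : E} (h : x ≠ 0) : (1 : SF) x = 1 := by
  simp only [eval_of_ne _ h]; rfl

theorem algebraMap_apply (c : ℝ) {x : E} (h : x ≠ 0) : (algebraMap ℝ SF c) x = c := by
  rw [Algebra.algebraMap_eq_smul_one, smul_apply, one_apply h, mul_one]

theorem sum_apply {ι : Type*} (s : Finset ι) (u : ι → SF) (x : E) :
    (∑ i ∈ s, u i) x = ∑ i ∈ s, u i x := by
  classical
  induction s using Finset.induction_on with
  | empty => simp [zero_apply]
  | insert a s ha ih => rw [Finset.sum_insert ha, Finset.sum_insert ha, add_apply, ih]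

/-- The restriction of a function that is smooth on the punctured space. -/
def of (u : E → ℝ) (h : ContDiffOn ℝ ∞ u {x | x ≠ 0}) : SF :=
  ⟨fun x => u x.1, h.congr fun x hx => by simp [extZero_of_ne hx]⟩

theorem of_apply {u : E → ℝ} (h : ContDiffOn ℝ ∞ u {x | x ≠ 0}) {x : E} (hx : x ≠ 0) :
    of u h x = u x := by
  simp only [eval_of_ne _ hx]; rfl

theorem eventuallyEq_of {u v : E → ℝ} (h : ∀ x : E, x ≠ 0 → u x = v x) {x : E} (hx : x ≠ 0) :
    u =ᶠ[𝓝 x] v :=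
  eventually_of_mem (isOpen_punctured.mem_nhds hx) h

end SF

theorem two_le_smooth : (2 : WithTop ℕ∞) ≤ ∞ := WithTop.coe_le_coe.2 (le_top : (2 : ℕ∞) ≤ ⊤)

theorem pd_congr {u v : E → ℝ} {x : E} (h : u =ᶠ[𝓝 x] v) (i : Fin 3) : pd i u x = pd i v x := by
  simp only [pd, h.fderiv_eq]

theorem contDiffOn_pd {u : E → ℝ} (h : ContDiffOn ℝ ∞ u {x | x ≠ 0}) (i : Fin 3) :
    ContDiffOn ℝ ∞ (pd i u) {x | x ≠ 0} := fun _ hx =>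
  (contDiffAt_pd (h.contDiffAt (isOpen_punctured.mem_nhds hx)) i).contDiffWithinAt

theorem pd_add' {u v : E → ℝ} {x : E} (hu : DifferentiableAt ℝ u x) (hv : DifferentiableAt ℝ v x)
    (i : Fin 3) : pd i (fun y => u y + v y) x = pd i u x + pd i v x := by
  simp only [pd]
  rw [show (fun y => u y + v y) = u + v from rfl, fderiv_add hu hv]; rfl

theorem pd_mul' {u v : E → ℝ} {x : E} (hu : DifferentiableAt ℝ u x) (hv : DifferentiableAt ℝ v x)
    (i : Fin 3) : pd i (fun y => u y * v y) x = u x * pd i v x + v x * pd i u x := by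
  simp only [pd]
  rw [show (fun y => u y * v y) = u * v from rfl, fderiv_mul hu hv]; simp

theorem pd_sub' {u v : E → ℝ} {x : E} (hu : DifferentiableAt ℝ u x) (hv : DifferentiableAt ℝ v x)
    (i : Fin 3) : pd i (fun y => u y - v y) x = pd i u x - pd i v x := by
  simp only [pd]
  rw [fderiv_fun_sub hu hv]; rfl

theorem pd_const (c : ℝ) (i : Fin 3) (x : E) : pd i (fun _ => c) x = 0 := by
  simp [pd]

theorem pd_comm' {u : E → ℝ} {x : E} (h : ContDiffAt ℝ ∞ u x) (i j : Fin 3) :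
    pd i (pd j u) x = pd j (pd i u) x := by
  have h2 : IsSymmSndFDerivAt ℝ u x := h.isSymmSndFDerivAt (by simpa using two_le_smooth)
  have hd : DifferentiableAt ℝ (fderiv ℝ u) x :=
    (h.fderiv_right (m := ∞) le_rfl).differentiableAt (by simp)
  have key : ∀ i j : Fin 3, pd i (pd j u) x =
      fderiv ℝ (fderiv ℝ u) x (EuclideanSpace.single i 1) (EuclideanSpace.single j 1) := by
    intro i j
    unfold pd
    rw [fderiv_clm_apply hd (differentiableAt_const _)]
    simp
  rw [key, key]
  exact h2 _ _

namespace SF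

/-- The partial derivatives, as derivations. -/
def d (i : Fin 3) : Derivation ℝ SF SF :=
  Derivation.mk'
    { toFun := fun u => of (pd i u) (contDiffOn_pd u.smooth i)
      map_add' := fun u v => ext' fun x hx => by
        rw [of_apply _ hx, add_apply, of_apply _ hx, of_apply _ hx,
          ← pd_add' (u.differentiableAt hx) (v.differentiableAt hx)]
        congr 1; funext y; exact add_apply u v y
      map_smul' := fun c u => ext' fun x hx => by
        rw [of_apply _ hx, RingHom.id_apply, smul_apply, of_apply _ hx]
        have := pd_mul' (differentiableAt_const c) (u.differentiableAt hx) i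
        rw [pd_const, mul_zero, add_zero] at this
        rw [← this]
        congr 1; funext y; exact smul_apply c u y }
    fun u v => ext' fun x hx => by
      simp only [smul_eq_mul, LinearMap.coe_mk, AddHom.coe_mk]
      rw [of_apply _ hx, add_apply, mul_apply, mul_apply, of_apply _ hx, of_apply _ hx,
          ← pd_mul' (u.differentiableAt hx) (v.differentiableAt hx)]
      congr 1; funext y; exact mul_apply u v y

theorem d_apply (i : Fin 3) (u : SF) {x : E} (hx : x ≠ 0) : d i u x = pd i u x :=
  of_apply (contDiffOn_pd u.smooth i) hx

theorem d_comm (i j : Fin 3) (u : SF) : d i (d j u) = d j (d i u) := ext' fun x hx => by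
  rw [d_apply _ _ hx, d_apply _ _ hx, pd_congr (eventuallyEq_of (fun y hy => d_apply j u hy) hx),
    pd_congr (eventuallyEq_of (fun y hy => d_apply i u hy) hx), pd_comm' (u.contDiffAt hx)]

theorem d_mul (i : Fin 3) (u v : SF) : d i (u * v) = d i u * v + u * d i v := by
  rw [Derivation.leibniz, smul_eq_mul, smul_eq_mul]; ring

theorem d_of (i : Fin 3) {u : E → ℝ} (h : ContDiffOn ℝ ∞ u {x | x ≠ 0}) :
    d i (of u h) = of (pd i u) (contDiffOn_pd h i) := ext' fun x hx => by
  rw [d_apply _ _ hx, of_apply _ hx]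
  exact pd_congr (eventuallyEq_of (fun y hy => of_apply h hy) hx) i

/-- Homogeneity of degree `k`. -/
def Hom (k : ℤ) (u : SF) : Prop :=
  ∀ (t : ℝ) (x : E), 0 < t → x ≠ 0 → u (t • x) = t ^ k * u x

theorem Hom.add {k : ℤ} {u v : SF} (hu : Hom k u) (hv : Hom k v) : Hom k (u + v) :=
  fun t x ht hx => by rw [add_apply, add_apply, hu t x ht hx, hv t x ht hx]; ring

theorem Hom.zero (k : ℤ) : Hom k 0 := fun t x _ _ => by simp [zero_apply]

theorem Hom.const (c : ℝ) : Hom 0 (algebraMap ℝ SF c) := fun t x ht hx => by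
  rw [algebraMap_apply c hx, algebraMap_apply c (smul_ne_zero ht.ne' hx), zpow_zero, one_mul]

theorem Hom.one : Hom 0 1 := by simpa using Hom.const 1

theorem Hom.neg {k : ℤ} {u : SF} (hu : Hom k u) : Hom k (-u) :=
  fun t x ht hx => by rw [neg_apply, neg_apply, hu t x ht hx]; ring

theorem Hom.sub {k : ℤ} {u v : SF} (hu : Hom k u) (hv : Hom k v) : Hom k (u - v) := by
  rw [sub_eq_add_neg]; exact hu.add hv.neg

theorem Hom.smul {k : ℤ} {u : SF} (c : ℝ) (hu : Hom k u) : Hom k (c • u) :=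
  fun t x ht hx => by rw [smul_apply, smul_apply, hu t x ht hx]; ring

theorem Hom.mul {k l : ℤ} {u v : SF} (hu : Hom k u) (hv : Hom l v) : Hom (k + l) (u * v) :=
  fun t x ht hx => by
    rw [mul_apply, mul_apply, hu t x ht hx, hv t x ht hx, zpow_add₀ ht.ne']; ring

theorem Hom.sum {k : ℤ} {ι : Type*} {s : Finset ι} {u : ι → SF} (hu : ∀ i ∈ s, Hom k (u i)) :
    Hom k (∑ i ∈ s, u i) := fun t x ht hx => by
  rw [sum_apply, sum_apply, Finset.mul_sum]
  exact Finset.sum_congr rfl fun i hi => hu i hi t x ht hx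

protected theorem Hom.d {k : ℤ} {u : SF} (hu : Hom k u) (i : Fin 3) : Hom (k - 1) (d i u) := by
  intro t x ht hx
  have htx : t • x ≠ 0 := smul_ne_zero ht.ne' hx
  rw [d_apply i u hx, d_apply i u htx]
  have h1 : fderiv ℝ (fun y => u (t • y)) x = t • fderiv ℝ u (t • x) := by
    have := ((u.differentiableAt htx).hasFDerivAt.comp x
      ((hasFDerivAt_id x).const_smul t)).fderiv
    simp only [Function.comp_def] at this
    rw [this]; ext y; simp
  have h2 : (fun y => u (t • y)) =ᶠ[𝓝 x] fun y => t ^ k * u y :=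
    eventuallyEq_of (fun y hy => hu t y ht hy) hx
  rw [h2.fderiv_eq, fderiv_const_mul (u.differentiableAt hx)] at h1
  have h3 := congrArg (fun L : E →L[ℝ] ℝ => L (EuclideanSpace.single i 1)) h1
  simp only [_root_.smul_apply, smul_eq_mul] at h3
  simp only [pd]
  rw [zpow_sub_one₀ ht.ne', mul_right_comm, h3]
  field_simp

theorem Hom.isSymbol {k : ℤ} {u : SF} (hu : Hom k u) : IsSymbol u k :=
  isSymbol_of_homogeneous u.smooth hu

/-- The coordinate functions. -/
def X (i : Fin 3) : SF := of (fun x => x i) (by fun_prop)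

theorem contDiffOn_norm : ContDiffOn ℝ ∞ (fun x : E => ‖x‖) {x | x ≠ 0} := fun _ hx =>
  (contDiffAt_norm ℝ hx).contDiffWithinAt

/-- The radius. -/
def r : SF := of (fun x => ‖x‖) contDiffOn_norm

/-- The inverse of the radius. -/
def ri : SF := of (fun x => ‖x‖⁻¹) (contDiffOn_norm.inv fun _ hx => norm_ne_zero_iff.2 hx)

/-- The radial unit vector. -/
def n (i : Fin 3) : SF := X i * ri

theorem r_apply {x : E} (hx : x ≠ 0) : r x = ‖x‖ := of_apply _ hx
theorem ri_apply {x : E} (hx : x ≠ 0) : ri x = ‖x‖⁻¹ := of_apply _ hx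
theorem X_apply (i : Fin 3) {x : E} (hx : x ≠ 0) : X i x = x i := of_apply _ hx
theorem n_apply (i : Fin 3) {x : E} (hx : x ≠ 0) : n i x = nrm i x := by
  rw [n, mul_apply, X_apply i hx, ri_apply hx]; rfl

theorem r_mul_ri : r * ri = 1 := ext' fun x hx => by
  rw [mul_apply, r_apply hx, ri_apply hx, one_apply hx, mul_inv_cancel₀ (norm_ne_zero_iff.2 hx)]

theorem hom_r : Hom 1 r := fun t x ht hx => by
  rw [r_apply hx, r_apply (smul_ne_zero ht.ne' hx), norm_smul, Real.norm_of_nonneg ht.le, zpow_one]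

theorem hom_ri : Hom (-1) ri := fun t x ht hx => by
  rw [ri_apply hx, ri_apply (smul_ne_zero ht.ne' hx), norm_smul, Real.norm_of_nonneg ht.le,
    zpow_neg_one, mul_inv]

theorem hom_X (i : Fin 3) : Hom 1 (X i) := fun t x ht hx => by
  rw [X_apply i hx, X_apply i (smul_ne_zero ht.ne' hx), zpow_one]; simp

theorem hom_n (i : Fin 3) : Hom 0 (n i) := (hom_X i).mul hom_ri

/-- Kronecker delta as a constant function. -/
def δ (i j : Fin 3) : SF := algebraMap ℝ SF (kd i j)

theorem hom_δ (i j : Fin 3) : Hom 0 (δ i j) := Hom.const _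

theorem d_δ (i j k : Fin 3) : d k (δ i j) = 0 := (d k).map_algebraMap _

theorem d_X (i j : Fin 3) : d i (X j) = δ i j := ext' fun x hx => by
  rw [X, d_of, of_apply _ hx, δ, algebraMap_apply _ hx]
  simp only [pd, kd]
  rw [show (fun x : E => x j) = fun x => EuclideanSpace.proj j x from rfl]
  rw [ContinuousLinearMap.fderiv]
  simp [eq_comm]

theorem sum_X_sq : ∑ i, X i * X i = r * r := ext' fun x hx => by
  rw [sum_apply, mul_apply, r_apply hx, ← real_inner_self_eq_norm_mul_norm, PiLp.inner_apply]
  exact Finset.sum_congr rfl fun i _ => by rw [mul_apply, X_apply i hx]; simp [sq]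

theorem X_eq (i : Fin 3) : X i = r * n i := by
  rw [n, mul_left_comm, r_mul_ri, mul_one]

theorem sum_n_sq : ∑ i, n i * n i = 1 := by
  have : ∑ i, n i * n i = (∑ i, X i * X i) * (ri * ri) := by
    rw [Finset.sum_mul]; exact Finset.sum_congr rfl fun i _ => by rw [n]; ring
  rw [this, sum_X_sq]
  linear_combination (r * ri + 1) * r_mul_ri

/-- Many identities are proved after doubling, which keeps the factors `1 / 2` out of the ring
computations. -/
theorem two_smul_inj {u v : SF} (h : 2 * u = 2 * v) : u = v := ext' fun x hx => by
  have := congrArg (fun w : SF => w x) h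
  simp only [two_mul, add_apply] at this
  linarith

theorem δ_self (i : Fin 3) : δ i i = 1 := by simp [δ, kd]

theorem δ_ne {i j : Fin 3} (h : i ≠ j) : δ i j = 0 := by simp [δ, kd, h]

theorem δ_comm (i j : Fin 3) : δ i j = δ j i := by simp [δ, kd, eq_comm]

theorem sum_δ_mul (i : Fin 3) (u : Fin 3 → SF) : ∑ j, δ i j * u j = u i := by
  rw [Finset.sum_eq_single i (fun j _ h => by rw [δ_ne h.symm, zero_mul]) (by simp), δ_self,
    one_mul]

theorem sum_δ_mul' (i : Fin 3) (u : Fin 3 → SF) : ∑ j, δ j i * u j = u i := by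
  simp_rw [δ_comm _ i]; exact sum_δ_mul i u

/-- Obtained by differentiating $\sum_i X_i^2=r^2$. Together with `d_ri` and `d_n` it turns all
derivatives of radial quantities into polynomials in `n`, `ri` and `δ`. -/
theorem d_r (i : Fin 3) : d i r = n i := by
  have h := congrArg (d i) sum_X_sq
  simp only [map_sum, d_mul, d_X, Finset.sum_add_distrib, mul_comm (X _) (δ _ _), sum_δ_mul] at h
  have h2 : d i r * r = X i := two_smul_inj (by linear_combination -h)
  rw [n, ← h2, mul_assoc, r_mul_ri, mul_one]

theorem d_ri (i : Fin 3) : d i ri = -(ri * ri * n i) := by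
  have h := congrArg (d i) r_mul_ri
  rw [d_mul, d_r, Derivation.map_one_eq_zero] at h
  linear_combination ri * h - d i ri * r_mul_ri

theorem d_n (i j : Fin 3) : d i (n j) = ri * (δ i j - n i * n j) := by
  have : n j = X j * ri := rfl
  rw [this, d_mul, d_X, d_ri]; ring

end SF
end AsympFlat
end

/-! ### Two-term homogeneous expansions and smooth families of them -/

noncomputable section
namespace AsympFlat

open Filter Asymptotics Bornology Topology

theorem IsRemainder.const_mul {F : E → ℝ} {k : ℤ} (c : ℝ) (hF : IsRemainder F k) :
    IsRemainder (fun x => c * F x) k := by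
  simpa [mul_comm] using hF.mul (isSymbol_const c)

theorem IsRemainder.neg {F : E → ℝ} {k : ℤ} (hF : IsRemainder F k) :
    IsRemainder (fun x => -F x) k := by
  simpa using hF.const_mul (-1)

theorem IsRemainder.isLittleO {F : E → ℝ} {k : ℤ} (hF : IsRemainder F k) :
    F =o[cobounded E] fun x => ‖x‖ ^ k := by
  refine ((isBigO_of_le _ fun x => ?_).trans_isLittleO (hF.2 0)).congr_right fun x => by simp
  rw [norm_iteratedFDeriv_zero]

theorem IsSymbol.tendsto_zero {F : E → ℝ} {k : ℤ} (hF : IsSymbol F k) (hk : k < 0) :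
    Tendsto F (cobounded E) (𝓝 0) := by
  have := (hF.isRemainder hk).isLittleO
  simpa [isLittleO_one_iff] using this

/-- Along a ray the quotient of `u` by $\|x\|^k$ is constant, so it can tend to zero only by being
zero. -/
theorem SF.Hom.eq_zero {k : ℤ} {u : SF} (hu : SF.Hom k u)
    (h : u =o[cobounded E] fun x => ‖x‖ ^ k) : u = 0 := SF.ext' fun x hx => by
  rw [SF.zero_apply]
  have hx' : 0 < ‖x‖ := norm_pos_iff.2 hx
  have ht : Tendsto (fun t : ℝ => t • x) atTop (cobounded E) := by
    rw [← tendsto_norm_atTop_iff_cobounded]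
    refine (tendsto_id.atTop_mul_const hx').congr' ?_
    filter_upwards [eventually_gt_atTop 0] with t ht
    rw [norm_smul, Real.norm_of_nonneg ht.le, id]
  have h1 := h.comp_tendsto ht
  have h2 : (fun _ : ℝ => u x) =o[atTop] fun _ : ℝ => ‖x‖ ^ k := by
    refine ((isBigO_refl (fun t : ℝ => (t ^ k)⁻¹) atTop).mul_isLittleO h1).congr' ?_ ?_
    · filter_upwards [eventually_gt_atTop 0] with t ht
      simp only [Function.comp]
      rw [hu t x ht hx, inv_mul_cancel_left₀ (zpow_ne_zero _ ht.ne')]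
    · filter_upwards [eventually_gt_atTop 0] with t ht
      simp only [Function.comp]
      rw [norm_smul, Real.norm_of_nonneg ht.le, mul_zpow,
        inv_mul_cancel_left₀ (zpow_ne_zero _ ht.ne')]
  have h3 := h2.trans_isBigO (isBigO_const_const (‖x‖ ^ k) (one_ne_zero (α := ℝ)) atTop)
  rw [isLittleO_one_iff] at h3
  exact tendsto_nhds_unique tendsto_const_nhds h3

/-- `F = u + v + o(r^{k-1})` with smooth homogeneous `u` of degree `k` and `v` of degree
`k - 1`. -/
structure Exp (F : E → ℝ) (k : ℤ) (u : SF) : Prop where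
  hom : SF.Hom k u
  rem : ∃ v : SF, SF.Hom (k - 1) v ∧ IsRemainder (fun x => F x - u x - v x) (k - 1)

namespace Exp

variable {F G : E → ℝ} {k l : ℤ} {u v : SF}

theorem congr (hF : Exp F k u) (h : ∀ᶠ x in cobounded E, F x = G x) : Exp G k u := by
  obtain ⟨w, hw, hr⟩ := hF.rem
  exact ⟨hF.hom, w, hw, hr.congr (h.mono fun x hx => by rw [hx])⟩

theorem lead (hF : Exp F k u) (h : u = v) : Exp F k v := h ▸ hF

theorem cast (hF : Exp F k u) (h : k = l) : Exp F l u := h ▸ hF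

theorem isRemainder_sub (hF : Exp F k u) : IsRemainder (fun x => F x - u x) k := by
  obtain ⟨w, hw, hr⟩ := hF.rem
  refine ((hr.isSymbol.add hw.isSymbol).isRemainder (sub_one_lt k)).congr
    (Eventually.of_forall fun x => by ring)

theorem isSymbol_sub (hF : Exp F k u) : IsSymbol (fun x => F x - u x) (k - 1) := by
  obtain ⟨w, hw, hr⟩ := hF.rem
  exact (hr.isSymbol.add hw.isSymbol).congr (Eventually.of_forall fun x => by ring)

theorem isSymbol (hF : Exp F k u) : IsSymbol F k :=
  (hF.isRemainder_sub.isSymbol.add hF.hom.isSymbol).congr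
    (Eventually.of_forall fun x => by ring)

theorem of_hom (hu : SF.Hom k u) : Exp u k u :=
  ⟨hu, 0, SF.Hom.zero _, ((SF.Hom.zero (k - 1 - 1)).isSymbol.isRemainder (sub_one_lt _)).congr
      (Eventually.of_forall fun x => by simp [SF.zero_apply])⟩

/-- The old leading term becomes the second coefficient of the new expansion, which is why exactly
one order is given up. -/
theorem weaken (hF : Exp F k u) (h : l = k + 1) : Exp F l 0 := by
  subst h
  refine ⟨SF.Hom.zero _, u, by simpa using hF.hom, ?_⟩
  rw [add_sub_cancel_right]
  exact hF.isRemainder_sub.congr (Eventually.of_forall fun x => by simp [SF.zero_apply])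

theorem add (hF : Exp F k u) (hG : Exp G k v) : Exp (fun x => F x + G x) k (u + v) := by
  obtain ⟨w, hw, hr⟩ := hF.rem
  obtain ⟨z, hz, hs⟩ := hG.rem
  refine ⟨hF.hom.add hG.hom, w + z, hw.add hz, (hr.add hs).congr
    (Eventually.of_forall fun x => ?_)⟩
  rw [SF.add_apply, SF.add_apply]; ring

theorem const_mul (c : ℝ) (hF : Exp F k u) : Exp (fun x => c * F x) k (c • u) := by
  obtain ⟨w, hw, hr⟩ := hF.rem
  refine ⟨hF.hom.smul c, c • w, hw.smul c, (hr.const_mul c).congr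
    (Eventually.of_forall fun x => ?_)⟩
  rw [SF.smul_apply, SF.smul_apply]; ring

theorem neg (hF : Exp F k u) : Exp (fun x => -F x) k (-u) := by
  simpa using hF.const_mul (-1)

theorem sub (hF : Exp F k u) (hG : Exp G k v) : Exp (fun x => F x - G x) k (u - v) := by
  simpa [sub_eq_add_neg] using hF.add hG.neg

theorem zero (k : ℤ) : Exp (fun _ => 0) k 0 := by
  have := of_hom (SF.Hom.zero k)
  rwa [show ((0 : SF) : E → ℝ) = fun _ => 0 from funext SF.zero_apply] at this

theorem sum {ι : Type*} {s : Finset ι} {F : ι → E → ℝ} {u : ι → SF}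
    (h : ∀ i ∈ s, Exp (F i) k (u i)) : Exp (fun x => ∑ i ∈ s, F i x) k (∑ i ∈ s, u i) := by
  classical
  induction s using Finset.induction_on with
  | empty => simpa using zero k
  | insert a s ha ih =>
    simp only [Finset.sum_insert ha]
    exact (h a (Finset.mem_insert_self a s)).add
      (ih fun i hi => h i (Finset.mem_insert_of_mem hi))

theorem mul (hF : Exp F k u) (hG : Exp G l v) : Exp (fun x => F x * G x) (k + l) (u * v) := by
  obtain ⟨w, hw, hr⟩ := hF.rem
  obtain ⟨z, hz, hs⟩ := hG.rem
  refine ⟨hF.hom.mul hG.hom, w * v + u * z, ?_, ?_⟩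
  · refine SF.Hom.add ?_ ?_
    · have := hw.mul hG.hom
      rwa [show k - 1 + l = k + l - 1 by ring] at this
    · have := hF.hom.mul hz
      rwa [show k + (l - 1) = k + l - 1 by ring] at this
  · have h1 := hr.mul hG.isSymbol
    rw [show k - 1 + l = k + l - 1 by ring] at h1
    have h2 := hs.mul hF.hom.isSymbol
    rw [show l - 1 + k = k + l - 1 by ring] at h2
    -- The remaining cross term is a product of symbols of orders $k-1$ and $l-1$.
    have h3 : IsRemainder (fun x => w x * (G x - v x)) (k + l - 1) :=
      (hw.isSymbol.mul hG.isSymbol_sub).isRemainder (by omega)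
    refine ((h1.add h2).add h3).congr (Eventually.of_forall fun x => ?_)
    rw [SF.add_apply, SF.mul_apply, SF.mul_apply, SF.mul_apply]; ring

/-- Termwise differentiation is legitimate because remainders are controlled together with all their
derivatives. -/
theorem pd (hF : Exp F k u) (i : Fin 3) : Exp (pd i F) (k - 1) (SF.d i u) := by
  obtain ⟨w, hw, hr⟩ := hF.rem
  refine ⟨hF.hom.d i, SF.d i w, hw.d i, (hr.pd i).congr ?_⟩
  filter_upwards [contDiffAt_eventually hF.isSymbol.1, eventually_far 0] with x h1 hx
  have hx0 : x ≠ 0 := norm_pos_iff.1 hx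
  have hF' : DifferentiableAt ℝ F x := h1.differentiableAt (by simp)
  rw [SF.d_apply i u hx0, SF.d_apply i w hx0]
  rw [pd_sub' (hF'.fun_sub (u.differentiableAt hx0)) (w.differentiableAt hx0),
    pd_sub' hF' (u.differentiableAt hx0)]

theorem unique (h1 : Exp F k u) (h2 : Exp F k v) : u = v := by
  have h3 := (h2.isRemainder_sub.add h1.isRemainder_sub.neg).isLittleO
  refine sub_eq_zero.1 ((h1.hom.sub h2.hom).eq_zero (h3.congr_left fun x => ?_))
  rw [SF.sub_apply]; ring

/-- This converts the analytic fall-off of the constraints into the vanishing of an element of `SF`.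
-/
theorem isLittleO_iff (hF : Exp F k u) : (F =o[cobounded E] fun x => ‖x‖ ^ k) ↔ u = 0 := by
  constructor
  · intro h
    exact hF.hom.eq_zero ((h.sub hF.isRemainder_sub.isLittleO).congr_left fun x => by ring)
  · rintro rfl
    exact hF.isRemainder_sub.isLittleO.congr_left fun x => by simp [SF.zero_apply]

theorem const (c : ℝ) : Exp (fun _ => c) 0 (algebraMap ℝ SF c) :=
  (of_hom (SF.Hom.const c)).congr <| (eventually_far 0).mono fun _ hx =>
    SF.algebraMap_apply c (norm_pos_iff.1 hx)

theorem one : Exp (fun _ => 1) 0 1 := by simpa using const 1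

theorem isSymbol_sub_one (hF : Exp F 0 1) : IsSymbol (fun x => F x - 1) (-1) :=
  hF.isSymbol_sub.congr <| (eventually_far 0).mono fun _ hx => by
    rw [SF.one_apply (norm_pos_iff.1 hx)]

theorem tendsto_one (hF : Exp F 0 1) : Tendsto F (cobounded E) (𝓝 1) := by
  have := (hF.isSymbol_sub_one.tendsto_zero (by norm_num)).add_const 1
  simpa using this

theorem isSymbol_inv (hF : Exp F 0 1) : IsSymbol (fun x => (F x)⁻¹) 0 :=
  hF.isSymbol.comp hF.tendsto_one (t := {0}ᶜ) isOpen_compl_singleton (by simp)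
    (φ := fun y => y⁻¹) (contDiffOn_id.inv fun x hx => hx)

theorem eventually_half_lt (hF : Exp F 0 1) : ∀ᶠ x in cobounded E, 1 / 2 < F x :=
  hF.tendsto_one.eventually (lt_mem_nhds (by norm_num))

/-- $F^{-1}=1-(F-1)+(F-1)^2F^{-1}$, and the last term has order -2. -/
theorem inv (hF : Exp F 0 1) : Exp (fun x => (F x)⁻¹) 0 1 := by
  obtain ⟨w, hw, hr⟩ := hF.rem
  refine ⟨SF.Hom.one, -w, hw.neg, ?_⟩
  have h1 : IsSymbol (fun x => (F x - 1) * (F x - 1) * (F x)⁻¹) (-2) :=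
    (hF.isSymbol_sub_one.mul hF.isSymbol_sub_one).mul hF.isSymbol_inv
  refine ((h1.isRemainder (by norm_num)).add hr.neg).congr ?_
  filter_upwards [hF.eventually_half_lt, eventually_far 0] with x hx hx0
  rw [SF.one_apply (norm_pos_iff.1 hx0), SF.neg_apply]
  have : F x ≠ 0 := by intro h; rw [h] at hx; norm_num at hx
  field_simp
  ring

theorem isSymbol_sqrt (hF : Exp F 0 1) : IsSymbol (fun x => Real.sqrt (F x)) 0 :=
  hF.isSymbol.comp hF.tendsto_one (t := {0}ᶜ) isOpen_compl_singleton (by simp)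
    (φ := Real.sqrt) (contDiffOn_id.sqrt fun x hx => hx)

/-- $\sqrt F-1=\frac12(F-1)-\frac12(\sqrt F-1)^2$. The order -1 of $\sqrt F-1$ is read off from its
form $(F-1)/(1+\sqrt F)$. -/
theorem sqrt (hF : Exp F 0 1) : Exp (fun x => Real.sqrt (F x)) 0 1 := by
  obtain ⟨w, hw, hr⟩ := hF.rem
  have ht : Tendsto (fun x => 1 + Real.sqrt (F x)) (cobounded E) (𝓝 2) := by
    have := (Real.continuous_sqrt.tendsto 1).comp hF.tendsto_one |>.const_add 1
    rw [Real.sqrt_one] at this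
    rwa [one_add_one_eq_two] at this
  have hz : IsSymbol (fun x => Real.sqrt (F x) - 1) (-1) := by
    have hi : IsSymbol (fun x => (1 + Real.sqrt (F x))⁻¹) 0 :=
      ((isSymbol_const 1).add hF.isSymbol_sqrt).comp ht (t := {0}ᶜ) isOpen_compl_singleton
        (by simp) (φ := fun y => y⁻¹) (contDiffOn_id.inv fun x hx => hx)
    refine (hF.isSymbol_sub_one.mul hi).congr ?_
    filter_upwards [hF.eventually_half_lt] with x hx
    have h0 : 0 ≤ F x := by linarith
    have h1 : 1 + Real.sqrt (F x) ≠ 0 := by positivity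
    rw [← div_eq_mul_inv, div_eq_iff h1]
    linear_combination -Real.sq_sqrt h0
  refine ⟨SF.Hom.one, (1 / 2 : ℝ) • w, hw.smul _, ?_⟩
  have h1 := (hz.mul hz).isRemainder (l := -1) (by norm_num)
  refine ((h1.const_mul (-1 / 2)).add (hr.const_mul (1 / 2))).congr ?_
  filter_upwards [hF.eventually_half_lt, eventually_far 0] with x hx hx0
  rw [SF.one_apply (norm_pos_iff.1 hx0), SF.smul_apply]
  have h0 : 0 ≤ F x := by linarith
  linear_combination (-1 / 2) * Real.sq_sqrt h0

end Exp

/-- A one-parameter family of functions that depends smoothly on the parameter, such that the member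
at parameter `0` and the first variation there have expansions with leading terms `u` and `u'`. -/
structure FExp (F : ℝ → E → ℝ) (k : ℤ) (u u' : SF) : Prop where
  joint : ∃ ρ : ℝ, 0 < ρ ∧ ∀ x : E, ρ < ‖x‖ → ContDiffAt ℝ ∞ (fun z : ℝ × E => F z.1 z.2) (0, x)
  base : Exp (F 0) k u
  der : Exp (fun x => deriv (fun s => F s x) 0) k u'

namespace FExp

variable {F G : ℝ → E → ℝ} {k l : ℤ} {u u' v v' : SF}

theorem joint_common {F G : ℝ → E → ℝ}
    (hF : ∃ ρ : ℝ, 0 < ρ ∧ ∀ x : E, ρ < ‖x‖ → ContDiffAt ℝ ∞ (fun z : ℝ × E => F z.1 z.2) (0, x))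
    (hG : ∃ ρ : ℝ, 0 < ρ ∧ ∀ x : E, ρ < ‖x‖ → ContDiffAt ℝ ∞ (fun z : ℝ × E => G z.1 z.2) (0, x)) :
    ∃ ρ : ℝ, 0 < ρ ∧ ∀ x : E, ρ < ‖x‖ → ContDiffAt ℝ ∞ (fun z : ℝ × E => F z.1 z.2) (0, x) ∧
      ContDiffAt ℝ ∞ (fun z : ℝ × E => G z.1 z.2) (0, x) := by
  obtain ⟨a, ha, h1⟩ := hF
  obtain ⟨b, hb, h2⟩ := hG
  exact ⟨max a b, lt_max_of_lt_left ha, fun x hx =>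
    ⟨h1 x ((le_max_left a b).trans_lt hx), h2 x ((le_max_right a b).trans_lt hx)⟩⟩

theorem hasDerivAt_of_joint {F : ℝ → E → ℝ} {x : E}
    (h : ContDiffAt ℝ ∞ (fun z : ℝ × E => F z.1 z.2) (0, x)) :
    HasDerivAt (fun s => F s x) (deriv (fun s => F s x) 0) 0 := by
  have h1 : DifferentiableAt ℝ (fun s : ℝ => F s x) 0 :=
    (h.differentiableAt (by simp)).comp (f := fun s : ℝ => (s, x)) 0
      (differentiableAt_id.prodMk (differentiableAt_const x))
  exact h1.hasDerivAt

theorem eventually_hasDerivAt (hF : FExp F k u u') : ∀ᶠ x in cobounded E,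
    HasDerivAt (fun s => F s x) (deriv (fun s => F s x) 0) 0 := by
  obtain ⟨a, ha, h1⟩ := hF.joint
  filter_upwards [eventually_far a] with x hx
  exact hasDerivAt_of_joint (h1 x hx)

theorem lead (hF : FExp F k u u') (h : u = v) (h' : u' = v') : FExp F k v v' := h ▸ h' ▸ hF

theorem cast (hF : FExp F k u u') (h : k = l) : FExp F l u u' := h ▸ hF

theorem add (hF : FExp F k u u') (hG : FExp G k v v') :
    FExp (fun s x => F s x + G s x) k (u + v) (u' + v') := by
  obtain ⟨ρ, h0, h⟩ := joint_common hF.joint hG.joint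
  refine ⟨⟨ρ, h0, fun x hx => (h x hx).1.add (h x hx).2⟩, hF.base.add hG.base,
    (hF.der.add hG.der).congr ?_⟩
  filter_upwards [hF.eventually_hasDerivAt, hG.eventually_hasDerivAt] with x h1 h2
  exact (h1.fun_add h2).deriv.symm

theorem mul (hF : FExp F k u u') (hG : FExp G l v v') :
    FExp (fun s x => F s x * G s x) (k + l) (u * v) (u' * v + u * v') := by
  obtain ⟨ρ, h0, h⟩ := joint_common hF.joint hG.joint
  refine ⟨⟨ρ, h0, fun x hx => (h x hx).1.mul (h x hx).2⟩, hF.base.mul hG.base,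
    ((hF.der.mul hG.base).add (hF.base.mul hG.der)).congr ?_⟩
  filter_upwards [hF.eventually_hasDerivAt, hG.eventually_hasDerivAt] with x h1 h2
  exact (h1.fun_mul h2).deriv.symm

theorem const {F : E → ℝ} (hF : Exp F k u) : FExp (fun _ => F) k u 0 := by
  refine ⟨?_, hF, ?_⟩
  · obtain ⟨ρ, h0, h⟩ := hF.isSymbol.1
    exact ⟨ρ, h0, fun x hx =>
      (h.contDiffAt ((isOpen_far ρ).mem_nhds hx)).comp (0, x) contDiffAt_snd⟩
  · simpa using Exp.zero k

theorem affine {F G : E → ℝ} (hF : Exp F k u) (hG : Exp G k u') :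
    FExp (fun s x => F x + s * G x) k u u' := by
  refine ⟨?_, by simpa using hF, ?_⟩
  · obtain ⟨ρ, h0, h⟩ := joint_common (F := fun _ => F) (G := fun _ => G) (const hF).joint (const hG).joint
    exact ⟨ρ, h0, fun x hx => (h x hx).1.add (contDiffAt_fst.mul (h x hx).2)⟩
  · refine hG.congr (Eventually.of_forall fun x => ?_)
    have : HasDerivAt (fun s : ℝ => F x + s * G x) (G x) 0 := by
      simpa using ((hasDerivAt_id (0 : ℝ)).mul_const (G x)).const_add (F x)
    exact this.deriv.symm

theorem const_mul (c : ℝ) (hF : FExp F k u u') :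
    FExp (fun s x => c * F s x) k (c • u) (c • u') := by
  refine ((const (Exp.const c)).mul hF).cast (zero_add k) |>.lead ?_ ?_ <;>
  simp [Algebra.smul_def]

theorem neg (hF : FExp F k u u') : FExp (fun s x => -F s x) k (-u) (-u') := by
  simpa using hF.const_mul (-1)

theorem sub (hF : FExp F k u u') (hG : FExp G k v v') :
    FExp (fun s x => F s x - G s x) k (u - v) (u' - v') := by
  simpa [sub_eq_add_neg] using hF.add hG.neg

theorem zero (k : ℤ) : FExp (fun _ _ => 0) k 0 0 := const (Exp.zero k)

theorem sum {ι : Type*} {s : Finset ι} {F : ι → ℝ → E → ℝ} {u u' : ι → SF}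
    (h : ∀ i ∈ s, FExp (F i) k (u i) (u' i)) :
    FExp (fun t x => ∑ i ∈ s, F i t x) k (∑ i ∈ s, u i) (∑ i ∈ s, u' i) := by
  classical
  induction s using Finset.induction_on with
  | empty => simpa using zero k
  | insert a s ha ih =>
    simp only [Finset.sum_insert ha]
    exact (h a (Finset.mem_insert_self a s)).add
      (ih fun i hi => h i (Finset.mem_insert_of_mem hi))

theorem weaken (hF : FExp F k u u') (h : l = k + 1) : FExp F l 0 0 :=
  ⟨hF.joint, hF.base.weaken h, hF.der.weaken h⟩

/-- The parameter derivative commutes with the spatial one by symmetry of the second derivative in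
`(s, x)`. This is the reason for requiring `joint` smoothness of the family. -/
theorem pd (hF : FExp F k u u') (i : Fin 3) :
    FExp (fun s => pd i (F s)) (k - 1) (SF.d i u) (SF.d i u') := by
  obtain ⟨ρ, h0, h⟩ := hF.joint
  set Φ : ℝ × E → ℝ := fun z => F z.1 z.2 with hΦ
  set e : E := EuclideanSpace.single i 1 with he
  have near : ∀ x : E, ρ < ‖x‖ → ∀ᶠ z in 𝓝 ((0 : ℝ), x), DifferentiableAt ℝ Φ z := by
    intro x hx
    have h1 : ContDiffAt ℝ 1 Φ (0, x) := (h x hx).of_le (mod_cast le_top)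
    filter_upwards [h1.eventually (by simp)] with z hz
    exact hz.differentiableAt (by simp)
  -- Spatial and parameter derivatives are the values of the joint derivative on `(0, e)` and `(1,
  -- 0)`. The identification is needed on a neighbourhood, since it will be differentiated once
  -- more.
  have hpd : ∀ z : ℝ × E, DifferentiableAt ℝ Φ z →
      AsympFlat.pd i (F z.1) z.2 = fderiv ℝ Φ z (0, e) := by
    intro z hz
    have := (hz.hasFDerivAt.comp (f := fun y : E => (z.1, y)) z.2
      ((hasFDerivAt_const z.1 z.2).prodMk (hasFDerivAt_id z.2))).fderiv
    simp only [AsympFlat.pd]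
    rw [show F z.1 = Φ ∘ fun y : E => (z.1, y) from rfl, this]
    simp [he]
  have hds : ∀ y : E, DifferentiableAt ℝ Φ (0, y) →
      deriv (fun s => F s y) 0 = fderiv ℝ Φ (0, y) (1, 0) := by
    intro y hy
    have h1 : HasFDerivAt (fun s : ℝ => (s, y)) ((ContinuousLinearMap.id ℝ ℝ).prod
        (0 : ℝ →L[ℝ] E)) 0 := (hasFDerivAt_id (0 : ℝ)).prodMk (hasFDerivAt_const y (0 : ℝ))
    have := (HasFDerivAt.comp (f := fun s : ℝ => (s, y)) (0 : ℝ) hy.hasFDerivAt h1)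
    rw [show (fun s => F s y) = Φ ∘ fun s : ℝ => (s, y) from rfl, this.hasDerivAt.deriv]
    simp
  refine ⟨⟨ρ, h0, fun x hx => ?_⟩, hF.base.pd i, (hF.der.pd i).congr ?_⟩
  · have h1 : ContDiffAt ℝ ∞ (fun z => fderiv ℝ Φ z (0, e)) (0, x) :=
      ((h x hx).fderiv_right (m := ∞) le_rfl).clm_apply contDiffAt_const
    exact h1.congr_of_eventuallyEq ((near x hx).mono fun z hz => hpd z hz)
  · filter_upwards [eventually_far ρ] with x hx
    have hd : DifferentiableAt ℝ (fderiv ℝ Φ) (0, x) :=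
      ((h x hx).fderiv_right (m := ∞) le_rfl).differentiableAt (by simp)
    have hsym : IsSymmSndFDerivAt ℝ Φ (0, x) := (h x hx).isSymmSndFDerivAt (by simpa using two_le_smooth)
    have hin : Tendsto (fun y : E => ((0 : ℝ), y)) (𝓝 x) (𝓝 (0, x)) :=
      (Continuous.prodMk_right (0 : ℝ)).tendsto x
    have his : Tendsto (fun s : ℝ => (s, x)) (𝓝 0) (𝓝 (0, x)) :=
      (Continuous.prodMk_left x).tendsto 0
    have e1 : AsympFlat.pd i (fun y => deriv (fun s => F s y) 0) x =
        fderiv ℝ (fderiv ℝ Φ) (0, x) (0, e) (1, 0) := by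
      rw [pd_congr ((hin.eventually (near x hx)).mono fun y hy => hds y hy)]
      have h1 : HasFDerivAt (fun y : E => ((0 : ℝ), y)) ((0 : E →L[ℝ] ℝ).prod
        (ContinuousLinearMap.id ℝ E)) x := (hasFDerivAt_const (0 : ℝ) x).prodMk (hasFDerivAt_id x)
      have h2 := (HasFDerivAt.comp (f := fun y : E => ((0 : ℝ), y)) x hd.hasFDerivAt h1).clm_apply
        (hasFDerivAt_const ((1 : ℝ), (0 : E)) x)
      simp only [AsympFlat.pd]
      simp only [Function.comp_def] at h2
      rw [h2.fderiv]
      simp [he]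
    have e2 : deriv (fun s => AsympFlat.pd i (F s) x) 0 =
        fderiv ℝ (fderiv ℝ Φ) (0, x) (1, 0) (0, e) := by
      have h3 : (fun s => AsympFlat.pd i (F s) x) =ᶠ[𝓝 0] fun s => fderiv ℝ Φ (s, x) (0, e) :=
        (his.eventually (near x hx)).mono fun s hs => hpd (s, x) hs
      rw [h3.deriv_eq]
      have h1 : HasFDerivAt (fun s : ℝ => (s, x)) ((ContinuousLinearMap.id ℝ ℝ).prod
        (0 : ℝ →L[ℝ] E)) 0 := (hasFDerivAt_id (0 : ℝ)).prodMk (hasFDerivAt_const x (0 : ℝ))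
      have h2 := (HasFDerivAt.comp (f := fun s : ℝ => (s, x)) (0 : ℝ) hd.hasFDerivAt h1).clm_apply
        (hasFDerivAt_const ((0 : ℝ), e) (0 : ℝ))
      simp only [Function.comp_def] at h2
      rw [h2.hasDerivAt.deriv]
      simp
    rw [e1, e2]
    exact hsym _ _

theorem base_ne_zero (hF : FExp F 0 1 0) : ∀ᶠ x in cobounded E, F 0 x ≠ 0 :=
  hF.base.eventually_half_lt.mono fun x hx h => by rw [h] at hx; norm_num at hx

theorem joint_comp (hF : FExp F 0 1 0) {φ : ℝ → ℝ} (hφ : ContDiffOn ℝ ∞ φ {0}ᶜ) :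
    ∃ ρ : ℝ, 0 < ρ ∧ ∀ x : E, ρ < ‖x‖ →
      ContDiffAt ℝ ∞ (fun z : ℝ × E => φ (F z.1 z.2)) (0, x) := by
  obtain ⟨a, ha, h1⟩ := hF.joint
  obtain ⟨b, -, hb⟩ := (hasBasis_cobounded_norm (E := E)).eventually_iff.1 hF.base_ne_zero
  refine ⟨max a b, lt_max_of_lt_left ha, fun x hx => ?_⟩
  exact ContDiffAt.comp (0, x) (hφ.contDiffAt (isOpen_compl_singleton.mem_nhds
    (hb ((le_max_right a b).trans hx.le)))) (h1 x ((le_max_left a b).trans_lt hx))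

/-- The variation of $F^{-1}$ is $-F'F^{-2}$, whose order-zero term vanishes together with that of
$F'$. -/
theorem inv (hF : FExp F 0 1 0) : FExp (fun s x => (F s x)⁻¹) 0 1 0 := by
  refine ⟨hF.joint_comp (φ := fun y => y⁻¹) (contDiffOn_id.inv fun x hx => hx), hF.base.inv, ?_⟩
  refine ((hF.der.mul (hF.base.inv.mul hF.base.inv)).neg.lead (by simp)).congr ?_
  filter_upwards [hF.eventually_hasDerivAt, hF.base_ne_zero] with x h1 h2
  rw [(h1.fun_inv h2).deriv]
  field_simp

theorem sqrt (hF : FExp F 0 1 0) : FExp (fun s x => Real.sqrt (F s x)) 0 1 0 := by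
  refine ⟨hF.joint_comp (φ := Real.sqrt) (contDiffOn_id.sqrt fun x hx => hx), hF.base.sqrt, ?_⟩
  refine (((hF.der.mul hF.base.sqrt.inv).const_mul (1 / 2)).lead (by simp)).congr ?_
  filter_upwards [hF.eventually_hasDerivAt, hF.base_ne_zero] with x h1 h2
  rw [(h1.sqrt h2).deriv]
  ring

end FExp
end AsympFlat
end

/-! ### Leading terms of the curvature and of the constraints -/

noncomputable section
namespace AsympFlat

open Filter Asymptotics Bornology Topology

/-- Cartesian components of a two-tensor with entries in the ring of smooth functions on the
punctured space. -/
abbrev Ten2 : Type := Fin 3 → Fin 3 → SF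

/-- At leading order the metric and its inverse act as the identity, and their variations have no
order-zero term. Raising, lowering and tracing therefore leave both leading terms alone; this is
what linearizes the formulas below. -/
theorem FExp.contract {A B : Fin 3 → ℝ → E → ℝ} {k : ℤ} {i : Fin 3} {T T' : Fin 3 → SF}
    (hA : ∀ j, FExp (A j) 0 (SF.δ i j) 0) (hB : ∀ j, FExp (B j) k (T j) (T' j)) :
    FExp (fun s x => ∑ j, A j s x * B j s x) k (T i) (T' i) := by
  refine ((FExp.sum fun j _ => (hA j).mul (hB j)).cast (zero_add k)).lead ?_ ?_
  · exact SF.sum_δ_mul i T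
  · simp only [zero_mul, zero_add]; exact SF.sum_δ_mul i T'

theorem FExp.contract₂ {A B : Fin 3 → ℝ → E → ℝ} {q : Fin 3 → Fin 3 → ℝ → E → ℝ} {k : ℤ}
    {i j : Fin 3} {T T' : Ten2}
    (hA : ∀ m, FExp (A m) 0 (SF.δ i m) 0) (hB : ∀ m, FExp (B m) 0 (SF.δ j m) 0)
    (hq : ∀ m l, FExp (q m l) k (T m l) (T' m l)) :
    FExp (fun s x => ∑ m, ∑ l, A m s x * B l s x * q m l s x) k (T i j) (T' i j) := by
  have h := FExp.contract hA fun m => FExp.contract hB (hq m)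
  have e : (fun s x => ∑ m, A m s x * ∑ l, B l s x * q m l s x) =
      fun s x => ∑ m, ∑ l, A m s x * B l s x * q m l s x := by
    funext s x
    exact Finset.sum_congr rfl fun m _ => by simp only [Finset.mul_sum, mul_assoc]
  rwa [e] at h

/-- A family of metrics that are asymptotically flat. -/
def MetricExp (g : ℝ → Field2) (Q Q' : Ten2) : Prop :=
  ∀ i j, FExp (fun s x => g s i j x - kd i j) (-1) (Q i j) (Q' i j)

/-- A family of momenta that are asymptotically flat. -/
def MomentumExp (p : ℝ → Field2) (P P' : Ten2) : Prop :=
  ∀ i j, FExp (fun s => p s i j) (-2) (P i j) (P' i j)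

/-- Linearized Christoffel symbols. -/
def linΓ (Q : Ten2) (k i j : Fin 3) : SF :=
  (1 / 2 : ℝ) • (SF.d i (Q k j) + SF.d j (Q i k) - SF.d k (Q i j))

/-- Linearized Ricci tensor. -/
def linRic (Q : Ten2) (i j : Fin 3) : SF :=
  ∑ k, (SF.d k (linΓ Q k i j) - SF.d j (linΓ Q k i k))

/-- Addition in `Fin 3` is cyclic, so the minors occur without alternating signs. `invMetric_eq`
uses the same convention. -/
theorem det_eq (g : Field2) (x : E) : (Matrix.of fun k l => g k l x).det =
    ∑ i, g 0 i x * (g 1 (i + 1) x * g 2 (i + 2) x - g 1 (i + 2) x * g 2 (i + 1) x) := by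
  rw [Matrix.det_fin_three, Fin.sum_univ_three]
  simp only [Matrix.of_apply]
  rw [show (1 : Fin 3) + 1 = 2 from rfl, show (1 : Fin 3) + 2 = 0 from rfl,
    show (2 : Fin 3) + 1 = 0 from rfl, show (2 : Fin 3) + 2 = 1 from rfl,
    show (0 : Fin 3) + 1 = 1 from rfl, show (0 : Fin 3) + 2 = 2 from rfl]
  ring

theorem invMetric_eq (g : Field2) (i j : Fin 3) (x : E) : invMetric g i j x =
    ((Matrix.of fun k l => g k l x).det)⁻¹ *
      (g (j + 1) (i + 1) x * g (j + 2) (i + 2) x - g (j + 1) (i + 2) x * g (j + 2) (i + 1) x) := by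
  rw [invMetric, Matrix.inv_def, Matrix.smul_apply, Ring.inverse_eq_inv', smul_eq_mul,
    Matrix.adjugate_fin_three]
  congr 1
  fin_cases i <;> fin_cases j <;>
    simp [show (2 : Fin 3) + 1 = 0 from rfl, show (1 : Fin 3) + 2 = 0 from rfl,
      show (2 : Fin 3) + 2 = 1 from rfl, show (1 : Fin 3) + 1 = 2 from rfl] <;> ring

namespace MetricExp

variable {g : ℝ → Field2} {Q Q' : Ten2} (hg : MetricExp g Q Q')
include hg

theorem entry (i j : Fin 3) : FExp (fun s => g s i j) 0 (SF.δ i j) 0 := by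
  have h := ((hg i j).weaken (l := 0) (by norm_num)).add (FExp.const (Exp.const (kd i j)))
  simp only [sub_add_cancel, zero_add] at h
  exact h

theorem pd (k i j : Fin 3) :
    FExp (fun s => pd k (g s i j)) (-2) (SF.d k (Q i j)) (SF.d k (Q' i j)) := by
  have h := (hg i j).pd k
  have e : (fun s => AsympFlat.pd k (fun x => g s i j x - kd i j)) =
      fun s => AsympFlat.pd k (g s i j) := by
    funext s x
    simp only [AsympFlat.pd, fderiv_sub_const]
  rw [e] at h
  exact h

theorem det : FExp (fun s x => (Matrix.of fun k l => g s k l x).det) 0 1 0 := by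
  simp only [det_eq]
  refine (FExp.contract (i := 0) (hg.entry 0) (k := 0)
    (T := fun i => SF.δ 1 (i + 1) * SF.δ 2 (i + 2) - SF.δ 1 (i + 2) * SF.δ 2 (i + 1))
    (T' := fun _ => 0) fun j => ?_).lead ?_ rfl
  · exact ((((hg.entry 1 (j + 1)).mul (hg.entry 2 (j + 2))).sub
      ((hg.entry 1 (j + 2)).mul (hg.entry 2 (j + 1))))).lead rfl (by simp)
  · simp [SF.δ, kd]

theorem sqrtDet : FExp (fun s => sqrtDet (g s)) 0 1 0 := hg.det.sqrt

theorem inv (i j : Fin 3) : FExp (fun s => invMetric (g s) i j) 0 (SF.δ i j) 0 := by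
  have e : (fun s => invMetric (g s) i j) = fun s x =>
    ((Matrix.of fun k l => g s k l x).det)⁻¹ * (g s (j + 1) (i + 1) x * g s (j + 2) (i + 2) x
      - g s (j + 1) (i + 2) x * g s (j + 2) (i + 1) x) := by
    funext s x
    exact invMetric_eq (g s) i j x
  rw [e]
  refine (hg.det.inv.mul (((hg.entry (j + 1) (i + 1)).mul (hg.entry (j + 2) (i + 2))).sub
    ((hg.entry (j + 1) (i + 2)).mul (hg.entry (j + 2) (i + 1))))).lead ?_ (by simp)
  fin_cases i <;> fin_cases j <;> simp [SF.δ, kd]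

theorem christoffel (k i j : Fin 3) :
    FExp (fun s => christoffel (g s) k i j) (-2) (linΓ Q k i j) (linΓ Q' k i j) :=
  (FExp.contract (hg.inv k) fun l => ((hg.pd i l j).add (hg.pd j i l)).sub
    (hg.pd l i j)).const_mul (1 / 2)

/-- The products of Christoffel symbols have order -4 and drop out. -/
theorem ricci (i j : Fin 3) :
    FExp (fun s => ricci (g s) i j) (-3) (linRic Q i j) (linRic Q' i j) := by
  have h1 := FExp.sum (s := Finset.univ) fun k _ =>
    ((hg.christoffel k i j).pd k).sub ((hg.christoffel k i k).pd j)
  have h2 := FExp.sum (s := Finset.univ) fun k _ => FExp.sum (s := Finset.univ) fun l _ =>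
    ((hg.christoffel k k l).mul (hg.christoffel l i j)).sub
      ((hg.christoffel k j l).mul (hg.christoffel l i k))
  exact (h1.add (h2.weaken (by norm_num))).lead (add_zero _) (add_zero _)

theorem raise {q : ℝ → Field2} {k : ℤ} {T T' : Ten2}
    (hq : ∀ i j, FExp (fun s => q s i j) k (T i j) (T' i j)) (i j : Fin 3) :
    FExp (fun s => raise (g s) (q s) i j) k (T i j) (T' i j) :=
  FExp.contract₂ (hg.inv i) (hg.inv j) hq

theorem lower {q : ℝ → Field2} {k : ℤ} {T T' : Ten2}
    (hq : ∀ i j, FExp (fun s => q s i j) k (T i j) (T' i j)) (i j : Fin 3) :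
    FExp (fun s => lower (g s) (q s) i j) k (T i j) (T' i j) :=
  FExp.contract₂ (hg.entry i) (hg.entry j) hq

theorem trCov {q : ℝ → Field2} {k : ℤ} {T T' : Ten2}
    (hq : ∀ i j, FExp (fun s => q s i j) k (T i j) (T' i j)) :
    FExp (fun s => trCov (g s) (q s)) k (∑ i, T i i) (∑ i, T' i i) :=
  FExp.sum fun i _ => FExp.contract (hg.inv i) (hq i)

theorem trCon {q : ℝ → Field2} {k : ℤ} {T T' : Ten2}
    (hq : ∀ i j, FExp (fun s => q s i j) k (T i j) (T' i j)) :
    FExp (fun s => trCon (g s) (q s)) k (∑ i, T i i) (∑ i, T' i i) :=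
  FExp.sum fun i _ => FExp.contract (hg.entry i) (hq i)

theorem scalarCurv :
    FExp (fun s => scalarCurv (g s)) (-3) (∑ i, linRic Q i i) (∑ i, linRic Q' i i) :=
  hg.trCov hg.ricci

variable {p : ℝ → Field2} {P P' : Ten2} (hp : MomentumExp p P P')
include hp

theorem sqCon : FExp (fun s => sqCon (g s) (p s)) (-3) 0 0 := by
  have := FExp.sum (s := Finset.univ) fun i _ => FExp.sum (s := Finset.univ) fun j _ =>
    (hg.lower hp i j).mul (hp i j)
  exact this.weaken (by norm_num)

/-- Quadratic in a momentum of order -2, hence invisible at order -3, where the curvature enters the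
Hamiltonian constraint. -/
theorem kinetic :
    FExp (fun s x => AsympFlat.sqCon (g s) (p s) x - (1 / 2) * AsympFlat.trCon (g s) (p s) x ^ 2)
      (-3) 0 0 := by
  have h := (((hg.trCon hp).mul (hg.trCon hp)).weaken (l := -3) (by norm_num)).const_mul (1 / 2)
  have := ((hg.sqCon hp).sub h).lead (v := 0) (v' := 0) (by simp) (by simp)
  simpa only [sq] using this

theorem hamConstraint : FExp (fun s => hamConstraint (g s) (p s)) (-3)
    (-∑ i, linRic Q i i) (-∑ i, linRic Q' i i) := by
  have h := (((hg.sqrtDet.inv).mul (hg.kinetic hp)).cast (l := -3) (by norm_num)).sub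
    ((hg.sqrtDet.mul hg.scalarCurv).cast (l := -3) (by norm_num))
  exact h.lead (by simp) (by simp)

theorem momConstraint (i : Fin 3) : FExp (fun s => momConstraint (g s) (p s) i) (-3)
    ((-2 : ℝ) • ∑ j, SF.d j (P i j)) ((-2 : ℝ) • ∑ j, SF.d j (P' i j)) := by
  refine (FExp.contract (hg.entry i) (k := -3) (T := fun k => ∑ j, SF.d j (P k j))
    (T' := fun k => ∑ j, SF.d j (P' k j)) fun k => ?_).const_mul (-2)
  have h1 := FExp.sum (s := Finset.univ) fun j _ => (hp k j).pd j
  have h2 := FExp.sum (s := Finset.univ) fun j _ => FExp.sum (s := Finset.univ) fun l _ =>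
    (hg.christoffel k j l).mul (hp j l)
  exact (h1.add (h2.weaken (by norm_num))).lead (add_zero _) (add_zero _)

end MetricExp

end AsympFlat
end

/-! ### Leading terms of the variations of metric and momentum -/

noncomputable section
namespace AsympFlat

open Filter Asymptotics Bornology Topology

/-- Leading term of the covariant Hessian of `ξ = N + F + …`. -/
def leadHess (Q : Ten2) (N F : SF) (i j : Fin 3) : SF :=
  SF.d i (SF.d j F) - ∑ k, linΓ Q k i j * SF.d k N

/-- Leading term of `δ_ξ g`. -/
def leadMetric (Q P : Ten2) (N : SF) (Y Z : Fin 3 → SF) (i j : Fin 3) : SF :=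
  2 * N * (P i j - (1 / 2 : ℝ) • (SF.δ i j * ∑ m, P m m))
    + ∑ m, (Y m * SF.d m (Q i j) + Q m j * SF.d i (Y m) + Q i m * SF.d j (Y m))
    + (SF.d i (Z j) + SF.d j (Z i))

/-- Leading term of `δ_ξ π`. -/
def leadMomentum (Q P : Ten2) (N F : SF) (Y : Fin 3 → SF) (i j : Fin 3) : SF :=
  -(N * (linRic Q i j - (1 / 2 : ℝ) • (SF.δ i j * ∑ m, linRic Q m m)))
    + (leadHess Q N F i j - SF.δ i j * ∑ m, leadHess Q N F m m)
    + ∑ m, (SF.d m (P i j * Y m) - SF.d m (Y i) * P m j - SF.d m (Y j) * P i m)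

/-- A deformation with the boost part `N`, rotation part `Y`, and next terms `F` and `Z`. -/
structure DefExp (ξ : E → ℝ) (X : VecField) (N F : SF) (Y Z : Fin 3 → SF) : Prop where
  homN : SF.Hom 1 N
  homY : ∀ i, SF.Hom 1 (Y i)
  boost : ∀ i j, SF.d i (SF.d j N) = 0
  killing : ∀ i j, SF.d i (Y j) + SF.d j (Y i) = 0
  normal : Exp (fun x => ξ x - N x) 0 F
  tangential : ∀ i, Exp (fun x => X i x - Y i x) 0 (Z i)

namespace DefExp

variable {ξ : E → ℝ} {X : VecField} {N F : SF} {Y Z : Fin 3 → SF} (h : DefExp ξ X N F Y Z)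
include h

theorem xi : Exp ξ 1 N :=
  ((Exp.of_hom h.homN).add (h.normal.weaken (by norm_num))).lead (add_zero N) |>.congr
    (Eventually.of_forall fun x => by ring)

theorem shift (i : Fin 3) : Exp (X i) 1 (Y i) :=
  ((Exp.of_hom (h.homY i)).add ((h.tangential i).weaken (by norm_num))).lead (add_zero (Y i))
    |>.congr (Eventually.of_forall fun x => by ring)

theorem pd_shift (i j : Fin 3) : ∀ᶠ x in cobounded E,
    pd j (fun x => X i x - Y i x) x = pd j (X i) x - SF.d j (Y i) x := by
  filter_upwards [contDiffAt_eventually (h.shift i).isSymbol.1, eventually_far 0] with x h1 hx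
  rw [SF.d_apply j _ (norm_pos_iff.1 hx), pd_sub' (h1.differentiableAt (by simp))
    ((Y i).differentiableAt (norm_pos_iff.1 hx))]

/-- The Hessian of `N` would have order -1 but vanishes for a boost, so the first contribution is
that of `F`, at order -2. -/
theorem pd_pd_xi (i j : Fin 3) : Exp (pd i (pd j ξ)) (-2) (SF.d i (SF.d j F)) := by
  refine ((h.normal.pd j).pd i).congr ?_
  obtain ⟨ρ, hρ, hs⟩ := h.xi.isSymbol.1
  filter_upwards [eventually_far ρ] with x hx
  have e : pd j (fun x => ξ x - N x) =ᶠ[𝓝 x] fun y => pd j ξ y - SF.d j N y := by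
    filter_upwards [(isOpen_far ρ).mem_nhds hx] with y hy
    have hy0 : y ≠ 0 := norm_pos_iff.1 (hρ.trans hy)
    rw [SF.d_apply j _ hy0,
      pd_sub' ((hs.contDiffAt ((isOpen_far ρ).mem_nhds hy)).differentiableAt (by simp))
        (N.differentiableAt hy0)]
  have hx0 : x ≠ 0 := norm_pos_iff.1 (hρ.trans hx)
  rw [pd_congr e]
  have h2 : pd i (SF.d j N) x = 0 := by
    rw [← SF.d_apply i _ hx0, h.boost i j, SF.zero_apply]
  have h3 : DifferentiableAt ℝ (pd j ξ) x :=
    (contDiffAt_pd (hs.contDiffAt ((isOpen_far ρ).mem_nhds hx)) j).differentiableAt (by simp)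
  rw [pd_sub' h3 ((SF.d j N).differentiableAt hx0), h2, sub_zero]

variable {g p : Field2} {Q P : Ten2} (hg : ∀ i j, Exp (fun x => g i j x - kd i j) (-1) (Q i j))
include hg

omit h in
theorem metricExp_const : MetricExp (fun _ => g) Q (fun _ _ => 0) :=
  fun i j => FExp.const (hg i j)

theorem hess (i j : Fin 3) : Exp (hess g ξ i j) (-2) (leadHess Q N F i j) := by
  have h2 := Exp.sum (s := Finset.univ) fun k _ =>
    (((metricExp_const hg).christoffel k i j).base.mul (h.xi.pd k)).cast (l := -2) (by norm_num)
  exact (h.pd_pd_xi i j).sub h2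

theorem lieMetric (i j : Fin 3) : Exp (lieMetric X g i j) (-1)
    (∑ m, (Y m * SF.d m (Q i j) + Q m j * SF.d i (Y m) + Q i m * SF.d j (Y m))
      + (SF.d i (Z j) + SF.d j (Z i))) := by
  have h1 := Exp.sum (s := Finset.univ) fun m _ =>
    ((((h.shift m).mul ((hg i j).pd m)).cast (l := -1) (by norm_num)).add
      (((hg m j).mul ((h.shift m).pd i)).cast (l := -1) (by norm_num))).add
      (((hg i m).mul ((h.shift m).pd j)).cast (l := -1) (by norm_num))
  have h2 := ((h.tangential j).pd i).add ((h.tangential i).pd j)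
  refine (h1.add h2).congr ?_
  filter_upwards [h.pd_shift j i, h.pd_shift i j] with x e1 e2
  rw [e1, e2]
  -- Contracting with the flat part of the metric leaves $\partial_iX_j+\partial_jX_i$. Killing's
  -- equation removes its order-zero part, and only the derivatives of `Z` survive.
  have hk : SF.d i (Y j) x + SF.d j (Y i) x = 0 := by
    rw [← SF.add_apply, h.killing, SF.zero_apply]
  have e3 : ∀ m, pd m (fun x => g i j x - kd i j) = pd m (g i j) := fun m => by
    funext x; simp only [pd, fderiv_sub_const]
  simp only [AsympFlat.lieMetric, e3]
  have e4 : ∑ m, kd m j * pd i (X m) x = pd i (X j) x := by simp [kd]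
  have e5 : ∑ m, kd i m * pd j (X m) x = pd j (X i) x := by simp [kd]
  have e6 : ∀ m, X m x * pd m (g i j) x + (g m j x - kd m j) * pd i (X m) x +
      (g i m x - kd i m) * pd j (X m) x = X m x * pd m (g i j) x + g m j x * pd i (X m) x +
      g i m x * pd j (X m) x - kd m j * pd i (X m) x - kd i m * pd j (X m) x := fun m => by ring
  simp only [e6, Finset.sum_sub_distrib, e4, e5]
  linear_combination -hk

variable (hp : ∀ i j, Exp (p i j) (-2) (P i j))
include hp

omit h hg in
theorem momentumExp_const : MomentumExp (fun _ => p) P (fun _ _ => 0) :=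
  fun i j => FExp.const (hp i j)

theorem deltaMetric (i j : Fin 3) :
    Exp (deltaMetric g p ξ X i j) (-1) (leadMetric Q P N Y Z i j) := by
  have m := metricExp_const hg
  have q := momentumExp_const hp
  have h1 := ((m.lower q i j).base.sub ((((m.entry i j).base.const_mul (1 / 2)).mul
    (m.trCon q).base).cast (l := -2) (by norm_num)))
  have h2 := (((h.xi.const_mul 2).mul m.sqrtDet.inv.base).mul h1).cast (l := -1) (by norm_num)
  refine (h2.add (h.lieMetric hg i j)).lead ?_
  rw [leadMetric, mul_one, smul_mul_assoc, smul_mul_assoc, ofNat_smul_eq_nsmul,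
    add_assoc (2 * N * _)]
  simp [two_mul, add_mul]

omit hg in
theorem lieMomentum (i j : Fin 3) : Exp (lieMomentum X p i j) (-2)
    (∑ m, (SF.d m (P i j * Y m) - SF.d m (Y i) * P m j - SF.d m (Y j) * P i m)) :=
  Exp.sum (s := Finset.univ) fun m _ =>
    ((((hp i j).mul (h.shift m)).pd m).cast (l := -2) (by norm_num) |>.sub
      ((((h.shift i).pd m).mul (hp m j)).cast (l := -2) (by norm_num))).sub
      ((((h.shift j).pd m).mul (hp i m)).cast (l := -2) (by norm_num))

theorem deltaMomentum (i j : Fin 3) :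
    Exp (deltaMomentum g p ξ X i j) (-2) (leadMomentum Q P N F Y i j) := by
  have m := metricExp_const hg
  have q := momentumExp_const hp
  have h1 : Exp (fun x => -(ξ x * sqrtDet g x * (raise g (ricci g) i j x
      - (1 / 2) * invMetric g i j x * scalarCurv g x))) (-2)
      (-(N * (linRic Q i j - (1 / 2 : ℝ) • (SF.δ i j * ∑ m, linRic Q m m)))) := by
    have a := (m.raise m.ricci i j).base.sub ((((m.inv i j).base.const_mul (1 / 2)).mul
      m.scalarCurv.base).cast (l := -3) (by norm_num))
    refine ((((h.xi.mul m.sqrtDet.base).mul a).cast (l := -2) (by norm_num)).neg).lead ?_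
    rw [mul_one, smul_mul_assoc]
  -- The terms quadratic in the momentum have order $1-4=-3$ after multiplication by `ξ`, so here
  -- and in `h3` the contribution at order -2 is zero.
  have h2 : Exp (fun x => (1 / 2) * ξ x * (sqrtDet g x)⁻¹ * invMetric g i j x
        * (sqCon g p x - (1 / 2) * trCon g p x ^ 2)) (-2) 0 := by
    refine (((((h.xi.const_mul (1 / 2)).mul m.sqrtDet.inv.base).mul (m.inv i j).base).mul
      (m.kinetic q).base).cast (l := -2) (by norm_num)).lead (by simp)
  have h3 : Exp (fun x => 2 * ξ x * (sqrtDet g x)⁻¹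
        * ((∑ m, ∑ l, p i m x * g m l x * p l j x) - (1 / 2) * p i j x * trCon g p x))
        (-2) 0 := by
    have a := Exp.sum (s := Finset.univ) fun k _ => Exp.sum (s := Finset.univ) fun l _ =>
      (((hp i k).mul (m.entry k l).base).mul (hp l j)).weaken (l := -3) (by norm_num)
    have b := (((hp i j).const_mul (1 / 2)).mul (m.trCon q).base).weaken (l := -3) (by norm_num)
    refine ((((h.xi.const_mul 2).mul m.sqrtDet.inv.base).mul (a.sub b)).cast
      (l := -2) (by norm_num)).lead (by simp)
  have h4 : Exp (fun x => sqrtDet g x * (raise g (AsympFlat.hess g ξ) i j x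
      - invMetric g i j x * trCov g (AsympFlat.hess g ξ) x)) (-2)
      (leadHess Q N F i j - SF.δ i j * ∑ m, leadHess Q N F m m) := by
    have hh : ∀ i j, FExp (fun _ => AsympFlat.hess g ξ i j) (-2) (leadHess Q N F i j) 0 :=
      fun i j => FExp.const (h.hess hg i j)
    have a := (m.raise (q := fun _ => AsympFlat.hess g ξ) (T' := fun _ _ => 0) hh i j).base.sub
      (((m.inv i j).base.mul (m.trCov (q := fun _ => AsympFlat.hess g ξ)
        (T' := fun _ _ => 0) hh).base).cast (l := -2) (by norm_num))
    exact ((m.sqrtDet.base.mul a).cast (l := -2) (by norm_num)).lead (one_mul _)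
  refine ((((h1.add h2).sub h3).add h4).add (h.lieMomentum hp i j)).lead ?_
  rw [leadMomentum, add_zero, sub_zero]

end DefExp

theorem isLittleO_pow_mul_iff {F : E → ℝ} {k l : ℤ} (n : ℕ) (hl : l = k + n) :
    ((fun x => ‖x‖ ^ n * F x) =o[cobounded E] fun x => ‖x‖ ^ l) ↔
      F =o[cobounded E] fun x => ‖x‖ ^ k := by
  have e : ∀ᶠ x in cobounded E, ‖x‖ ^ l = ‖x‖ ^ n * ‖x‖ ^ k :=
    (eventually_far 0).mono fun x hx => by rw [hl, zpow_add₀ hx.ne', zpow_natCast, mul_comm]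
  constructor
  · intro h
    refine ((isBigO_refl (fun x : E => (‖x‖ ^ n)⁻¹) _).mul_isLittleO h).congr' ?_ ?_
    · filter_upwards [eventually_far 0] with x hx
      rw [inv_mul_cancel_left₀ (pow_ne_zero n hx.ne')]
    · filter_upwards [eventually_far 0, e] with x hx e
      rw [e, inv_mul_cancel_left₀ (pow_ne_zero n hx.ne')]
  · intro h
    exact ((isBigO_refl (fun x : E => ‖x‖ ^ n) _).mul_isLittleO h).congr' .rfl
      (e.mono fun _ h => h.symm)

theorem exp_nrm (i : Fin 3) : Exp (nrm i) 0 (SF.n i) :=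
  (Exp.of_hom (SF.hom_n i)).congr <| (eventually_far 0).mono fun _ hx =>
    SF.n_apply i (norm_pos_iff.1 hx)

/-- The projector on the tangent spaces of the spheres. -/
def SF.γ (i j : Fin 3) : SF := SF.δ i j - SF.n i * SF.n j

theorem exp_proj (i j : Fin 3) : Exp (proj i j) 0 (SF.γ i j) :=
  (Exp.const (kd i j)).sub ((exp_nrm i).mul (exp_nrm j))

/-- The constraint fall-off holds exactly when the leading terms of the constraints vanish. -/
theorem constraintFalloff_iff {H : E → ℝ} {M : VecField} {u : SF} {w : Fin 3 → SF}
    (hH : Exp H (-3) u) (hM : ∀ i, Exp (M i) (-3) (w i)) :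
    ConstraintFalloff H M ↔ u = 0 ∧ ∀ i, w i = 0 := by
  have e1 : ((fun x => ‖x‖ ^ 2 * H x) =o[cobounded E] fun x => ‖x‖⁻¹) ↔ u = 0 := by
    rw [← hH.isLittleO_iff, ← isLittleO_pow_mul_iff 2 (l := -1) (by norm_num)]
    simp only [zpow_neg_one]
  have r1 : Exp (fun x => ∑ i, nrm i x * M i x) (-3) (∑ i, SF.n i * w i) :=
    Exp.sum fun i _ => ((exp_nrm i).mul (hM i)).cast (by norm_num)
  have e2 : ((fun x => ‖x‖ ^ 2 * ∑ i, nrm i x * M i x) =o[cobounded E] fun x => ‖x‖⁻¹) ↔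
      ∑ i, SF.n i * w i = 0 := by
    rw [← r1.isLittleO_iff, ← isLittleO_pow_mul_iff 2 (l := -1) (by norm_num)]
    simp only [zpow_neg_one]
  have r2 : ∀ a, Exp (fun x => ∑ i, proj a i x * M i x) (-3) (∑ i, SF.γ a i * w i) := fun a =>
    Exp.sum fun i _ => ((exp_proj a i).mul (hM i)).cast (by norm_num)
  have e3 : ∀ a, ((fun x => ‖x‖ ^ 3 * ∑ i, proj a i x * M i x) =o[cobounded E]
      fun _ => (1 : ℝ)) ↔ ∑ i, SF.γ a i * w i = 0 := fun a => by
    rw [← (r2 a).isLittleO_iff, ← isLittleO_pow_mul_iff 3 (l := 0) (by norm_num)]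
    simp only [zpow_zero]
  -- Radial and angular conditions together control all Cartesian components, since $w=\gamma
  -- w+n\,(n\cdot w)$.
  have e4 : ∀ a, ∑ i, SF.γ a i * w i = w a - SF.n a * ∑ i, SF.n i * w i := fun a => by
    simp only [SF.γ, sub_mul, Finset.sum_sub_distrib, SF.sum_δ_mul, Finset.mul_sum, mul_assoc]
  constructor
  · rintro ⟨h1, h2, h3⟩
    refine ⟨e1.1 h1, fun a => ?_⟩
    have := (e3 a).1 (h3 a)
    rwa [e4, e2.1 h2, mul_zero, sub_zero] at this
  · rintro ⟨h1, h2⟩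
    exact ⟨e1.2 h1, e2.2 (by simp [h2]), fun a => (e3 a).2 (by simp [h2])⟩

/-- Leading term of the Hamiltonian constraint. -/
def leadHam (Q : Ten2) : SF := ∑ i, linRic Q i i

/-- Leading term of the divergence of the momentum. -/
def leadDiv (P : Ten2) (i : Fin 3) : SF := ∑ j, SF.d j (P i j)

theorem smul_eq_zero_iff' {c : ℝ} (hc : c ≠ 0) {u : SF} : c • u = 0 ↔ u = 0 := by
  constructor
  · intro h
    rw [← inv_smul_smul₀ hc u, h, smul_zero]
  · rintro rfl
    rw [smul_zero]

theorem constraints_iff {g p : Field2} {Q P : Ten2}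
    (hg : ∀ i j, Exp (fun x => g i j x - kd i j) (-1) (Q i j)) (hp : ∀ i j, Exp (p i j) (-2) (P i j)) :
    ConstraintFalloff (hamConstraint g p) (momConstraint g p) ↔
      leadHam Q = 0 ∧ ∀ i, leadDiv P i = 0 := by
  have m := DefExp.metricExp_const hg
  have q := DefExp.momentumExp_const hp
  rw [constraintFalloff_iff (m.hamConstraint q).base fun i => (m.momConstraint q i).base]
  exact and_congr neg_eq_zero (forall_congr' fun i => smul_eq_zero_iff' (by norm_num))

/-- Along the affine family in the direction `(dg, dp)` the leading terms of the constraints depend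
linearly on those of the fields. Their first variation is thus the same expression, evaluated at
`Q'` and `P'`. -/
theorem varConstraints_iff {g p dg dp : Field2} {Q P Q' P' : Ten2}
    (hg : ∀ i j, Exp (fun x => g i j x - kd i j) (-1) (Q i j)) (hp : ∀ i j, Exp (p i j) (-2) (P i j))
    (hdg : ∀ i j, Exp (dg i j) (-1) (Q' i j)) (hdp : ∀ i j, Exp (dp i j) (-2) (P' i j)) :
    ConstraintFalloff (varHam g p dg dp) (varMom g p dg dp) ↔
      leadHam Q' = 0 ∧ ∀ i, leadDiv P' i = 0 := by
  have m : MetricExp (fun s i j y => g i j y + s * dg i j y) Q Q' := fun i j => by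
    have := FExp.affine (hg i j) (hdg i j)
    simpa only [sub_add_eq_add_sub] using this
  have q : MomentumExp (fun s i j y => p i j y + s * dp i j y) P P' := fun i j =>
    FExp.affine (hp i j) (hdp i j)
  rw [constraintFalloff_iff (H := varHam g p dg dp) (M := varMom g p dg dp)
    (m.hamConstraint q).der fun i => (m.momConstraint q i).der]
  exact and_congr neg_eq_zero (forall_congr' fun i => smul_eq_zero_iff' (by norm_num))

end AsympFlat
end

/-! ### Preservation of the linearized constraints -/

noncomputable section
namespace AsympFlat
open SF

/-- Symmetry of `Q` and commuting derivatives collapse the contracted Ricci tensor to a double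
divergence minus the Laplacian of the trace. -/
theorem leadHam_eq {Q : Ten2} (hQ : ∀ i j, Q i j = Q j i) :
    leadHam Q = ∑ i, ∑ j, (d i (d j (Q i j)) - d i (d i (Q j j))) := by
  simp only [leadHam, linRic, linΓ, Derivation.map_smul, map_add, map_sub, Fin.sum_univ_three,
    hQ 1 0, hQ 2 0, hQ 2 1, d_comm 1 0, d_comm 2 0, d_comm 2 1]
  algebra

/-- An infinitesimal diffeomorphism of flat space creates no curvature. -/
theorem leadHam_gauge (Z : Fin 3 → SF) : leadHam (fun i j => d i (Z j) + d j (Z i)) = 0 := by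
  rw [leadHam_eq fun i j => add_comm _ _]
  simp only [map_add, Fin.sum_univ_three, d_comm 1 0, d_comm 2 0, d_comm 2 1]
  ring

theorem leadHam_add {Q Q' : Ten2} : leadHam (fun i j => Q i j + Q' i j) =
    leadHam Q + leadHam Q' := by
  simp only [leadHam, linRic, linΓ, ← Finset.sum_add_distrib]
  refine Finset.sum_congr rfl fun i _ => Finset.sum_congr rfl fun j _ => ?_
  simp only [Derivation.map_smul, map_add, map_sub]
  algebra

/-- $\partial_i\partial_jY_k$ is symmetric in the first two indices and antisymmetric in the last
two, hence zero. This is used again for the parity of rotations. -/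
theorem killing_second {Y : Fin 3 → SF} (hY : ∀ i j, d i (Y j) + d j (Y i) = 0) (i j k : Fin 3) :
    d i (d j (Y k)) = 0 := by
  have key : ∀ i j k, d i (d j (Y k)) = -d i (d k (Y j)) := fun i j k => by
    rw [eq_neg_iff_add_eq_zero, ← map_add, hY, map_zero]
  have h1 := key i j k
  have h2 := key k i j
  have h3 := key j k i
  rw [d_comm i k] at h1
  rw [d_comm k j] at h2
  rw [d_comm j i] at h3
  exact two_smul_inj (by linear_combination h1 - h2 + h3)

theorem d_two (i : Fin 3) : d i (2 : SF) = 0 := by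
  simpa using (d i).map_natCast 2

/-- For the tensor $2NP_{ij}-\delta_{ij}N\,\mathrm{tr}P$ the two Laplacians of $N\,\mathrm{tr}P$
cancel. Since `N` has zero Hessian, the double divergence of $2NP$ contains only the divergence of
`P` and its derivatives. -/
theorem leadHam_boost {N : SF} (hN : ∀ i j, d i (d j N) = 0) {P : Ten2}
    (hP : ∀ i j, P i j = P j i) (hdiv : ∀ i, leadDiv P i = 0) :
    leadHam (fun i j => 2 * N * (P i j - (1 / 2 : ℝ) • (δ i j * ∑ m, P m m))) = 0 := by
  have e : (fun i j => 2 * N * (P i j - (1 / 2 : ℝ) • (δ i j * ∑ m, P m m))) =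
      fun i j => 2 * (N * P i j) - δ i j * (N * ∑ m, P m m) := by
    funext i j; algebra
  rw [e, leadHam_eq fun i j => by rw [hP i j, δ_comm i j]]
  have e1 : ∀ k i, d k (∑ j, d j (P i j)) = 0 := fun k i => by
    rw [show ∑ j, d j (P i j) = 0 from hdiv i, map_zero]
  have e0 : ∀ i, ∑ j, d j (P i j) = 0 := hdiv
  have z0 := e0 0
  have z1 := e0 1
  have z2 := e0 2
  have y0 := e1 0 0
  have y1 := e1 1 1
  have y2 := e1 2 2
  simp only [Fin.sum_univ_three, map_add] at z0 z1 z2 y0 y1 y2 ⊢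
  have n01 : δ 0 1 = 0 := δ_ne (by decide)
  have n02 : δ 0 2 = 0 := δ_ne (by decide)
  have n12 : δ 1 2 = 0 := δ_ne (by decide)
  have n10 : δ 1 0 = 0 := δ_ne (by decide)
  have n20 : δ 2 0 = 0 := δ_ne (by decide)
  have n21 : δ 2 1 = 0 := δ_ne (by decide)
  simp only [δ_self, n01, n02, n12, n10, n20, n21, one_mul, zero_mul, sub_zero,
    d_mul, map_add, map_sub, hN, d_two, zero_add, hP 1 0, hP 2 0, hP 2 1, d_comm 1 0, d_comm 2 0,
    d_comm 2 1] at z0 z1 z2 y0 y1 y2 ⊢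
  linear_combination 2 * N * (y0 + y1 + y2) + 4 * d 0 N * z0 + 4 * d 1 N * z1 + 4 * d 2 N * z2

/-- The linearized scalar curvature is built from the flat metric alone, so it commutes with the Lie
derivative along a flat Killing field. -/
theorem leadHam_lie {Y : Fin 3 → SF} (hY : ∀ i j, d i (Y j) + d j (Y i) = 0) {Q : Ten2}
    (hQ : ∀ i j, Q i j = Q j i) :
    leadHam (fun i j => ∑ m, (Y m * d m (Q i j) + Q m j * d i (Y m) + Q i m * d j (Y m))) =
      ∑ m, Y m * d m (leadHam Q) := by
  have hY2 := killing_second hY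
  rw [leadHam_eq hQ, leadHam_eq fun i j => Finset.sum_congr rfl fun m _ => by
    rw [hQ i j, hQ m j, hQ i m]; ring]
  have a : ∀ i, d i (Y i) = 0 := fun i => two_smul_inj (by linear_combination hY i i)
  have a10 : d 1 (Y 0) = -d 0 (Y 1) := by linear_combination hY 1 0
  have a20 : d 2 (Y 0) = -d 0 (Y 2) := by linear_combination hY 2 0
  have a21 : d 2 (Y 1) = -d 1 (Y 2) := by linear_combination hY 2 1
  simp only [Fin.sum_univ_three, map_add, map_sub, d_mul, hY2, a, a10, a20, a21, mul_zero, add_zero,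
    hQ 1 0, hQ 2 0, hQ 2 1, d_comm 1 0, d_comm 2 0, d_comm 2 1, mul_neg, neg_mul]
  ring


/-- The variation of the metric satisfies the linearized Hamiltonian constraint. -/
theorem leadHam_leadMetric {Q P : Ten2} {N : SF} {Y Z : Fin 3 → SF}
    (hN : ∀ i j, d i (d j N) = 0) (hY : ∀ i j, d i (Y j) + d j (Y i) = 0)
    (hQ : ∀ i j, Q i j = Q j i) (hP : ∀ i j, P i j = P j i)
    (hham : leadHam Q = 0) (hdiv : ∀ i, leadDiv P i = 0) :
    leadHam (leadMetric Q P N Y Z) = 0 := by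
  have h1 := leadHam_add (Q := fun i j => 2 * N * (P i j - (1 / 2 : ℝ) • (δ i j * ∑ m, P m m))
      + ∑ m, (Y m * SF.d m (Q i j) + Q m j * SF.d i (Y m) + Q i m * SF.d j (Y m)))
    (Q' := fun i j => SF.d i (Z j) + SF.d j (Z i))
  have h2 := leadHam_add (Q := fun i j => 2 * N * (P i j - (1 / 2 : ℝ) • (δ i j * ∑ m, P m m)))
    (Q' := fun i j => ∑ m, (Y m * SF.d m (Q i j) + Q m j * SF.d i (Y m) + Q i m * SF.d j (Y m)))
  refine h1.trans ?_
  rw [h2, leadHam_gauge, leadHam_lie hY hQ, leadHam_boost hN hP hdiv, hham]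
  simp

theorem linΓ_symm {Q : Ten2} (hQ : ∀ i j, Q i j = Q j i) (k i j : Fin 3) :
    linΓ Q k i j = linΓ Q k j i := by
  rw [linΓ, linΓ, hQ k j, hQ k i, hQ i j, add_comm (d i _)]

theorem two_mul_linRic {Q : Ten2} (hQ : ∀ i j, Q i j = Q j i) (i j : Fin 3) :
    2 * linRic Q i j = ∑ k, (d k (d i (Q k j)) + d k (d j (Q k i)) - d k (d k (Q i j))
      - d i (d j (Q k k))) := by
  rw [linRic, Finset.mul_sum]
  refine Finset.sum_congr rfl fun k _ => ?_
  simp only [linΓ, Derivation.map_smul, map_add, map_sub, d_comm j i, hQ i k]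
  algebra

theorem linRic_symm {Q : Ten2} (hQ : ∀ i j, Q i j = Q j i) (i j : Fin 3) :
    linRic Q i j = linRic Q j i := two_smul_inj <| by
  rw [two_mul_linRic hQ, two_mul_linRic hQ]
  refine Finset.sum_congr rfl fun k _ => ?_
  rw [hQ i j, d_comm i j]; ring

/-- The linearized contracted Bianchi identity. -/
theorem linBianchi {Q : Ten2} (hQ : ∀ i j, Q i j = Q j i) (i : Fin 3) :
    2 * ∑ j, d j (linRic Q i j) = d i (leadHam Q) := by
  have h : ∀ j, d j (linRic Q i j) + d j (linRic Q i j) =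
      ∑ k, (d j (d k (d i (Q k j))) + d j (d k (d j (Q k i))) - d j (d k (d k (Q i j)))
      - d j (d i (d j (Q k k)))) := fun j => by
    rw [← map_add, ← two_mul, two_mul_linRic hQ]
    simp only [map_sum, map_add, map_sub]
  rw [two_mul, ← Finset.sum_add_distrib, Finset.sum_congr rfl fun j _ => h j, leadHam_eq hQ]
  simp only [map_sub, map_add, Fin.sum_univ_three, hQ 1 0, hQ 2 0, hQ 2 1]
  fin_cases i <;>
  simp only [Fin.zero_eta, Fin.mk_one, Fin.reduceFinMk, hQ 1 0, hQ 2 0, hQ 2 1,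
    d_comm 1 0, d_comm 2 0, d_comm 2 1] <;> ring

/-- Applied to the Christoffel part of the Hessian, this yields the Ricci term that compensates the
gradient of the lapse in `leadDiv_leadMomentum`. -/
theorem div_linΓ {Q : Ten2} (hQ : ∀ i j, Q i j = Q j i) (i k : Fin 3) :
    ∑ j, d j (linΓ Q k i j) - d i (∑ j, linΓ Q k j j) = -linRic Q i k := two_smul_inj <| by
  rw [mul_neg, two_mul_linRic hQ]
  simp only [map_sum]
  rw [← Finset.sum_sub_distrib, Finset.mul_sum, ← Finset.sum_neg_distrib]
  refine Finset.sum_congr rfl fun j _ => ?_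
  simp only [linΓ, Derivation.map_smul, map_add, map_sub, hQ k j, hQ i j, d_comm j i, d_comm j k,
    d_comm i k]
  algebra

/-- Because `Y` is Killing with zero second derivatives, only the divergence of `P` and its first
derivatives remain. -/
theorem leadDiv_lie {Y : Fin 3 → SF} (hY : ∀ i j, d i (Y j) + d j (Y i) = 0) {P : Ten2}
    (hdiv : ∀ i, leadDiv P i = 0) (i : Fin 3) :
    leadDiv (fun i j => ∑ m, (d m (P i j * Y m) - d m (Y i) * P m j - d m (Y j) * P i m)) i
      = 0 := by
  have hY2 := killing_second hY
  have a : ∀ i, d i (Y i) = 0 := fun i => two_smul_inj (by linear_combination hY i i)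
  have e0 : ∀ i, ∑ j, d j (P i j) = 0 := hdiv
  have e1 : ∀ k i, d k (∑ j, d j (P i j)) = 0 := fun k i => by rw [e0, map_zero]
  have y0 := e1 0 i
  have y1 := e1 1 i
  have y2 := e1 2 i
  simp only [leadDiv, Fin.sum_univ_three, map_add, map_sub, map_zero, d_mul, hY2, a,
    d_comm 1 0, d_comm 2 0, d_comm 2 1] at e0 y0 y1 y2 ⊢
  linear_combination Y 0 * y0 + Y 1 * y1 + Y 2 * y2 -
    d 0 (Y i) * e0 0 - d 1 (Y i) * e0 1 - d 2 (Y i) * e0 2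

/-- The variation of the momentum satisfies the linearized momentum constraint. -/
theorem leadDiv_leadMomentum {Q P : Ten2} {N F : SF} {Y : Fin 3 → SF}
    (hN : ∀ i j, d i (d j N) = 0) (hY : ∀ i j, d i (Y j) + d j (Y i) = 0)
    (hQ : ∀ i j, Q i j = Q j i) (hham : leadHam Q = 0) (hdiv : ∀ i, leadDiv P i = 0) (i : Fin 3) :
    leadDiv (leadMomentum Q P N F Y) i = 0 := by
  have hR : ∑ m, linRic Q m m = 0 := hham
  have hB : ∑ j, d j (linRic Q i j) = 0 := two_smul_inj <| by
    rw [linBianchi hQ, hham, map_zero, mul_zero]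
  have hL := leadDiv_lie hY hdiv i
  have hG : ∀ k, ∑ j, d j (linΓ Q k i j) - d i (∑ j, linΓ Q k j j) = -linRic Q i k :=
    fun k => div_linΓ hQ i k
  have e : leadDiv (leadMomentum Q P N F Y) i =
      -∑ j, (d j N * linRic Q i j + N * d j (linRic Q i j))
      + (∑ j, d j (leadHess Q N F i j) - d i (∑ m, leadHess Q N F m m))
      + leadDiv (fun i j => ∑ m, (d m (P i j * Y m) - d m (Y i) * P m j - d m (Y j) * P i m)) i := by
    have e2 : ∑ j, d j (δ i j * ∑ m, leadHess Q N F m m) = d i (∑ m, leadHess Q N F m m) := by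
      simp only [d_mul, d_δ, zero_mul, zero_add]
      exact sum_δ_mul i _
    rw [← e2]
    simp only [leadDiv, leadMomentum, hR, mul_zero, smul_zero, sub_zero]
    rw [← Finset.sum_neg_distrib, ← Finset.sum_sub_distrib, ← Finset.sum_add_distrib,
      ← Finset.sum_add_distrib]
    refine Finset.sum_congr rfl fun j _ => ?_
    simp only [map_add, map_neg, d_mul, map_sub]
  rw [e, hL]
  -- In the divergence of $\mathrm{Hess}-\delta\,\mathrm{tr}\,\mathrm{Hess}$ the part with `F`
  -- cancels and $R_{ik}\partial_kN$ is left. It cancels the derivative of `N` in the divergence of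
  -- $-NR_{ij}$, while the Bianchi identity removes the rest.
  have h1 : ∑ j, d j (leadHess Q N F i j) - d i (∑ m, leadHess Q N F m m) =
      ∑ k, linRic Q i k * d k N := by
    have h2 : ∑ k, linRic Q i k * d k N =
        -∑ k, (∑ j, d j (linΓ Q k i j) - d i (∑ j, linΓ Q k j j)) * d k N := by
      rw [← Finset.sum_neg_distrib]
      exact Finset.sum_congr rfl fun k _ => by rw [hG]; ring
    rw [h2]
    simp only [leadHess, map_sub, d_mul, hN, mul_zero, add_zero, Fin.sum_univ_three,
      map_add]
    rw [d_comm 0 i, d_comm 1 i, d_comm 2 i]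
    ring
  rw [h1, Finset.sum_add_distrib, ← Finset.mul_sum, hB]
  simp only [mul_zero, add_zero, mul_comm (d _ N)]
  ring

end AsympFlat
end

/-! ### Covariant derivatives on the sphere in Cartesian components -/

noncomputable section
namespace AsympFlat

open Filter Asymptotics Bornology Topology

namespace SF

/-- Euler's relation. -/
theorem Hom.euler {k : ℤ} {u : SF} (hu : Hom k u) : ∑ i, X i * d i u = (k : ℝ) • u :=
  ext' fun x hx => by
    rw [sum_apply, smul_apply]
    -- Both sides are the derivative of $t\mapsto u(tx)$ at $t=1$.
    have h1 : HasDerivAt (fun t : ℝ => u (t • x)) (fderiv ℝ u x x) 1 := by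
      have h2 : HasDerivAt (fun t : ℝ => t • x) x 1 := by
        simpa using (hasDerivAt_id (1 : ℝ)).smul_const x
      have h3 : HasFDerivAt u (fderiv ℝ u x) ((1 : ℝ) • x) := by
        rw [one_smul]; exact (u.differentiableAt hx).hasFDerivAt
      exact h3.comp_hasDerivAt (1 : ℝ) h2
    have h4 : HasDerivAt (fun t : ℝ => t ^ k * u x) ((k : ℝ) * u x) 1 := by
      have := (hasDerivAt_zpow k (1 : ℝ) (Or.inl one_ne_zero)).mul_const (u x)
      simpa using this
    have h5 : (fun t : ℝ => u (t • x)) =ᶠ[𝓝 1] fun t => t ^ k * u x := by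
      filter_upwards [lt_mem_nhds (zero_lt_one : (0 : ℝ) < 1)] with t ht
      exact hu t x ht hx
    rw [← h1.unique (h4.congr_of_eventuallyEq h5)]
    have hxs : x = ∑ i, x i • (EuclideanSpace.single i (1 : ℝ) : E) := by
      ext j
      simp [Pi.single_apply]
    conv_rhs => arg 2; rw [hxs]
    rw [map_sum]
    refine Finset.sum_congr rfl fun i _ => ?_
    rw [mul_apply, X_apply i hx, d_apply i u hx, map_smul]
    rfl

theorem Hom.sum_n_d {k : ℤ} {u : SF} (hu : Hom k u) : ∑ i, n i * d i u = (k : ℝ) • (ri * u) := by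
  have h := hu.euler
  have e : ∑ i, n i * d i u = ri * ∑ i, X i * d i u := by
    rw [Finset.mul_sum]
    exact Finset.sum_congr rfl fun i _ => by rw [n]; ring
  rw [e, h, mul_smul_comm]

theorem Hom.sum_n_d_zero {u : SF} (hu : Hom 0 u) : ∑ i, n i * d i u = 0 := by
  rw [hu.sum_n_d]; simp

theorem Hom.congr {k l : ℤ} {u : SF} (hu : Hom k u) (h : k = l) : Hom l u := h ▸ hu

theorem hom_γ (i j : Fin 3) : Hom 0 (γ i j) :=
  (hom_δ i j).sub (((hom_n i).mul (hom_n j)).congr (add_zero 0))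

theorem γ_comm (i j : Fin 3) : γ i j = γ j i := by rw [γ, γ, δ_comm, mul_comm (n i)]

theorem γ_apply (i j : Fin 3) {x : E} (hx : x ≠ 0) : γ i j x = proj i j x := by
  rw [γ, sub_apply, mul_apply, n_apply i hx, n_apply j hx, δ, algebraMap_apply _ hx]; rfl

theorem sum_n_γ (j : Fin 3) : ∑ i, n i * γ i j = 0 := by
  have : ∀ i, n i * γ i j = δ j i * n i - n i * n i * n j := fun i => by
    rw [γ, δ_comm i j]; ring
  simp only [this, Finset.sum_sub_distrib, sum_δ_mul, ← Finset.sum_mul, sum_n_sq]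
  ring

/-- Tangential vectors are fixed by the projector. -/
theorem sum_γ_mul {V : Fin 3 → SF} (hV : ∑ i, n i * V i = 0) (a : Fin 3) :
    ∑ i, γ a i * V i = V a := by
  simp only [γ, sub_mul, Finset.sum_sub_distrib, sum_δ_mul, mul_assoc, ← Finset.mul_sum, hV]
  ring

/-- Derivative of a tangency relation. -/
theorem sum_n_d_tangent {V : Fin 3 → SF} (hV : ∑ i, n i * V i = 0) (c : Fin 3) :
    ∑ i, n i * d c (V i) = -(ri * V c) := by
  have h := congrArg (d c) hV
  simp only [map_sum, d_mul, d_n, map_zero, Finset.sum_add_distrib] at h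
  have e : ∑ i, ri * (δ c i - n c * n i) * V i = ri * V c := by
    have : ∀ i, ri * (δ c i - n c * n i) * V i = ri * (δ c i * V i) - ri * n c * (n i * V i) :=
      fun i => by ring
    simp only [this, Finset.sum_sub_distrib, ← Finset.mul_sum, sum_δ_mul, hV]
    ring
  linear_combination h - e

/-- The normal part of the derivative of a tangential field is fixed by tangency. Projected
derivatives therefore have closed forms without sums over projectors, and these are taken as `D1`,
`D2` and `D3` below. -/
theorem sum_γ_d_tangent {V : Fin 3 → SF} (hV : ∑ i, n i * V i = 0) (a c : Fin 3) :
    ∑ i, γ a i * d c (V i) = d c (V a) + ri * n a * V c := by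
  simp only [γ, sub_mul, Finset.sum_sub_distrib, sum_δ_mul, mul_assoc, ← Finset.mul_sum,
    sum_n_d_tangent hV]
  ring

/-- Gradient on the spheres. -/
def D0 (u : SF) (a : Fin 3) : SF := r * d a u

/-- Covariant derivative of tangential vectors. -/
def D1 (V : Fin 3 → SF) (c a : Fin 3) : SF := r * d c (V a) + n a * V c

/-- Covariant derivative of tangential two-tensors. -/
def D2 (k : Ten2) (c a b : Fin 3) : SF := r * d c (k a b) + n a * k c b + n b * k a c

/-- Covariant derivative of tangential three-tensors. -/
def D3 (t : Fin 3 → Ten2) (m c a b : Fin 3) : SF :=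
  r * d m (t c a b) + n c * t m a b + n a * t c m b + n b * t c a m

protected theorem Hom.D0 {u : SF} (hu : Hom 0 u) (a : Fin 3) : Hom 0 (D0 u a) :=
  (hom_r.mul (hu.d a)).congr (by norm_num)

/-- Tangential vectors. -/
def Tan1 (V : Fin 3 → SF) : Prop := ∑ a, n a * V a = 0

/-- Two-tensors that are tangential in both indices. -/
def Tan2 (k : Ten2) : Prop := (∀ b, Tan1 fun a => k a b) ∧ ∀ a, Tan1 (k a)

/-- Three-tensors that are tangential in all indices. -/
def Tan3 (t : Fin 3 → Ten2) : Prop := (∀ a b, Tan1 fun c => t c a b) ∧ ∀ c, Tan2 (t c)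

theorem tan_D0 {u : SF} (hu : Hom 0 u) : Tan1 (D0 u) := by
  have h := hu.sum_n_d_zero
  have : ∀ a, n a * D0 u a = r * (n a * d a u) := fun a => by rw [D0]; ring
  simp only [Tan1, this, ← Finset.mul_sum, h, mul_zero]

theorem sum_n_r_d {u : SF} (hu : Hom 0 u) : ∑ c, n c * (r * d c u) = 0 := tan_D0 hu

theorem sum_n_r_d_tangent {V : Fin 3 → SF} (hV : Tan1 V) (c : Fin 3) :
    ∑ i, n i * (r * d c (V i)) = -V c := by
  have h := sum_n_d_tangent hV c
  have : ∀ i, n i * (r * d c (V i)) = r * (n i * d c (V i)) := fun i => by ring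
  simp only [this, ← Finset.mul_sum, h]
  linear_combination -V c * r_mul_ri

theorem sum_n_n_mul (u : SF) : ∑ i, n i * (n i * u) = u := by
  simp only [← mul_assoc, ← Finset.sum_mul, sum_n_sq, one_mul]

theorem sum_n_mul_left {V : Fin 3 → SF} (hV : Tan1 V) (u : SF) : ∑ i, n i * (u * V i) = 0 := by
  have : ∀ i, n i * (u * V i) = u * (n i * V i) := fun i => by ring
  simp only [this, ← Finset.mul_sum, show ∑ i, n i * V i = 0 from hV, mul_zero]

/-- In the derivative index tangency is Euler's relation in degree zero. In the other index the term
with `n a` compensates the normal part of the derivative. -/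
theorem tan_D1 {V : Fin 3 → SF} (hV : ∀ a, Hom 0 (V a)) (tV : Tan1 V) : Tan2 (D1 V) := by
  constructor
  · intro b
    simp only [Tan1, D1, mul_add, Finset.sum_add_distrib, sum_n_r_d (hV b), sum_n_mul_left tV,
      add_zero]
  · intro a
    simp only [Tan1, D1, mul_add, Finset.sum_add_distrib, sum_n_r_d_tangent tV, sum_n_n_mul]
    ring

theorem tan_D2 {k : Ten2} (hk : ∀ a b, Hom 0 (k a b)) (tk : Tan2 k) : Tan3 (D2 k) := by
  refine ⟨fun a b => ?_, fun c => ⟨fun b => ?_, fun a => ?_⟩⟩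
  · simp only [Tan1, D2, mul_add, Finset.sum_add_distrib, sum_n_r_d (hk a b),
      sum_n_mul_left (tk.1 b), sum_n_mul_left (tk.2 a), add_zero]
  · simp only [Tan1, D2, mul_add, Finset.sum_add_distrib, sum_n_r_d_tangent (tk.1 b), sum_n_n_mul,
      sum_n_mul_left (tk.1 c)]
    ring
  · simp only [Tan1, D2, mul_add, Finset.sum_add_distrib, sum_n_r_d_tangent (tk.2 a), sum_n_n_mul,
      sum_n_mul_left (tk.2 c)]
    ring

theorem tan_D3 {t : Fin 3 → Ten2} (tt : Tan3 t) (m : Fin 3) : Tan3 (D3 t m) := by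
  refine ⟨fun a b => ?_, fun c => ⟨fun b => ?_, fun a => ?_⟩⟩
  · simp only [Tan1, D3, mul_add, Finset.sum_add_distrib, sum_n_r_d_tangent (tt.1 a b), sum_n_n_mul,
      sum_n_mul_left (tt.1 m b), sum_n_mul_left (tt.1 a m)]
    ring
  · simp only [Tan1, D3, mul_add, Finset.sum_add_distrib, sum_n_r_d_tangent ((tt.2 c).1 b),
      sum_n_n_mul, sum_n_mul_left ((tt.2 m).1 b), sum_n_mul_left ((tt.2 c).1 m)]
    ring
  · simp only [Tan1, D3, mul_add, Finset.sum_add_distrib, sum_n_r_d_tangent ((tt.2 c).2 a),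
      sum_n_n_mul, sum_n_mul_left ((tt.2 m).2 a), sum_n_mul_left ((tt.2 c).2 m)]
    ring

end SF

/-- `U` represents the function `u` on the sphere. -/
def Rep (u : E → ℝ) (U : SF) : Prop := SF.Hom 0 U ∧ ∀ x : E, x ≠ 0 → u x = U x

namespace Rep

variable {u v : E → ℝ} {U V : SF}

theorem add (hu : Rep u U) (hv : Rep v V) : Rep (fun x => u x + v x) (U + V) :=
  ⟨hu.1.add hv.1, fun x hx => by simp only [SF.add_apply, hu.2 x hx, hv.2 x hx]⟩

theorem sub (hu : Rep u U) (hv : Rep v V) : Rep (fun x => u x - v x) (U - V) :=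
  ⟨hu.1.sub hv.1, fun x hx => by simp only [SF.sub_apply, hu.2 x hx, hv.2 x hx]⟩

theorem neg (hu : Rep u U) : Rep (fun x => -u x) (-U) :=
  ⟨hu.1.neg, fun x hx => by simp only [SF.neg_apply, hu.2 x hx]⟩

theorem mul (hu : Rep u U) (hv : Rep v V) : Rep (fun x => u x * v x) (U * V) :=
  ⟨(hu.1.mul hv.1).congr (add_zero 0), fun x hx => by simp only [SF.mul_apply, hu.2 x hx, hv.2 x hx]⟩

theorem sum {ι : Type*} {s : Finset ι} {u : ι → E → ℝ} {U : ι → SF} (h : ∀ i, Rep (u i) (U i)) :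
    Rep (fun x => ∑ i ∈ s, u i x) (∑ i ∈ s, U i) :=
  ⟨SF.Hom.sum fun i _ => (h i).1, fun x hx => by
    rw [SF.sum_apply]; exact Finset.sum_congr rfl fun i _ => (h i).2 x hx⟩

theorem proj (i j : Fin 3) : Rep (proj i j) (SF.γ i j) :=
  ⟨SF.hom_γ i j, fun _ hx => (SF.γ_apply i j hx).symm⟩

theorem lead (hu : Rep u U) (h : U = V) : Rep u V := h ▸ hu

theorem pd (hu : Rep u U) (i : Fin 3) {x : E} (hx : x ≠ 0) : pd i u x = SF.d i U x := by
  rw [SF.d_apply i U hx, pd_congr (SF.eventuallyEq_of hu.2 hx)]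

theorem D0 (hu : Rep u U) (a : Fin 3) : Rep (D0 u a) (SF.D0 U a) := by
  refine ⟨hu.1.D0 a, fun x hx => ?_⟩
  have h : SF.D0 U a = SF.r * ∑ i, SF.γ a i * SF.d i U := by
    simp only [SF.γ, sub_mul, Finset.sum_sub_distrib, SF.sum_δ_mul, mul_assoc, ← Finset.mul_sum,
      hu.1.sum_n_d_zero, mul_zero, sub_zero, SF.D0]
  rw [h, AsympFlat.D0, SF.mul_apply, SF.sum_apply, SF.r_apply hx]
  congr 1
  exact Finset.sum_congr rfl fun i _ => by rw [SF.mul_apply, SF.γ_apply _ _ hx, hu.pd i hx]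

theorem D1 {u : VecField} {U : Fin 3 → SF} (hu : ∀ a, Rep (u a) (U a)) (tU : SF.Tan1 U)
    (c a : Fin 3) : Rep (D1 u c a) (SF.D1 U c a) := by
  refine (sum fun i => (proj a i).mul ((hu i).D0 c)).lead ?_
  have e : ∀ i, SF.γ a i * SF.D0 (U i) c = SF.r * (SF.γ a i * SF.d c (U i)) := fun i => by
    rw [SF.D0]; ring
  simp only [e, ← Finset.mul_sum, SF.sum_γ_d_tangent tU, SF.D1]
  linear_combination SF.n a * U c * SF.r_mul_ri

theorem D2 {u : Field2} {U : Ten2} (hu : ∀ a b, Rep (u a b) (U a b)) (tU : SF.Tan2 U)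
    (c a b : Fin 3) : Rep (D2 u c a b) (SF.D2 U c a b) := by
  refine (sum fun i => sum fun j => ((proj a i).mul (proj b j)).mul ((hu i j).D0 c)).lead ?_
  have e : ∀ i, ∑ j, SF.γ a i * SF.γ b j * SF.D0 (U i j) c =
      SF.r * (SF.γ a i * SF.d c (U i b)) + SF.n b * (SF.γ a i * U i c) := fun i => by
    have e' : ∀ j, SF.γ a i * SF.γ b j * SF.D0 (U i j) c =
        SF.r * SF.γ a i * (SF.γ b j * SF.d c (U i j)) := fun j => by rw [SF.D0]; ring
    simp only [e', ← Finset.mul_sum, SF.sum_γ_d_tangent (tU.2 i)]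
    linear_combination SF.γ a i * SF.n b * U i c * SF.r_mul_ri
  simp only [e, Finset.sum_add_distrib, ← Finset.mul_sum, SF.sum_γ_d_tangent (tU.1 b),
    SF.sum_γ_mul (tU.1 c), SF.D2]
  linear_combination SF.n a * U c b * SF.r_mul_ri

theorem D3 {u : Field3} {U : Fin 3 → Ten2} (hu : ∀ c a b, Rep (u c a b) (U c a b))
    (tU : SF.Tan3 U) (m c a b : Fin 3) : Rep (D3 u m c a b) (SF.D3 U m c a b) := by
  refine (sum fun i => sum fun j => sum fun l =>
    (((proj c i).mul (proj a j)).mul (proj b l)).mul ((hu i j l).D0 m)).lead ?_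
  have e : ∀ i j, ∑ l, SF.γ c i * SF.γ a j * SF.γ b l * SF.D0 (U i j l) m =
      SF.γ c i * (SF.r * (SF.γ a j * SF.d m (U i j b)) + SF.n b * (SF.γ a j * U i j m)) :=
    fun i j => by
      have e' : ∀ l, SF.γ c i * SF.γ a j * SF.γ b l * SF.D0 (U i j l) m =
          SF.r * SF.γ c i * SF.γ a j * (SF.γ b l * SF.d m (U i j l)) := fun l => by
        rw [SF.D0]; ring
      simp only [e', ← Finset.mul_sum, SF.sum_γ_d_tangent ((tU.2 i).2 j)]
      linear_combination SF.γ c i * SF.γ a j * SF.n b * U i j m * SF.r_mul_ri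
  have e2 : ∀ i, ∑ j, SF.γ c i * (SF.r * (SF.γ a j * SF.d m (U i j b)) +
      SF.n b * (SF.γ a j * U i j m)) = SF.r * (SF.γ c i * SF.d m (U i a b)) +
      SF.n a * (SF.γ c i * U i m b) + SF.n b * (SF.γ c i * U i a m) := fun i => by
    simp only [← Finset.mul_sum, Finset.sum_add_distrib, SF.sum_γ_d_tangent ((tU.2 i).1 b),
      SF.sum_γ_mul ((tU.2 i).1 m)]
    linear_combination SF.γ c i * SF.n a * U i m b * SF.r_mul_ri
  simp only [e, e2, Finset.sum_add_distrib, ← Finset.mul_sum, SF.sum_γ_d_tangent (tU.1 a b),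
    SF.sum_γ_mul (tU.1 m b), SF.sum_γ_mul (tU.1 a m), SF.D3]
  linear_combination SF.n c * U m a b * SF.r_mul_ri

theorem isSphereFn (U : SF) (hU : SF.Hom 0 U) : IsSphereFn U where
  smooth := U.smooth
  homogeneous t x ht := by
    by_cases hx : x = 0
    · rw [hx, smul_zero]
    · rw [hU t x ht hx, zpow_zero, one_mul]

theorem coe (U : SF) (hU : SF.Hom 0 U) : Rep U U := ⟨hU, fun _ _ => rfl⟩

end Rep

/-- The element of the ring of smooth functions given by a function on the sphere. -/
theorem IsSphereFn.exists_rep {u : E → ℝ} (hu : IsSphereFn u) : ∃ U : SF, Rep u U :=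
  ⟨SF.of u hu.smooth, fun t x ht hx => by
    rw [SF.of_apply _ hx, SF.of_apply _ (smul_ne_zero ht.ne' hx), hu.homogeneous t x ht, zpow_zero,
      one_mul], fun _ hx => (SF.of_apply _ hx).symm⟩

end AsympFlat
end

/-! ### Spherical components against Cartesian expansions -/

noncomputable section
namespace AsympFlat

open Filter Asymptotics Bornology Topology

namespace SF

theorem contDiffOn_norm_zpow (k : ℤ) : ContDiffOn ℝ ∞ (fun x : E => ‖x‖ ^ k) {x | x ≠ 0} := by
  obtain ⟨n, rfl | rfl⟩ := k.eq_nat_or_neg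
  · simpa only [zpow_natCast] using contDiffOn_norm.pow n
  · simp only [zpow_neg, zpow_natCast]
    exact (contDiffOn_norm.pow n).inv fun _ hx => pow_ne_zero n (norm_ne_zero_iff.2 hx)

/-- Integer powers of the radius. -/
def rz (k : ℤ) : SF := of (fun x => ‖x‖ ^ k) (contDiffOn_norm_zpow k)

theorem rz_apply (k : ℤ) {x : E} (hx : x ≠ 0) : rz k x = ‖x‖ ^ k := of_apply _ hx

theorem hom_rz (k : ℤ) : Hom k (rz k) := fun t x ht hx => by
  rw [rz_apply k hx, rz_apply k (smul_ne_zero ht.ne' hx), norm_smul, Real.norm_of_nonneg ht.le,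
    mul_zpow]

theorem rz_mul (k l : ℤ) : rz k * rz l = rz (k + l) := ext' fun x hx => by
  rw [mul_apply, rz_apply k hx, rz_apply l hx, rz_apply _ hx, zpow_add₀ (norm_ne_zero_iff.2 hx)]

theorem rz_zero : rz 0 = 1 := ext' fun x hx => by rw [rz_apply 0 hx, zpow_zero, one_apply hx]

theorem rz_one : rz 1 = r := ext' fun x hx => by rw [rz_apply 1 hx, zpow_one, r_apply hx]

theorem rz_neg_one : rz (-1) = ri := ext' fun x hx => by
  rw [rz_apply _ hx, zpow_neg_one, ri_apply hx]

theorem rz_neg_two : rz (-2) = ri * ri := by rw [← rz_neg_one, rz_mul]; rfl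

/-- The symmetric tensor with tangential part `A`, mixed part `B` and radial part `C`. -/
def dec (A : Ten2) (B : Fin 3 → SF) (C : SF) : Ten2 := fun i j =>
  A i j + n i * B j + n j * B i + C * (n i * n j)

section dec

variable {A : Ten2} {B : Fin 3 → SF} {C : SF} (hA : Tan2 A) (hB : Tan1 B)
include hA hB

theorem sum_n_dec (i : Fin 3) : ∑ j, n j * dec A B C i j = B i + C * n i := by
  have e : ∀ j, n j * dec A B C i j = n j * A i j + n j * (n i * B j) + n j * (n j * B i) +
      n j * (n j * (C * n i)) := fun j => by rw [dec]; ring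
  simp only [e, Finset.sum_add_distrib, sum_n_n_mul, sum_n_mul_left hB,
    show ∑ j, n j * A i j = 0 from hA.2 i]
  ring

theorem sum_γ_dec (i b : Fin 3) : ∑ j, γ b j * dec A B C i j = A i b + n i * B b := by
  have e : ∀ j, γ b j * dec A B C i j = γ b j * A i j + n i * (γ b j * B j) +
      (B i + C * n i) * (n j * γ j b) := fun j => by rw [dec, γ_comm b j]; ring
  simp only [e, Finset.sum_add_distrib, ← Finset.mul_sum, sum_n_γ, sum_γ_mul hB, sum_γ_mul (hA.2 i)]
  ring

theorem nn_dec : ∑ i, ∑ j, n i * n j * dec A B C i j = C := by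
  simp only [mul_assoc, ← Finset.mul_sum, sum_n_dec hA hB, mul_add, Finset.sum_add_distrib,
    show ∑ i, n i * B i = 0 from hB]
  have e : ∀ i, n i * (C * n i) = n i * (n i * C) := fun i => by ring
  simp only [e, sum_n_n_mul, zero_add]

theorem γn_dec (a : Fin 3) : ∑ i, ∑ j, γ a i * n j * dec A B C i j = B a := by
  simp only [mul_assoc, ← Finset.mul_sum, sum_n_dec hA hB, mul_add, Finset.sum_add_distrib,
    sum_γ_mul hB]
  have e : ∀ i, γ a i * (C * n i) = C * (n i * γ i a) := fun i => by rw [γ_comm a i]; ring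
  simp only [e, ← Finset.mul_sum, sum_n_γ, mul_zero, add_zero]

theorem γγ_dec (a b : Fin 3) : ∑ i, ∑ j, γ a i * γ b j * dec A B C i j = A a b := by
  simp only [mul_assoc, ← Finset.mul_sum, sum_γ_dec hA hB, mul_add, Finset.sum_add_distrib,
    sum_γ_mul (hA.1 b)]
  have e : ∀ i, γ a i * (n i * B b) = B b * (n i * γ i a) := fun i => by rw [γ_comm a i]; ring
  simp only [e, ← Finset.mul_sum, sum_n_γ, mul_zero, add_zero]

end dec

end SF

/-- Multiplication by $r^k$ identifies functions on the sphere with homogeneous functions of degree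
$k$; `Exp.hasExpansion` is the passage back. -/
theorem HasExpansion.exp {F F₁ : E → ℝ} {k : ℤ} {U : SF} (h : HasExpansion F k F₁)
    (hU : Rep F₁ U) : Exp F k (SF.rz k * U) := by
  obtain ⟨F₂, h2, hr⟩ := h
  obtain ⟨V, hV⟩ := h2.exists_rep
  refine ⟨((SF.hom_rz k).mul hU.1).congr (add_zero k), SF.rz (k - 1) * V,
    ((SF.hom_rz (k - 1)).mul hV.1).congr (add_zero _), hr.congr ?_⟩
  filter_upwards [eventually_far 0] with x hx
  have hx0 := norm_pos_iff.1 hx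
  rw [SF.mul_apply, SF.mul_apply, SF.rz_apply _ hx0, SF.rz_apply _ hx0, hU.2 x hx0, hV.2 x hx0]

theorem Exp.hasExpansion {F F₁ : E → ℝ} {k : ℤ} {U : SF} (h : Exp F k (SF.rz k * U))
    (hU : Rep F₁ U) : HasExpansion F k F₁ := by
  obtain ⟨v, hv, hr⟩ := h.rem
  refine ⟨(SF.rz (1 - k) * v : SF), Rep.isSphereFn _ (((SF.hom_rz (1 - k)).mul hv).congr
    (by ring)), hr.congr ?_⟩
  filter_upwards [eventually_far 0] with x hx
  have hx0 := norm_pos_iff.1 hx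
  rw [SF.mul_apply, SF.mul_apply, SF.rz_apply _ hx0, SF.rz_apply _ hx0, hU.2 x hx0, ← mul_assoc,
    ← zpow_add₀ hx.ne', show k - 1 + (1 - k) = 0 by ring, zpow_zero, one_mul]

/-- Boundary data with entries in the ring of smooth functions on the punctured space. -/
structure LeadData where
  hrr : SF
  hAB : Ten2
  prr : SF
  prA : Fin 3 → SF
  pAB : Ten2

namespace LeadData

/-- The entries are smooth functions, vectors and symmetric tensors on the sphere. -/
structure IsSphere (D : LeadData) : Prop where
  hom_hrr : SF.Hom 0 D.hrr
  hom_hAB : ∀ a b, SF.Hom 0 (D.hAB a b)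
  hom_prr : SF.Hom 0 D.prr
  hom_prA : ∀ a, SF.Hom 0 (D.prA a)
  hom_pAB : ∀ a b, SF.Hom 0 (D.pAB a b)
  symm_hAB : ∀ a b, D.hAB a b = D.hAB b a
  symm_pAB : ∀ a b, D.pAB a b = D.pAB b a
  tan_hAB : SF.Tan2 D.hAB
  tan_prA : SF.Tan1 D.prA
  tan_pAB : SF.Tan2 D.pAB

/-- `D` represents the boundary data `d`. -/
structure Represents (D : LeadData) (d : BoundaryData) : Prop where
  hrr : Rep d.hrr D.hrr
  hAB : ∀ a b, Rep (d.hAB a b) (D.hAB a b)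
  prr : Rep d.prr D.prr
  prA : ∀ a, Rep (d.prA a) (D.prA a)
  pAB : ∀ a b, Rep (d.pAB a b) (D.pAB a b)

/-- The boundary data represented by `D`. -/
def toBoundaryData (D : LeadData) : BoundaryData :=
  ⟨D.hrr, fun a b => D.hAB a b, D.prr, fun a => D.prA a, fun a b => D.pAB a b⟩

/-- Leading term of the deviation of the metric from the flat metric. -/
def metric (D : LeadData) : Ten2 := fun i j => SF.ri * SF.dec D.hAB (fun _ => 0) D.hrr i j

/-- Leading term of the momentum. -/
def momentum (D : LeadData) : Ten2 := fun i j =>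
  SF.ri * SF.ri * SF.dec D.pAB D.prA D.prr i j

theorem dec_symm {A : Ten2} {B : Fin 3 → SF} {C : SF} (hA : ∀ i j, A i j = A j i) (i j : Fin 3) :
    SF.dec A B C i j = SF.dec A B C j i := by
  rw [SF.dec, SF.dec, hA i j]; ring

variable {D : LeadData} (hD : D.IsSphere)
include hD

theorem metric_symm (i j : Fin 3) : D.metric i j = D.metric j i := by
  rw [metric, metric, dec_symm hD.symm_hAB]

theorem momentum_symm (i j : Fin 3) : D.momentum i j = D.momentum j i := by
  rw [momentum, momentum, dec_symm hD.symm_pAB]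

theorem represents_toBoundaryData : D.Represents D.toBoundaryData :=
  ⟨Rep.coe _ hD.hom_hrr, fun a b => Rep.coe _ (hD.hom_hAB a b), Rep.coe _ hD.hom_prr,
    fun a => Rep.coe _ (hD.hom_prA a), fun a b => Rep.coe _ (hD.hom_pAB a b)⟩

omit hD in
theorem sum_nrm_eq_zero {V : Fin 3 → SF} (hV : SF.Tan1 V) {x : E} (hx : x ≠ 0) :
    ∑ a, nrm a x * V a x = 0 := by
  have h : (∑ a, SF.n a * V a) x = 0 := by
    rw [show ∑ a, SF.n a * V a = 0 from hV, SF.zero_apply]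
  rw [SF.sum_apply] at h
  rw [← h]
  exact Finset.sum_congr rfl fun a _ => by rw [SF.mul_apply, SF.n_apply a hx]

theorem isSmooth_toBoundaryData : D.toBoundaryData.IsSmooth where
  hrr := Rep.isSphereFn _ hD.hom_hrr
  hAB := ⟨fun a b => Rep.isSphereFn _ (hD.hom_hAB a b),
    fun a b x _ => by simp only [toBoundaryData, hD.symm_hAB a b],
    fun b _ hx => sum_nrm_eq_zero (hD.tan_hAB.1 b) hx⟩
  prr := Rep.isSphereFn _ hD.hom_prr
  prA := ⟨fun a => Rep.isSphereFn _ (hD.hom_prA a), fun _ hx => sum_nrm_eq_zero hD.tan_prA hx⟩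
  pAB := ⟨fun a b => Rep.isSphereFn _ (hD.hom_pAB a b),
    fun a b x _ => by simp only [toBoundaryData, hD.symm_pAB a b],
    fun b _ hx => sum_nrm_eq_zero (hD.tan_pAB.1 b) hx⟩

end LeadData

theorem exp_norm : Exp (fun x => ‖x‖) 1 SF.r :=
  (Exp.of_hom SF.hom_r).congr <| (eventually_far 0).mono fun _ hx => SF.r_apply (norm_pos_iff.1 hx)

theorem exp_norm_inv : Exp (fun x => ‖x‖⁻¹) (-1) SF.ri :=
  (Exp.of_hom SF.hom_ri).congr <| (eventually_far 0).mono fun _ hx =>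
    SF.ri_apply (norm_pos_iff.1 hx)

/-- A tensor with Cartesian expansions has expansions of the spherical components. -/
theorem hasFalloff_of_exp {q p : Field2} {D : LeadData} (hD : D.IsSphere)
    (hq : ∀ i j, Exp (q i j) (-1) (D.metric i j)) (hp : ∀ i j, Exp (p i j) (-2) (D.momentum i j))
    (hsq : ∀ᶠ x in cobounded E, ∀ i j, q i j x = q j i x)
    (hsp : ∀ᶠ x in cobounded E, ∀ i j, p i j x = p j i x) : HasFalloff q p D.toBoundaryData := by
  have hR := LeadData.represents_toBoundaryData hD
  have t0 : SF.Tan1 fun _ => 0 := by simp [SF.Tan1]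
  have pull : ∀ (A T : Ten2) (s : SF), ∑ i, ∑ j, A i j * (s * T i j) =
      s * ∑ i, ∑ j, A i j * T i j := fun A T s => by
    simp only [Finset.mul_sum, mul_left_comm s]
  refine ⟨hsq, hsp, LeadData.isSmooth_toBoundaryData hD, ?_, fun a => ?_, fun a b => ?_, ?_,
    fun a => ?_, fun a b => ?_⟩
  · refine Exp.hasExpansion (U := D.hrr) ?_ hR.hrr
    have h := Exp.sum (s := Finset.univ) fun i _ => Exp.sum (s := Finset.univ) fun j _ =>
      (((exp_nrm i).mul (exp_nrm j)).mul (hq i j)).cast (l := -1) (by norm_num)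
    refine h.lead ?_
    simp only [LeadData.metric]
    rw [pull (fun i j => SF.n i * SF.n j), SF.nn_dec hD.tan_hAB t0, SF.rz_neg_one]
  -- `D.metric` has no mixed part, so the order-zero term of the `rA` components vanishes.
  · refine Exp.hasExpansion (U := 0) ?_ ⟨SF.Hom.zero 0, fun x _ => (SF.zero_apply x).symm⟩
    have h := exp_norm.mul <| Exp.sum (s := Finset.univ) fun i _ => Exp.sum (s := Finset.univ)
      fun j _ => (((exp_proj a i).mul (exp_nrm j)).mul (hq i j)).cast (l := -1) (by norm_num)
    refine (h.cast (by norm_num)).lead ?_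
    simp only [LeadData.metric]
    rw [pull (fun i j => SF.γ a i * SF.n j), SF.γn_dec hD.tan_hAB t0]
    simp
  · refine Exp.hasExpansion (U := D.hAB a b) ?_ (hR.hAB a b)
    have h := (exp_norm.mul exp_norm).mul <| Exp.sum (s := Finset.univ) fun i _ =>
      Exp.sum (s := Finset.univ)
      fun j _ => (((exp_proj a i).mul (exp_proj b j)).mul (hq i j)).cast (l := -1) (by norm_num)
    refine ((h.cast (l := 1) (by norm_num)).lead ?_).congr
      (Eventually.of_forall fun x => by rw [covAB, sq])
    simp only [LeadData.metric]
    rw [pull (fun i j => SF.γ a i * SF.γ b j), SF.γγ_dec hD.tan_hAB t0, SF.rz_one]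
    linear_combination SF.r * D.hAB a b * SF.r_mul_ri
  · refine Exp.hasExpansion (U := D.prr) ?_ hR.prr
    have h := (exp_norm.mul exp_norm).mul <| Exp.sum (s := Finset.univ) fun i _ =>
      Exp.sum (s := Finset.univ) fun j _ =>
      (((exp_nrm i).mul (exp_nrm j)).mul (hp i j)).cast (l := -2) (by norm_num)
    refine ((h.cast (l := 0) (by norm_num)).lead ?_).congr
      (Eventually.of_forall fun x => by rw [conRR, sq])
    simp only [LeadData.momentum]
    rw [pull (fun i j => SF.n i * SF.n j), SF.nn_dec hD.tan_pAB hD.tan_prA, SF.rz_zero]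
    linear_combination (SF.r * SF.ri + 1) * D.prr * SF.r_mul_ri
  · refine Exp.hasExpansion (U := D.prA a) ?_ (hR.prA a)
    have h := exp_norm.mul <| Exp.sum (s := Finset.univ) fun i _ => Exp.sum (s := Finset.univ)
      fun j _ => (((exp_proj a i).mul (exp_nrm j)).mul (hp i j)).cast (l := -2) (by norm_num)
    refine (h.cast (l := -1) (by norm_num)).lead ?_
    simp only [LeadData.momentum]
    rw [pull (fun i j => SF.γ a i * SF.n j), SF.γn_dec hD.tan_pAB hD.tan_prA, SF.rz_neg_one]
    linear_combination SF.ri * D.prA a * SF.r_mul_ri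
  · refine Exp.hasExpansion (U := D.pAB a b) ?_ (hR.pAB a b)
    have h := Exp.sum (s := Finset.univ) fun i _ => Exp.sum (s := Finset.univ)
      fun j _ => (((exp_proj a i).mul (exp_proj b j)).mul (hp i j)).cast (l := -2) (by norm_num)
    refine h.lead ?_
    simp only [LeadData.momentum]
    rw [pull (fun i j => SF.γ a i * SF.γ b j), SF.γγ_dec hD.tan_pAB hD.tan_prA, SF.rz_neg_two]

/-- Insert the identity as `proj` plus the radial projector in both slots; symmetry lets both mixed
terms use the same contraction. -/
theorem decompose_symm {T : Fin 3 → Fin 3 → ℝ} (hT : ∀ i j, T i j = T j i) (i j : Fin 3) (x : E) :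
    T i j = (∑ a, ∑ b, proj i a x * proj j b x * T a b)
      + nrm i x * (∑ a, ∑ b, proj j a x * nrm b x * T a b)
      + nrm j x * (∑ a, ∑ b, proj i a x * nrm b x * T a b)
      + (∑ a, ∑ b, nrm a x * nrm b x * T a b) * (nrm i x * nrm j x) := by
  have h1 : ∀ (V : Fin 3 → ℝ) (i : Fin 3), ∑ a, proj i a x * V a =
      V i - nrm i x * ∑ a, nrm a x * V a := fun V i => by
    simp only [proj, sub_mul, Finset.sum_sub_distrib, mul_assoc, ← Finset.mul_sum]
    simp [kd]
  have h2 : ∀ b, ∑ a, nrm a x * T a b = ∑ a, nrm a x * T b a := fun b =>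
    Finset.sum_congr rfl fun a _ => by rw [hT]
  simp only [mul_assoc, ← Finset.mul_sum, h1, mul_sub, Finset.sum_sub_distrib, h2]
  have h3 : ∀ i, ∑ a, nrm a x * (nrm i x * ∑ b, nrm b x * T a b) =
      nrm i x * ∑ a, nrm a x * ∑ b, nrm b x * T a b := fun i => by
    rw [Finset.mul_sum]; exact Finset.sum_congr rfl fun a _ => by ring
  simp only [h3]
  rw [hT i j]
  ring

/-- The spherical components determine the Cartesian expansions. -/
theorem HasFalloff.exists_lead {q p : Field2} {d : BoundaryData} (h : HasFalloff q p d) :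
    ∃ D : LeadData, D.IsSphere ∧ D.Represents d ∧
      (∀ i j, Exp (q i j) (-1) (D.metric i j)) ∧ ∀ i j, Exp (p i j) (-2) (D.momentum i j) := by
  obtain ⟨hrr, Rhrr⟩ := h.smooth.hrr.exists_rep
  obtain ⟨prr, Rprr⟩ := h.smooth.prr.exists_rep
  choose hAB RhAB using fun a b => (h.smooth.hAB.sphereFn a b).exists_rep
  choose prA RprA using fun a => (h.smooth.prA.sphereFn a).exists_rep
  choose pAB RpAB using fun a b => (h.smooth.pAB.sphereFn a b).exists_rep
  have tan : ∀ {v : VecField} {V : Fin 3 → SF}, (∀ a, Rep (v a) (V a)) →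
      (∀ x : E, x ≠ 0 → ∑ a, nrm a x * v a x = 0) → SF.Tan1 V := fun hv h0 =>
    SF.ext' fun x hx => by
      rw [SF.zero_apply, SF.sum_apply, ← h0 x hx]
      exact Finset.sum_congr rfl fun a _ => by rw [SF.mul_apply, SF.n_apply a hx, (hv a).2 x hx]
  have sym : ∀ {k : Field2} {K : Ten2}, (∀ a b, Rep (k a b) (K a b)) → IsSphereSym k →
      ∀ a b, K a b = K b a := fun hk h0 a b => SF.ext' fun x hx => by
    rw [← (hk a b).2 x hx, ← (hk b a).2 x hx, h0.symm a b x hx]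
  have tan2 : ∀ {k : Field2} {K : Ten2}, (∀ a b, Rep (k a b) (K a b)) → IsSphereSym k →
      SF.Tan2 K := fun hk h0 =>
    ⟨fun b => tan (fun a => hk a b) (h0.tangent b), fun a => tan (hk a) fun x hx => by
      rw [← h0.tangent a x hx]
      exact Finset.sum_congr rfl fun b _ => by rw [h0.symm a b x hx]⟩
  refine ⟨⟨hrr, hAB, prr, prA, pAB⟩, ⟨Rhrr.1, fun a b => (RhAB a b).1, Rprr.1, fun a => (RprA a).1,
    fun a b => (RpAB a b).1, sym RhAB h.smooth.hAB, sym RpAB h.smooth.pAB, tan2 RhAB h.smooth.hAB,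
    tan RprA h.smooth.prA.tangent, tan2 RpAB h.smooth.pAB⟩, ⟨Rhrr, RhAB, Rprr, RprA, RpAB⟩,
    fun i j => ?_, fun i j => ?_⟩
  · have e1 := (h.rr.exp Rhrr).mul ((exp_nrm i).mul (exp_nrm j)) |>.cast (l := -1) (by norm_num)
    have r0 : Rep (fun _ => 0) 0 := ⟨SF.Hom.zero 0, fun x _ => (SF.zero_apply x).symm⟩
    have e2 := fun i j => (exp_nrm i).mul (exp_norm_inv.mul ((h.rA j).exp r0))
      |>.cast (l := -1) (by norm_num)
    have e3 := (exp_norm_inv.mul exp_norm_inv).mul ((h.AB i j).exp (RhAB i j))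
      |>.cast (l := -1) (by norm_num)
    refine ((((e3.add (e2 i j)).add (e2 j i)).add e1).lead ?_).congr ?_
    · rw [LeadData.metric, SF.dec, SF.rz_one, SF.rz_neg_one]
      linear_combination SF.ri * hAB i j * SF.r_mul_ri
    · filter_upwards [h.symm_metric, eventually_far 0] with x hs hx
      rw [decompose_symm hs i j x, covAB, covRA, covRA, covRR]
      field_simp
  · have e1 := (exp_norm_inv.mul exp_norm_inv).mul ((h.prr.exp Rprr).mul
      ((exp_nrm i).mul (exp_nrm j))) |>.cast (l := -2) (by norm_num)
    have e2 := fun i j => (exp_nrm i).mul (exp_norm_inv.mul ((h.prA j).exp (RprA j)))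
      |>.cast (l := -2) (by norm_num)
    have e3 := (h.pAB i j).exp (RpAB i j)
    refine ((((e3.add (e2 i j)).add (e2 j i)).add e1).lead ?_).congr ?_
    · rw [LeadData.momentum, SF.dec, SF.rz_neg_one, SF.rz_neg_two, SF.rz_zero]
      ring
    · filter_upwards [h.symm_momentum, eventually_far 0] with x hs hx
      rw [decompose_symm hs i j x, conAB, conRA, conRA, conRR]
      field_simp

end AsympFlat
end

/-! ### Flat Laplacians and radial contractions -/

noncomputable section
namespace AsympFlat

namespace SF

/-- The flat Laplacian. -/
def lap (u : SF) : SF := ∑ i, d i (d i u)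

/-- The inner product of two gradients. -/
def dot (u v : SF) : SF := ∑ i, d i u * d i v

theorem lap_add (u v : SF) : lap (u + v) = lap u + lap v := by
  simp only [lap, map_add, Finset.sum_add_distrib]

theorem lap_sub (u v : SF) : lap (u - v) = lap u - lap v := by
  simp only [lap, map_sub, Finset.sum_sub_distrib]

theorem lap_sum {ι : Type*} (s : Finset ι) (u : ι → SF) :
    lap (∑ i ∈ s, u i) = ∑ i ∈ s, lap (u i) := by
  simp only [lap, map_sum]
  exact Finset.sum_comm

theorem lap_mul (u v : SF) : lap (u * v) = lap u * v + 2 * dot u v + u * lap v := by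
  simp only [lap, dot, d_mul, map_add, Fin.sum_univ_three]
  ring

theorem lap_two : lap (2 : SF) = 0 := by simp [lap, d_two]

theorem lap_δ (i j : Fin 3) : lap (δ i j) = 0 := by simp [lap, d_δ]

theorem dot_two (u : SF) : dot 2 u = 0 := by simp [dot, d_two]

theorem dot_δ (i j : Fin 3) (u : SF) : dot u (δ i j) = 0 := by simp [dot, d_δ]

theorem dot_comm (u v : SF) : dot u v = dot v u := by simp only [dot, mul_comm]

theorem dot_mul (u v w : SF) : dot u (v * w) = dot u v * w + v * dot u w := by
  simp only [dot, d_mul, Fin.sum_univ_three]; ring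

theorem dot_add (u v w : SF) : dot u (v + w) = dot u v + dot u w := by
  simp only [dot, map_add, mul_add, Finset.sum_add_distrib]

theorem dot_sub (u v w : SF) : dot u (v - w) = dot u v - dot u w := by
  simp only [dot, map_sub, mul_sub, Finset.sum_sub_distrib]

theorem sum_n_δ (j : Fin 3) : ∑ m, n m * δ m j = n j := by
  simpa only [mul_comm] using sum_δ_mul' j n

/-- The gradient of $1/r$ is radial, and a function of degree zero has no radial derivative. -/
theorem dot_ri {u : SF} (hu : Hom 0 u) : dot ri u = 0 := by
  have e : ∀ i, d i ri * d i u = -(ri * ri) * (n i * d i u) := fun i => by rw [d_ri]; ring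
  simp only [dot, e, ← Finset.mul_sum, hu.sum_n_d_zero, mul_zero]

theorem Hom.sum_n_d_neg_one {u : SF} (hu : Hom (-1) u) : ∑ i, n i * d i u = -(ri * u) := by
  rw [hu.sum_n_d]; simp

theorem Hom.sum_n_d_neg_two {u : SF} (hu : Hom (-2) u) : ∑ i, n i * d i u = -(2 * (ri * u)) := by
  rw [hu.sum_n_d, Int.cast_neg, neg_smul, Int.cast_ofNat, ofNat_smul_eq_nsmul, nsmul_eq_mul,
    Nat.cast_ofNat]

theorem dot_n (i : Fin 3) (u : SF) : dot (n i) u = ri * d i u - ri * n i * ∑ m, n m * d m u := by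
  have e : ∀ m, d m (n i) * d m u = ri * (δ m i * d m u) - ri * n i * (n m * d m u) := fun m => by
    rw [d_n]; ring
  simp only [dot, e, Finset.sum_sub_distrib, ← Finset.mul_sum, sum_δ_mul']

theorem div_n : ∑ i, d i (n i) = 2 * ri := by
  have h := sum_n_sq
  simp only [d_n, δ_self, Fin.sum_univ_three] at *
  linear_combination -ri * h

theorem lap_n (i : Fin 3) : lap (n i) = -(2 * (ri * ri * n i)) := by
  have h := sum_n_sq
  have h1 := sum_n_δ i
  have h2 := div_n
  simp only [lap, d_n, d_mul, map_sub, d_ri, d_δ, Fin.sum_univ_three, δ_self] at *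
  linear_combination (-2 * ri * ri) * h1 + (3 * ri * ri * n i) * h

theorem lap_ri : lap ri = 0 := by
  have h := sum_n_sq
  simp only [lap, d_n, d_mul, map_neg, d_ri, Fin.sum_univ_three, δ_self] at *
  linear_combination (3 * ri * ri * ri) * h

/-- Differentiating `n` projects and divides by `r`; this is the correction for moving `n` past a
derivative. -/
theorem sum_dn_mul (V : Fin 3 → SF) (j : Fin 3) :
    ∑ i, d j (n i) * V i = ri * (V j - n j * ∑ i, n i * V i) := by
  have e : ∀ i, d j (n i) * V i = ri * (δ j i * V i) - ri * n j * (n i * V i) := fun i => by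
    rw [d_n]; ring
  simp only [e, Finset.sum_sub_distrib, ← Finset.mul_sum, sum_δ_mul]
  ring

section radial

variable {Q : Ten2} (hQ : ∀ i j, Hom (-1) (Q i j)) (sQ : ∀ i j, Q i j = Q j i)
include hQ sQ

/-- The mixed components of the linearized Ricci tensor. -/
theorem sum_n_linRic (j : Fin 3) : 2 * ∑ i, n i * linRic Q i j =
    -(ri * ∑ m, d m (Q m j)) + d j (∑ i, n i * ∑ m, d m (Q m i))
      + ri * n j * ∑ i, n i * ∑ m, d m (Q m i) - lap (∑ i, n i * Q i j)
      + 2 * ri * d j (∑ m, Q m m) := by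
  have hD : ∀ j, Hom (-2) (∑ m, d m (Q m j)) := fun j => Hom.sum fun m _ => (hQ m j).d m
  have ht : Hom (-2) (d j (∑ m, Q m m)) := (Hom.sum fun m _ => hQ m m).d j
  have e : ∀ i, 2 * (n i * linRic Q i j) = n i * d i (∑ m, d m (Q m j)) +
      n i * d j (∑ m, d m (Q m i)) - n i * lap (Q i j) - n i * d i (d j (∑ m, Q m m)) := fun i => by
    rw [mul_left_comm, two_mul_linRic sQ]
    simp only [lap, Fin.sum_univ_three, map_add]
    rw [d_comm 0 i, d_comm 1 i, d_comm 2 i, d_comm 0 j, d_comm 1 j, d_comm 2 j]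
    ring
  have e1 : ∑ i, n i * d j (∑ m, d m (Q m i)) = d j (∑ i, n i * ∑ m, d m (Q m i)) -
      ri * ((∑ m, d m (Q m j)) - n j * ∑ i, n i * ∑ m, d m (Q m i)) := by
    rw [← sum_dn_mul fun i => ∑ m, d m (Q m i), map_sum, ← Finset.sum_sub_distrib]
    exact Finset.sum_congr rfl fun i _ => by rw [d_mul]; ring
  have e2 : ∑ i, n i * lap (Q i j) = lap (∑ i, n i * Q i j) - 2 * ri * ∑ m, d m (Q m j) := by
    have a : ∀ i, n i * lap (Q i j) = lap (n i * Q i j) - 2 * ri * d i (Q i j) := fun i => by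
      rw [lap_mul, dot_n, (hQ i j).sum_n_d_neg_one, lap_n]; ring
    simp only [a, Finset.sum_sub_distrib, ← Finset.mul_sum, lap_sum]
  rw [Finset.mul_sum]
  simp only [e, Finset.sum_sub_distrib, Finset.sum_add_distrib, e1, e2, (hD j).sum_n_d_neg_two,
    ht.sum_n_d_neg_two]
  ring

/-- The radial derivative in the Christoffel symbol is evaluated by homogeneity of degree -1; in the
other two `n` is moved through with `sum_dn_mul`. -/
theorem sum_n_linΓ (k j : Fin 3) : 2 * ∑ i, n i * linΓ Q k i j =
    -(ri * Q k j) + d j (∑ i, n i * Q i k) - d k (∑ i, n i * Q i j)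
      + ri * (n j * (∑ i, n i * Q i k) - n k * ∑ i, n i * Q i j) := by
  have h1 := (hQ k j).sum_n_d_neg_one
  have h2 := sum_dn_mul (fun i => Q i k) j
  have h3 := sum_dn_mul (fun i => Q i j) k
  rw [Finset.mul_sum]
  simp only [linΓ, Fin.sum_univ_three, map_add, d_mul] at *
  have e : ∀ u : SF, 2 * ((1 / 2 : ℝ) • u) = u := fun u => by algebra
  simp only [mul_left_comm (2 : SF), e]
  linear_combination h1 - h2 + h3 - ri * sQ j k

end radial

end SF
end AsympFlat
end

/-! ### The leading metric in terms of λ and k, and the radial row of the momentum -/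

noncomputable section
namespace AsympFlat

namespace SF

/-- Leading term of the metric in terms of `λ` and `k`. -/
def sphQ (lam : SF) (k : Ten2) : Ten2 := fun i j =>
  2 * ri * (k i j - lam * δ i j + 2 * lam * (n i * n j))

/-- The trace of a tensor. -/
def tr (k : Ten2) : SF := ∑ m, k m m

/-- The divergence of a tensor. -/
def dv (k : Ten2) (j : Fin 3) : SF := ∑ m, d m (k m j)

/-- The contraction of a tensor with a gradient. -/
def cd (k : Ten2) (b : SF) (j : Fin 3) : SF := ∑ m, k m j * d m b

theorem sphQ_symm {lam : SF} {k : Ten2} (sk : ∀ i j, k i j = k j i) (i j : Fin 3) :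
    sphQ lam k i j = sphQ lam k j i := by
  rw [sphQ, sphQ, sk, δ_comm]; ring

theorem hom_two : Hom 0 (2 : SF) := by
  simpa only [map_ofNat] using Hom.const 2

theorem hom_sphQ {lam : SF} {k : Ten2} (hlam : Hom 0 lam) (hk : ∀ a b, Hom 0 (k a b))
    (i j : Fin 3) : Hom (-1) (sphQ lam k i j) := by
  exact ((hom_two.mul hom_ri).mul (((hk i j).sub ((hlam.mul (hom_δ i j)).congr (by norm_num))).add
    (((hom_two.mul hlam).mul ((hom_n i).mul (hom_n j))).congr (by norm_num)))).congr (by norm_num)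

theorem tr_sphQ (lam : SF) (k : Ten2) : ∑ m, sphQ lam k m m = 2 * ri * (tr k - lam) := by
  have h := sum_n_sq
  simp only [sphQ, tr, Fin.sum_univ_three, δ_self] at *
  linear_combination 4 * ri * lam * h

theorem sum_n_sphQ (lam : SF) {k : Ten2} (tk : Tan2 k) (j : Fin 3) :
    ∑ m, n m * sphQ lam k m j = 2 * ri * lam * n j := by
  have h1 := sum_n_δ j
  have h2 := sum_n_sq
  have h3 : ∑ m, n m * k m j = 0 := tk.1 j
  simp only [sphQ, Fin.sum_univ_three] at *
  linear_combination -2 * ri * lam * h1 + 4 * ri * lam * n j * h2 + 2 * ri * h3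

theorem div_sphQ {lam : SF} {k : Ten2} (hlam : Hom 0 lam) (tk : Tan2 k) (j : Fin 3) :
    ∑ m, d m (sphQ lam k m j) = 6 * ri * ri * lam * n j - 2 * ri * d j lam + 2 * ri * dv k j := by
  have h1 := sum_n_δ j
  have h2 := sum_n_sq
  have h3 := hlam.sum_n_d_zero
  have h4 : ∑ a, n a * k a j = 0 := tk.1 j
  have h5 := sum_δ_mul' j (fun i => d i lam)
  simp only [Fin.sum_univ_three, sphQ, dv, d_mul, map_add, map_sub, d_ri, d_n, d_δ, d_two,
    δ_self] at *
  linear_combination 6 * ri * ri * lam * h1 - 12 * ri * ri * lam * n j * h2 + 4 * ri * n j * h3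
    - 2 * ri * ri * h4 - 2 * ri * h5

/-- Differentiating the tangency of `k` trades the normal component of its divergence for its trace.
-/
theorem sum_n_dv {k : Ten2} (tk : Tan2 k) : ∑ j, n j * dv k j = -(ri * tr k) := by
  have h := fun m => sum_n_d_tangent (tk.2 m) m
  simp only [dv, tr, Finset.mul_sum]
  rw [Finset.sum_comm]
  simp only [h, Finset.sum_neg_distrib]

theorem Hom.tr {k : Ten2} {l : ℤ} (hk : ∀ a b, Hom l (k a b)) : Hom l (tr k) :=
  Hom.sum fun m _ => hk m m

section radial

variable {lam b : SF} {k : Ten2} (hlam : Hom 0 lam) (hb : Hom 0 b) (hk : ∀ a b, Hom 0 (k a b))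
  (sk : ∀ i j, k i j = k j i) (tk : Tan2 k)
include hlam hk sk tk

/-- The contractions of `sphQ` are inserted into `sum_n_linRic`; the radial part stays simple
because $1/r$ is harmonic. -/
theorem sum_n_linRic_sphQ (j : Fin 3) : ∑ i, n i * linRic (sphQ lam k) i j =
    ri * ri * (d j (tr k) - dv k j)
      - (ri * lap lam + 2 * ri * ri * ri * lam + ri * ri * ri * tr k) * n j := by
  have h1 : ∑ i, n i * (6 * ri * ri * lam * n i - 2 * ri * d i lam + 2 * ri * dv k i) =
      6 * ri * ri * lam - 2 * ri * ri * tr k := by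
    have a := sum_n_sq
    have c := hlam.sum_n_d_zero
    have e := sum_n_dv tk
    simp only [Fin.sum_univ_three] at *
    linear_combination 6 * ri * ri * lam * a - 2 * ri * c + 2 * ri * e
  have h2 := dot_n j lam
  rw [hlam.sum_n_d_zero] at h2
  have h3 : lap (2 * ri * lam * n j) =
      2 * ri * (lap lam * n j + 2 * ri * d j lam - 2 * ri * ri * lam * n j) := by
    rw [show 2 * ri * lam * n j = 2 * (ri * (lam * n j)) by ring, lap_mul, lap_mul ri, lap_mul lam,
      lap_ri, lap_two, lap_n, dot_comm lam, h2, dot_two,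
      dot_ri ((hlam.mul (hom_n j)).congr (add_zero 0))]
    ring
  apply two_smul_inj
  rw [sum_n_linRic (hom_sphQ hlam hk) (sphQ_symm sk)]
  simp only [div_sphQ hlam tk, tr_sphQ, sum_n_sphQ lam tk, h1, h3]
  simp only [map_sub, d_mul, d_ri, d_two, show (6 : SF) = 2 + 2 + 2 by norm_num, map_add]
  ring

include hb

/-- The gradient of the boost splits as $\partial N=n\,b+r\,\partial b$ into a radial and a
tangential part, and each is contracted with the radial row of the Christoffel symbols. -/
theorem sum_n_linΓ_sphQ {N : SF} (hN : N = r * b) (j : Fin 3) :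
    ∑ i, n i * ∑ l, linΓ (sphQ lam k) l i j * d l N =
      -(ri * ri * lam * b * n j) - ri * (cd k b j - lam * d j b) + ri * b * d j lam
        - dot lam b * n j := by
  have hd : ∀ l, d l N = n l * b + r * d l b := fun l => by rw [hN, d_mul, d_r]
  have e : ∀ l, 2 * ∑ i, n i * linΓ (sphQ lam k) l i j =
      -(ri * sphQ lam k l j) + 2 * ri * (d j lam * n l - d l lam * n j) := fun l => by
    rw [sum_n_linΓ (hom_sphQ hlam hk) (sphQ_symm sk), sum_n_sphQ lam tk, sum_n_sphQ lam tk]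
    simp only [d_mul, d_ri, d_n, d_two, δ_comm l j]
    ring
  have e2 : ∑ i, n i * ∑ l, linΓ (sphQ lam k) l i j * d l N =
      ∑ l, (∑ i, n i * linΓ (sphQ lam k) l i j) * (n l * b + r * d l b) := by
    simp only [Finset.sum_mul, Finset.mul_sum, hd]
    rw [Finset.sum_comm]
    exact Finset.sum_congr rfl fun _ _ => Finset.sum_congr rfl fun _ _ => by ring
  have e3 : 2 * ∑ l, (∑ i, n i * linΓ (sphQ lam k) l i j) * (n l * b + r * d l b) =
      ∑ l, (-(ri * sphQ lam k l j) + 2 * ri * (d j lam * n l - d l lam * n j)) *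
        (n l * b + r * d l b) := by
    rw [Finset.mul_sum]
    exact Finset.sum_congr rfl fun l _ => by rw [← e]; ring
  apply two_smul_inj
  rw [e2, e3]
  have s1 := sum_n_sphQ lam tk j
  have s2 : ∑ l, sphQ lam k l j * d l b = 2 * ri * (cd k b j - lam * d j b) := by
    have a := sum_δ_mul' j fun i => d i b
    have c := hb.sum_n_d_zero
    simp only [sphQ, cd, Fin.sum_univ_three] at *
    linear_combination -2 * ri * lam * a + 4 * ri * lam * n j * c
  have s3 := sum_n_sq
  have s4 := hb.sum_n_d_zero
  have s5 := hlam.sum_n_d_zero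
  simp only [dot, Fin.sum_univ_three] at *
  linear_combination -ri * b * s1 - r * ri * s2 + 2 * ri * b * d j lam * s3
    + 2 * ri * r * d j lam * s4 - 2 * ri * b * n j * s5
    + (-2 * ri * (cd k b j - lam * d j b) - 2 * n j *
      (d 0 lam * d 0 b + d 1 lam * d 1 b + d 2 lam * d 2 b)) * r_mul_ri

/-- The part of `δ_ξ π` that does not involve the rotations. -/
def boostMomentum (Q : Ten2) (N F : SF) (i j : Fin 3) : SF :=
  leadHess Q N F i j - N * linRic Q i j - δ i j * ∑ m, leadHess Q N F m m

/-- The first bracket is going to be the variation of the mixed momentum. The shift in `F` cancels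
$\partial_j(b\lambda)$ against the Christoffel term and $b\,\partial_j\mathrm{tr}\,k$ against the
Ricci term. The trace of the Hessian is left unevaluated in the radial coefficient. -/
theorem sum_n_boostMomentum {N F T : SF} (hN : N = r * b) (hT : Hom 0 T)
    (hF : F = T - b * lam - b * tr k) (j : Fin 3) :
    ∑ i, n i * boostMomentum (sphQ lam k) N F i j =
      ri * (b * dv k j + cd k b j + tr k * d j b - d j T)
      + (b * lap lam + dot lam b + 3 * ri * ri * lam * b + ri * ri * b * tr k
        - ∑ m, leadHess (sphQ lam k) N F m m) * n j := by
  have h1 := sum_n_linRic_sphQ hlam hk sk tk j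
  have h2 := sum_n_linΓ_sphQ hlam hb hk sk tk hN j
  have hF0 : Hom 0 F := hF ▸ (hT.sub ((hb.mul hlam).congr (add_zero 0))).sub
    ((hb.mul (Hom.tr hk)).congr (add_zero 0))
  have h3 := ((hF0.d j).congr (l := -1) (by norm_num)).sum_n_d_neg_one
  have h4 := sum_n_δ j
  have h5 : d j F = d j T - (d j b * lam + b * d j lam) - (d j b * tr k + b * d j (tr k)) := by
    rw [hF]; simp only [map_sub, d_mul]
  have e : ∀ i, n i * boostMomentum (sphQ lam k) N F i j = n i * d i (d j F)
      - n i * (∑ l, linΓ (sphQ lam k) l i j * d l N) - N * (n i * linRic (sphQ lam k) i j)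
      - (∑ m, leadHess (sphQ lam k) N F m m) * (n i * δ i j) := fun i => by
    rw [boostMomentum, leadHess]; ring
  simp only [e, Finset.sum_sub_distrib, ← Finset.mul_sum, h1, h2, h3, h4]
  rw [h5, hN]
  linear_combination (-(ri * b * (d j (tr k) - dv k j)) + b * n j * (lap lam + 2 * ri * ri * lam
    + ri * ri * tr k)) * r_mul_ri

end radial

end SF
end AsympFlat
end

/-! ### Tangential components modulo normal terms -/

noncomputable section
namespace AsympFlat

namespace SF

/-- Equality of the tangential parts of two tensors. -/
def EqTan (A B : Ten2) : Prop := ∃ u v : Fin 3 → SF, ∀ i j, A i j = B i j + n i * u j + v i * n j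

namespace EqTan

variable {A B A' B' : Ten2}

theorem add (h : EqTan A B) (h' : EqTan A' B') :
    EqTan (fun i j => A i j + A' i j) (fun i j => B i j + B' i j) := by
  obtain ⟨u, v, e⟩ := h
  obtain ⟨u', v', e'⟩ := h'
  exact ⟨fun j => u j + u' j, fun i => v i + v' i, fun i j => by simp only [e, e']; ring⟩

theorem const_mul (c : SF) (h : EqTan A B) : EqTan (fun i j => c * A i j) (fun i j => c * B i j) := by
  obtain ⟨u, v, e⟩ := h
  exact ⟨fun j => c * u j, fun i => c * v i, fun i j => by simp only [e]; ring⟩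

theorem sub (h : EqTan A B) (h' : EqTan A' B') :
    EqTan (fun i j => A i j - A' i j) (fun i j => B i j - B' i j) := by
  obtain ⟨u, v, e⟩ := h
  obtain ⟨u', v', e'⟩ := h'
  exact ⟨fun j => u j - u' j, fun i => v i - v' i, fun i j => by simp only [e, e']; ring⟩

theorem transpose (h : EqTan A B) : EqTan (fun i j => A j i) (fun i j => B j i) := by
  obtain ⟨u, v, e⟩ := h
  exact ⟨v, u, fun i j => by simp only [e]; ring⟩

theorem trans (h : EqTan A B) (h' : EqTan B B') : EqTan A B' := by
  obtain ⟨u, v, e⟩ := h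
  obtain ⟨u', v', e'⟩ := h'
  exact ⟨fun j => u j + u' j, fun i => v i + v' i, fun i j => by simp only [e, e']; ring⟩

theorem congr (h : EqTan A B) (e : ∀ i j, A' i j = A i j) (e' : ∀ i j, B' i j = B i j) :
    EqTan A' B' := by
  obtain ⟨u, v, h⟩ := h
  exact ⟨u, v, fun i j => by rw [e, e', h]⟩

theorem half (h : EqTan (fun i j => 2 * A i j) (fun i j => 2 * B i j)) : EqTan A B := by
  obtain ⟨u, v, h⟩ := h
  refine ⟨fun j => (1 / 2 : ℝ) • u j, fun i => (1 / 2 : ℝ) • v i, fun i j => ?_⟩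
  refine two_smul_inj ((h i j).trans ?_)
  algebra

theorem refl (A : Ten2) : EqTan A A := ⟨0, 0, fun i j => by simp⟩

end EqTan

/-- A symmetric tensor is determined by its tangential part and the contraction with `n`. -/
theorem eq_dec {M A : Ten2} {B : Fin 3 → SF} {C : SF} (hM : ∀ i j, M i j = M j i) (hA : Tan2 A)
    (hB : Tan1 B) (h : EqTan M A) (hn : ∀ j, ∑ i, n i * M i j = B j + C * n j) (i j : Fin 3) :
    M i j = dec A B C i j := by
  obtain ⟨u, v, e⟩ := h
  -- Contracting in either slot, and then in both, determines the normal terms `u` and `v` as far as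
  -- they enter the tensor.
  have h1 : ∀ j, u j + (∑ i, n i * v i) * n j = B j + C * n j := fun j => by
    have a : ∑ i, n i * A i j = 0 := hA.1 j
    have b := sum_n_sq
    have c := hn j
    simp only [e, Fin.sum_univ_three] at *
    linear_combination c - a - u j * b
  have h2 : ∀ i, v i + (∑ j, n j * u j) * n i = B i + C * n i := fun i => by
    have a : ∑ j, n j * A i j = 0 := hA.2 i
    have b := sum_n_sq
    have c := hn i
    simp only [hM _ i] at c
    simp only [e, Fin.sum_univ_three] at *
    linear_combination c - a - v i * b
  have h3 : (∑ j, n j * u j) + ∑ i, n i * v i = C := by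
    have a : ∑ j, n j * B j = 0 := hB
    have b := sum_n_sq
    have h10 := h1 0
    have h11 := h1 1
    have h12 := h1 2
    simp only [Fin.sum_univ_three] at *
    linear_combination n 0 * h10 + n 1 * h11 + n 2 * h12 + a
      + (C - n 0 * v 0 - n 1 * v 1 - n 2 * v 2) * b
  rw [e, dec]
  linear_combination n i * h1 j + n j * h2 i - n i * n j * h3

section tangential

variable {lam b : SF} {k : Ten2} (hlam : Hom 0 lam) (hb : Hom 0 b)
  (sk : ∀ i j, k i j = k j i) (tk : Tan2 k)

include hlam in
theorem lap_sphQ (hk : ∀ a b, Hom 0 (k a b)) (i j : Fin 3) : lap (sphQ lam k i j) =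
    2 * ri * (lap (k i j) - lap lam * δ i j + 2 * (lap lam * (n i * n j)
      + 2 * ri * (d i lam * n j + n i * d j lam) + lam * (2 * ri * ri * δ i j
      - 6 * ri * ri * (n i * n j)))) := by
  have hnn : Hom 0 (n i * n j) := ((hom_n i).mul (hom_n j)).congr (add_zero 0)
  have hA : Hom 0 (k i j - lam * δ i j + 2 * (lam * (n i * n j))) :=
    ((hk i j).sub ((hlam.mul (hom_δ i j)).congr (add_zero 0))).add
      ((hom_two.mul (hlam.mul hnn)).congr (by norm_num))
  have h1 : ∀ i, dot lam (n i) = ri * d i lam := fun i => by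
    rw [dot_comm, dot_n, hlam.sum_n_d_zero]; ring
  have h2 : dot (n i) (n j) = ri * ri * (δ i j - n i * n j) := by
    rw [dot_n, (hom_n j).sum_n_d_zero, d_n]; ring
  rw [sphQ, show 2 * ri * (k i j - lam * δ i j + 2 * lam * (n i * n j)) =
    2 * (ri * (k i j - lam * δ i j + 2 * (lam * (n i * n j)))) by ring, lap_mul, lap_two,
    dot_comm 2, dot_comm, dot_two, lap_mul ri, dot_ri hA, lap_ri, lap_add, lap_sub,
    lap_mul lam (δ i j), lap_δ, dot_δ, lap_mul 2, dot_two, lap_two, lap_mul lam, dot_mul,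
    lap_mul (n i), lap_n, lap_n, h1, h1, h2]
  ring

include hlam sk tk in
-- The radial row being known already, every term with a factor $n_i$ or $n_j$ can be collected in
-- the witnesses `u` and `v` and forgotten. The divergence, Laplacian and trace terms of
-- `two_mul_linRic` are treated separately.
theorem linRic_sphQ_eqTan (hk : ∀ a b, Hom 0 (k a b)) : EqTan (linRic (sphQ lam k)) fun i j =>
    ri * ri * ri * δ i j * (lam + tr k) + ri * (δ i j * lap lam - d i (d j lam) - d i (d j (tr k))
      + d i (dv k j) + d j (dv k i) - lap (k i j)) := by
  have hD : EqTan (fun i j => d i (∑ m, d m (sphQ lam k m j))) fun i j =>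
      6 * ri * ri * ri * lam * δ i j - 2 * ri * d i (d j lam) + 2 * ri * d i (dv k j) :=
    ⟨fun j => 2 * ri * ri * d j lam - 2 * ri * ri * dv k j,
      fun i => 6 * ri * ri * d i lam - 18 * ri * ri * ri * lam * n i, fun i j => by
      simp only [div_sphQ hlam tk]
      simp only [map_sub, d_mul, d_ri, d_two, show (6 : SF) = 2 + 2 + 2 by norm_num, map_add, d_n]
      ring⟩
  have hL : EqTan (fun i j => lap (sphQ lam k i j)) fun i j =>
      2 * ri * (lap (k i j) - lap lam * δ i j + 4 * ri * ri * lam * δ i j) :=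
    ⟨fun j => 8 * ri * ri * d j lam, fun i => 2 * ri * (2 * lap lam * n i + 4 * ri * d i lam
      - 12 * ri * ri * lam * n i), fun i j => by simp only [lap_sphQ hlam hk]; ring⟩
  have hT : EqTan (fun i j => d i (d j (∑ m, sphQ lam k m m))) fun i j =>
      2 * ri * (d i (d j (tr k)) - d i (d j lam)) - 2 * ri * ri * ri * (tr k - lam) * δ i j :=
    ⟨fun j => -(2 * ri * ri * (d j (tr k) - d j lam)), fun i => 6 * ri * ri * ri * (tr k - lam)
      * n i - 2 * ri * ri * (d i (tr k) - d i lam), fun i j => by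
      rw [tr_sphQ]
      simp only [map_sub, d_mul, d_ri, d_two, map_neg, map_add, d_n, map_zero]
      ring⟩
  refine EqTan.half <| (((hD.add hD.transpose).sub hL).sub hT).congr (fun i j => ?_) fun i j => ?_
  · rw [two_mul_linRic (sphQ_symm sk)]
    simp only [Finset.sum_add_distrib, Finset.sum_sub_distrib, map_sum, lap, fun m =>
      d_comm i m (sphQ lam k m j), fun m => d_comm j m (sphQ lam k m i)]
  · rw [δ_comm j i, d_comm j i lam]
    ring

include hlam hb sk tk in
-- Twice the sum consists of $\partial_iQ_{mj}\,\partial_mN$, its transpose, and minus the product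
-- of the gradients of $Q_{ij}$ and `N`.
theorem sum_linΓ_sphQ_eqTan (hk : ∀ a b, Hom 0 (k a b)) {N : SF} (hN : N = r * b) :
    EqTan (fun i j => ∑ l, linΓ (sphQ lam k) l i j * d l N) fun i j =>
      3 * ri * ri * lam * b * δ i j - ri * ri * b * k i j + (∑ m, d i (k m j) * d m b)
        + (∑ m, d j (k m i) * d m b) - (d i lam * d j b + d j lam * d i b) - dot (k i j) b
        + dot lam b * δ i j := by
  have hd : ∀ l, d l N = n l * b + r * d l b := fun l => by rw [hN, d_mul, d_r]
  have h0 := hb.sum_n_d_zero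
  have hG : EqTan (fun i j => ∑ m, d i (sphQ lam k m j) * d m N) fun i j =>
      b * (4 * ri * ri * lam * δ i j - 2 * ri * ri * k i j)
        + 2 * ((∑ m, d i (k m j) * d m b) - d i lam * d j b) :=
    ⟨fun j => -(2 * ri * (cd k b j - lam * d j b)),
      fun i => b * (2 * ri * d i lam - 6 * ri * ri * lam * n i) + 4 * ri * lam * d i b,
      fun i j => by
      have e1 : ∑ m, n m * d i (sphQ lam k m j) = d i (2 * ri * lam * n j) -
          ri * (sphQ lam k i j - n i * (2 * ri * lam * n j)) := by
        have a1 := sum_dn_mul (fun m => sphQ lam k m j) i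
        have a2 := congrArg (d i) (sum_n_sphQ lam tk j)
        rw [sum_n_sphQ lam tk] at a1
        simp only [Fin.sum_univ_three, map_add, d_mul _ (n _) (sphQ _ _ _ _)] at *
        linear_combination a2 - a1
      have e2 : r * ∑ m, d i (sphQ lam k m j) * d m b = -(2 * ri * (cd k b j - lam * d j b)) * n i
          + 2 * ((∑ m, d i (k m j) * d m b) - d i lam * d j b) + 4 * lam * ri * d i b * n j := by
        have a3 := sum_δ_mul' j fun m => d m b
        have a4 := sum_δ_mul i fun m => d m b
        simp only [sphQ, cd, Fin.sum_univ_three, d_mul, map_add, map_sub, d_ri, d_n, d_δ,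
          d_two] at *
        linear_combination (r * (2 * ri * ri * n i * lam - 2 * ri * d i lam)) * a3
          + 4 * r * ri * ri * lam * n j * a4
          + r * (4 * ri * d i lam * n j - 8 * ri * ri * lam * n i * n j
            + 4 * ri * ri * lam * (δ i j - n i * n j)) * h0
          + (-(2 * ri * (k 0 j * d 0 b + k 1 j * d 1 b + k 2 j * d 2 b - lam * d j b)) * n i
          + 2 * ((d i (k 0 j) * d 0 b + d i (k 1 j) * d 1 b + d i (k 2 j) * d 2 b)
          - d i lam * d j b) + 4 * lam * ri * d i b * n j) * r_mul_ri
      have e3 : ∑ m, d i (sphQ lam k m j) * d m N = b * (∑ m, n m * d i (sphQ lam k m j)) +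
          r * ∑ m, d i (sphQ lam k m j) * d m b := by
        simp only [hd, Fin.sum_univ_three]; ring
      simp only [e3, e1, e2]
      rw [sphQ]
      simp only [d_mul, d_ri, d_n, d_two]
      ring⟩
  have hV : EqTan (fun i j => dot (sphQ lam k i j) N) fun i j =>
      2 * (dot (k i j) b - dot lam b * δ i j) - 2 * ri * ri * b * (k i j - lam * δ i j) :=
    ⟨fun j => 4 * dot lam b * n j + 4 * lam * ri * d j b - 4 * ri * ri * b * lam * n j,
      fun i => 4 * lam * ri * d i b, fun i j => by
      have e1 := (hom_sphQ hlam hk i j).sum_n_d_neg_one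
      have e3 : dot (sphQ lam k i j) N = b * (∑ m, n m * d m (sphQ lam k i j)) +
          r * dot (sphQ lam k i j) b := by
        simp only [dot, hd, Fin.sum_univ_three]; ring
      have e4 : ∀ i, dot b (n i) = ri * d i b := fun i => by rw [dot_comm, dot_n, h0]; ring
      have e5 : dot (sphQ lam k i j) b = 2 * ri * (dot (k i j) b - dot lam b * δ i j +
          2 * (dot lam b * (n i * n j) + lam * (ri * d i b * n j + n i * (ri * d j b)))) := by
        rw [sphQ, dot_comm, dot_mul, dot_mul, dot_comm b 2, dot_two, dot_comm b ri, dot_ri hb,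
          dot_add, dot_sub, dot_mul, dot_δ, dot_mul, dot_mul, dot_mul, dot_comm b 2, dot_two, e4,
          e4, dot_comm b lam, dot_comm b]
        ring
      simp only [e3, e1, e5]
      rw [sphQ]
      linear_combination 2 * (dot (k i j) b - dot lam b * δ i j +
          2 * (dot lam b * (n i * n j) + lam * (ri * d i b * n j + n i * (ri * d j b)))) * r_mul_ri⟩
  refine EqTan.half <| ((hG.add hG.transpose).sub hV).congr (fun i j => ?_) fun i j => ?_
  · have e : ∀ u : SF, 2 * ((1 / 2 : ℝ) • u) = u := fun u => by algebra
    rw [Finset.mul_sum, dot, ← Finset.sum_add_distrib, ← Finset.sum_sub_distrib]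
    refine Finset.sum_congr rfl fun l _ => ?_
    rw [linΓ, ← mul_assoc, e, sphQ_symm sk i l]
    ring
  · rw [δ_comm j i, sk j i]
    ring

/-- The trace of the covariant Hessian. -/
theorem tr_leadHess_sphQ (hlam : Hom 0 lam) (hb : Hom 0 b) (sk : ∀ i j, k i j = k j i)
    (tk : Tan2 k) (hk : ∀ a b, Hom 0 (k a b)) {N F T : SF} (hN : N = r * b)
    (boost : ∀ i j, d i (d j N) = 0) (hF : F = T - b * lam - b * tr k) :
    ∑ m, leadHess (sphQ lam k) N F m m = lap T - b * lap lam - b * lap (tr k)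
      - 3 * ri * ri * b * lam + 3 * ri * ri * b * tr k - dot lam b - dot (tr k) b
      - 2 * ∑ m, dv k m * d m b := by
  have hd : ∀ l, d l N = n l * b + r * d l b := fun l => by rw [hN, d_mul, d_r]
  have h0 := hb.sum_n_d_zero
  have e1 : ∑ m, leadHess (sphQ lam k) N F m m = lap F -
      ∑ l, (∑ m, linΓ (sphQ lam k) l m m) * d l N := by
    simp only [leadHess, Finset.sum_sub_distrib, lap, Finset.sum_mul]
    rw [Finset.sum_comm (f := fun m l => linΓ (sphQ lam k) l m m * d l N)]
  have e2 : ∀ l, 2 * ∑ m, linΓ (sphQ lam k) l m m =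
      2 * (∑ m, d m (sphQ lam k m l)) - d l (∑ m, sphQ lam k m m) := fun l => by
    have e : ∀ u : SF, 2 * ((1 / 2 : ℝ) • u) = u := fun u => by algebra
    simp only [linΓ, Finset.mul_sum, map_sum, ← Finset.sum_sub_distrib, e]
    refine Finset.sum_congr rfl fun m _ => ?_
    rw [sphQ_symm sk l m]; ring
  have e3 : 2 * ∑ l, (∑ m, linΓ (sphQ lam k) l m m) * d l N = 2 * (5 * b * ri * ri * lam
      - b * ri * ri * tr k - dot lam b + 2 * (∑ m, dv k m * d m b) - dot (tr k) b) := by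
    have a : ∀ l, 2 * ((∑ m, linΓ (sphQ lam k) l m m) * d l N) = (2 * (6 * ri * ri * lam * n l
        - 2 * ri * d l lam + 2 * ri * dv k l) - 2 * (ri * (d l (tr k) - d l lam)
        - ri * ri * n l * (tr k - lam))) * (n l * b + r * d l b) := fun l => by
      rw [← mul_assoc, e2, tr_sphQ, div_sphQ hlam tk, hd]
      simp only [d_mul, d_ri, d_two, map_sub]
      ring
    rw [Finset.mul_sum]
    simp only [a]
    have b1 := sum_n_sq
    have b2 := hlam.sum_n_d_zero
    have b3 := (Hom.tr hk).sum_n_d_zero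
    have b4 := sum_n_dv tk
    simp only [dot, Fin.sum_univ_three] at *
    linear_combination b * (10 * ri * ri * lam + 2 * ri * ri * tr k) * b1 - 2 * ri * b * b2
      - 2 * ri * b * b3 + 4 * ri * b * b4 + r * (10 * ri * ri * lam + 2 * ri * ri * tr k) * h0
      + (-2 * (d 0 lam * d 0 b + d 1 lam * d 1 b + d 2 lam * d 2 b)
      - 2 * (d 0 (tr k) * d 0 b + d 1 (tr k) * d 1 b + d 2 (tr k) * d 2 b)
      + 4 * (dv k 0 * d 0 b + dv k 1 * d 1 b + dv k 2 * d 2 b)) * r_mul_ri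
  -- A boost is a first spherical harmonic: the trace of the vanishing Hessian of $rb$ gives $\Delta
  -- b=-2b/r^2$.
  have e4 : lap b = -(2 * ri * ri * b) := by
    have a : ∑ i, d i (d i N) = 0 := Finset.sum_eq_zero fun i _ => boost i i
    have b1 := sum_n_sq
    simp only [hd, lap, d_mul, map_add, d_n, d_r, δ_self, Fin.sum_univ_three] at *
    linear_combination ri * a - 2 * ri * h0 + ri * ri * b * b1 - (d 0 (d 0 b) + d 1 (d 1 b) + d 2 (d 2 b)) * r_mul_ri
  rw [e1, two_smul_inj e3, hF, lap_sub, lap_sub, lap_mul, lap_mul, e4, dot_comm b, dot_comm b]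
  ring

/-- All terms in `lam` cancel, again because of the shift in `F`, and the tangential momentum sees
only `b`, `T` and `k`. -/
theorem boostMomentum_eqTan (hlam : Hom 0 lam) (hb : Hom 0 b) (sk : ∀ i j, k i j = k j i)
    (tk : Tan2 k) (hk : ∀ a b, Hom 0 (k a b)) {N F T : SF} (hN : N = r * b)
    (boost : ∀ i j, d i (d j N) = 0) (hF : F = T - b * lam - b * tr k) :
    EqTan (boostMomentum (sphQ lam k) N F) fun i j =>
      d i (d j T) - δ i j * lap T - (d i b * d j (tr k) + d j b * d i (tr k))
      + δ i j * (dot (tr k) b + 2 * ∑ m, dv k m * d m b) + ri * ri * b * k i j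
      - 3 * ri * ri * b * tr k * δ i j + b * lap (tr k) * δ i j
      - (∑ m, d i (k m j) * d m b) - (∑ m, d j (k m i) * d m b) + dot (k i j) b
      + b * (lap (k i j) - d i (dv k j) - d j (dv k i)) := by
  have hd : ∀ l, d l N = n l * b + r * d l b := fun l => by rw [hN, d_mul, d_r]
  -- The boost equation expresses the Hessian of `b` through `b` and its gradient.
  have e1 : ∀ i j, d i (d j b) = -(ri * ri * b * (δ i j - n i * n j)) -
      ri * n i * d j b - ri * n j * d i b := fun i j => by
    have a := boost i j
    rw [hd, map_add, d_mul, d_mul, d_n, d_r] at a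
    linear_combination ri * a - d i (d j b) * r_mul_ri
  have hF2 : EqTan (fun i j => d i (d j F)) fun i j => d i (d j T) - (d i b * (d j lam + d j (tr k))
      + d j b * (d i lam + d i (tr k))) - b * (d i (d j lam) + d i (d j (tr k)))
      + ri * ri * b * (lam + tr k) * δ i j :=
    ⟨fun j => (lam + tr k) * ri * d j b, fun i => (lam + tr k) * (ri * d i b - ri * ri * b * n i),
      fun i j => by
      simp only [hF, map_sub, map_add, d_mul, e1]
      ring⟩
  refine (((hF2.sub (sum_linΓ_sphQ_eqTan hlam hb sk tk hk hN)).sub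
    ((linRic_sphQ_eqTan hlam sk tk hk).const_mul N)).sub (EqTan.refl fun i j => δ i j *
      ∑ m, leadHess (sphQ lam k) N F m m)).congr (fun i j => ?_) fun i j => ?_
  · rw [boostMomentum, leadHess]
  · rw [tr_leadHess_sphQ hlam hb sk tk hk hN boost hF, hN]
    linear_combination b * (ri * ri * δ i j * (lam + tr k) + (δ i j * lap lam - d i (d j lam)
      - d i (d j (tr k)) + d i (dv k j) + d j (dv k i) - lap (k i j))) * r_mul_ri

end tangential
end SF
end AsympFlat
end

/-! ### From flat derivatives to covariant derivatives on the sphere -/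

noncomputable section
namespace AsympFlat

namespace SF

/-- Laplacian on the spheres. -/
def lapS (u : SF) : SF := ∑ a, D1 (D0 u) a a

/-- Lie derivative of a function on the spheres. -/
def lieFn (Y : Fin 3 → SF) (u : SF) : SF := ∑ c, Y c * D0 u c

/-- Divergence on the spheres. -/
def divS (Y : Fin 3 → SF) : SF := ∑ c, D1 Y c c

/-- Lie derivative of a covariant tensor on the spheres. -/
def lieCov (Y : Fin 3 → SF) (k : Ten2) : Ten2 := fun a b =>
  ∑ c, (Y c * D2 k c a b + k c b * D1 Y a c + k a c * D1 Y b c)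

/-- Lie derivative of a scalar density on the spheres. -/
def lieDens (Y : Fin 3 → SF) (u : SF) : SF := lieFn Y u + divS Y * u

/-- Lie derivative of a vector density on the spheres. -/
def lieVecDens (Y V : Fin 3 → SF) (a : Fin 3) : SF :=
  ∑ c, (Y c * D1 V c a - V c * D1 Y c a) + divS Y * V a

/-- Lie derivative of a contravariant tensor density on the spheres. -/
def lieConDens (Y : Fin 3 → SF) (q : Ten2) : Ten2 := fun a b =>
  ∑ c, (Y c * D2 q c a b - q c b * D1 Y c a - q a c * D1 Y c b) + divS Y * q a b

/-- In degree zero the radial derivatives drop out of the flat Laplacian. -/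
theorem lapS_eq {u : SF} (hu : Hom 0 u) : lapS u = r * r * lap u := by
  have h := hu.sum_n_d_zero
  simp only [lapS, D1, D0, lap, d_mul, d_r, Fin.sum_univ_three] at *
  linear_combination 2 * r * h

theorem sum_D0_mul_D0 (u v : SF) : ∑ c, D0 u c * D0 v c = r * r * dot u v := by
  simp only [D0, dot, Fin.sum_univ_three]; ring

section contractions

variable {k : Ten2} (hk : ∀ a b, Hom 0 (k a b)) (sk : ∀ i j, k i j = k j i) (tk : Tan2 k)

include tk in
theorem sum_D2 (c : Fin 3) : ∑ m, D2 k m m c = r * dv k c + n c * tr k := by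
  have h : ∑ m, n m * k m c = 0 := tk.1 c
  simp only [D2, dv, tr, Fin.sum_univ_three] at *
  linear_combination h

include tk in
theorem sum_D2_trace (c : Fin 3) : ∑ m, D2 k c m m = r * d c (tr k) := by
  have h : ∑ m, n m * k m c = 0 := tk.1 c
  have h' : ∑ m, n m * k c m = 0 := tk.2 c
  simp only [D2, tr, map_add, Fin.sum_univ_three] at *
  linear_combination h + h'

include sk in
theorem sum_D2_mul_D0 {b : SF} (hb : Hom 0 b) (a c : Fin 3) : ∑ m, D2 k a c m * D0 b m =
    r * r * (∑ m, d a (k m c) * d m b) + r * n c * cd k b a := by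
  have h := hb.sum_n_d_zero
  have e : ∀ m, D2 k a c m = r * d a (k m c) + n c * k m a + n m * k a c := fun m => by
    rw [D2, sk c m, sk a m, sk c a]
  simp only [e, D0, cd, Fin.sum_univ_three] at *
  linear_combination r * k a c * h

theorem sum_D2_mul_D0' (sk : ∀ i j, k i j = k j i) (b : SF) (a c : Fin 3) :
    ∑ m, D2 k m a c * D0 b m = r * r * dot (k a c) b + r * (n a * cd k b c + n c * cd k b a) := by
  simp only [D2, D0, cd, dot, Fin.sum_univ_three, sk a]
  ring

include sk tk in
theorem sum_sum_D2_mul_D0 {b : SF} (hb : Hom 0 b) : ∑ m, ∑ e, D2 k e m e * D0 b m =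
    r * r * ∑ m, dv k m * d m b := by
  have h := hb.sum_n_d_zero
  have e : ∀ m, ∑ e, D2 k e m e = r * dv k m + n m * tr k := fun m => by
    rw [← sum_D2 tk]
    exact Finset.sum_congr rfl fun e _ => by rw [D2, D2, sk m e, sk e m, sk m e]; ring
  simp only [← Finset.sum_mul, e, D0]
  simp only [Fin.sum_univ_three] at *
  linear_combination r * tr k * h

include tk in
theorem sum_D2_mul (b : SF) (c : Fin 3) : ∑ m, D2 (fun e m => b * k e m) m m c =
    r * (cd k b c + b * dv k c) + b * tr k * n c := by
  have h : ∑ m, n m * k m c = 0 := tk.1 c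
  simp only [D2, dv, tr, cd, d_mul, Fin.sum_univ_three] at *
  linear_combination b * h

include hk sk tk

/-- The terms with `n a` or `n c` are normal and disappear under `EqTan`. The term `2 * k a c`, with
its counterparts in `sum_D3_div`, lowers the coefficient 3 of $b\,k$ in the transformation law to
the coefficient 1 in `boostMomentum_eqTan`. -/
theorem sum_D3_lap (a c : Fin 3) : ∑ m, D3 (D2 k) m m a c = r * r * lap (k a c) + 2 * k a c
    + n a * (2 * r * dv k c + n c * tr k) + n c * (2 * r * dv k a + n a * tr k) := by
  have h1 : ∑ m, n m * D2 k m a c = 0 := (tan_D2 hk tk).1 a c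
  have h2 := sum_D2 tk c
  have h3 := sum_D2 tk a
  have h4 := (hk a c).sum_n_d_zero
  have h5 : ∑ m, n m * k m c = 0 := tk.1 c
  have h6 : ∑ m, n m * k m a = 0 := tk.1 a
  have h7 := sum_δ_mul' a fun m => k m c
  have h8 := sum_δ_mul' c fun m => k m a
  have e : ∀ m, D3 (D2 k) m m a c = r * d m (D2 k m a c) + n m * D2 k m a c +
      n a * D2 k m m c + n c * D2 k m m a := fun m => by
    rw [D3]
    have : D2 k m a m = D2 k m m a := by rw [D2, D2, sk a m, sk m m]; ring
    rw [this]
  simp only [e, Finset.sum_add_distrib, ← Finset.mul_sum, h1, h2, h3]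
  simp only [D2, lap, dv, d_mul, d_r, d_n, map_add, sk a, Fin.sum_univ_three] at *
  linear_combination r * h4 + r * ri * h7 + r * ri * h8 - r * ri * n a * h5 - r * ri * n c * h6
    + 2 * k c a * r_mul_ri

theorem sum_D3_div (a c : Fin 3) : ∑ m, D3 (D2 k) m a m c = r * r * d a (dv k c) + 2 * k a c
    + n a * (r * dv k c + n c * tr k) + n c * (r * d a (tr k) + r * dv k a) := by
  have h1 : ∑ m, n m * D2 k a m c = 0 := ((tan_D2 hk tk).2 a).1 c
  have h2 := sum_D2 tk c
  have h3 := sum_D2_trace tk a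
  have h4 := (hk a c).sum_n_d_zero
  have h5 := sum_n_d_tangent (tk.1 c) a
  have h6 : ∑ m, n m * k m a = 0 := tk.1 a
  have h7 := sum_n_sq
  have h8 := sum_δ_mul' c fun m => k m a
  have e : ∀ m, D3 (D2 k) m a m c = r * d m (D2 k a m c) + n a * D2 k m m c +
      n m * D2 k a m c + n c * D2 k a m m := fun m => by rw [D3]
  simp only [e, Finset.sum_add_distrib, ← Finset.mul_sum, h1, h2, h3]
  simp only [D2, dv, d_mul, d_r, d_n, map_add, Fin.sum_univ_three, δ_self, d_comm a, sk a] at *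
  rw [sk c a] at *
  linear_combination r * h4 + r * h5 + r * ri * h8 - r * ri * n c * h6 - r * ri * k a c * h7
    + 2 * k a c * r_mul_ri

end contractions

section lie

variable {Y : Fin 3 → SF} (tY : Tan1 Y) (hY : ∀ a, Hom 0 (Y a))

include tY in
theorem sum_n_d_mul (i : Fin 3) : ∑ m, n m * d i (r * Y m) = -Y i := by
  have h1 := sum_n_d_tangent tY i
  have h2 : ∑ m, n m * Y m = 0 := tY
  simp only [d_mul, d_r, Fin.sum_univ_three] at *
  linear_combination r * h1 + n i * h2 - Y i * r_mul_ri

include tY in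
/-- The Lie derivative of the metric along a rotation. -/
theorem lie_sphQ {lam : SF} {k : Ten2} (tk : Tan2 k)
    (kil : ∀ i j, d i (r * Y j) + d j (r * Y i) = 0) (i j : Fin 3) :
    ∑ m, (r * Y m * d m (sphQ lam k i j) + sphQ lam k m j * d i (r * Y m)
      + sphQ lam k i m * d j (r * Y m)) = sphQ (lieFn Y lam) (lieCov Y k) i j := by
  have h1 : ∑ m, n m * Y m = 0 := tY
  have h2 : ∑ m, n m * k m j = 0 := tk.1 j
  have h3 : ∑ m, n m * k i m = 0 := tk.2 i
  have h4 := sum_n_d_mul tY i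
  have h5 := sum_n_d_mul tY j
  have h6' := sum_δ_mul' i Y
  have h7 := sum_δ_mul' j Y
  have h8 := sum_δ_mul' j fun m => d i (r * Y m)
  have h9 := sum_δ_mul i fun m => d j (r * Y m)
  have h10 := kil i j
  simp only [sphQ, lieFn, lieCov, D0, D1, D2, d_mul, d_r, d_ri, d_n, d_δ, d_two, map_add, map_sub,
    Fin.sum_univ_three] at *
  linear_combination (-2 * ri * ri * r * (k i j - lam * δ i j + 2 * lam * (n i * n j))
      - 8 * r * ri * ri * lam * n i * n j) * h1
    - 2 * ri * Y i * h2 - 2 * ri * Y j * h3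
    + 4 * ri * lam * n j * h4 + 4 * ri * lam * n i * h5 - 2 * ri * lam * h8 - 2 * ri * lam * h9
    - 2 * ri * lam * h10 + 4 * r * ri * ri * lam * n j * h6' + 4 * r * ri * ri * lam * n i * h7
    + 4 * ri * lam * (n i * Y j + n j * Y i) * r_mul_ri

include tY hY in
/-- The Lie derivative of the momentum along a rotation. -/
theorem lie_dec {s : Ten2} {q : Fin 3 → SF} {C : SF} (ts : Tan2 s) (tq : Tan1 q) (i j : Fin 3) :
    ∑ m, (d m (ri * ri * dec s q C i j * (r * Y m)) - d m (r * Y i) * (ri * ri * dec s q C m j)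
      - d m (r * Y j) * (ri * ri * dec s q C i m)) =
    ri * ri * dec (lieConDens Y s) (lieVecDens Y q) (lieDens Y C) i j := by
  have h1 : ∑ m, n m * Y m = 0 := tY
  have h2 := (hY i).sum_n_d_zero
  have h2' := (hY j).sum_n_d_zero
  have h3 := sum_n_sq
  have h4 : ∑ m, n m * s m j = 0 := ts.1 j
  have h4' : ∑ m, n m * s i m = 0 := ts.2 i
  have h5 : ∑ m, n m * q m = 0 := tq
  have h6 := sum_δ_mul' i Y
  have h7 := sum_δ_mul' j Y
  simp only [dec, lieConDens, lieVecDens, lieDens, lieFn, divS, D0, D1, D2, d_mul, d_r, d_ri, d_n,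
    map_add, Fin.sum_univ_three] at *
  linear_combination (-2 * r * ri * ri * ri * (s i j + n i * q j + n j * q i + C * (n i * n j))
      - r * ri * ri * ri * (n i * q j + n j * q i + 2 * C * n i * n j)) * h1
    + r * ri * ri * ri * (q j + C * n j) * h6 + r * ri * ri * ri * (q i + C * n i) * h7
    - Y i * ri * ri * h4 - Y j * ri * ri * h4'
    - ri * ri * (Y i * (q j + C * n j) + Y j * (q i + C * n i)) * h3
    - ri * ri * (Y i * n j + Y j * n i) * h5
    - r * ri * ri * (q j + C * n j) * h2 - r * ri * ri * (q i + C * n i) * h2'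
    + ri * ri * (Y i * q j + Y j * q i + C * Y i * n j + C * n i * Y j) * r_mul_ri

end lie

end SF
end AsympFlat
end

/-! ### The variation of the boundary data, its symmetry and tangency -/

noncomputable section
namespace AsympFlat

open SF

namespace SF

namespace Tan1

variable {V V' : Fin 3 → SF}

theorem add (h : Tan1 V) (h' : Tan1 V') : Tan1 fun a => V a + V' a := by
  have e : ∀ a, n a * (V a + V' a) = n a * V a + n a * V' a := fun a => mul_add _ _ _
  simp only [Tan1, e, Finset.sum_add_distrib, show ∑ a, n a * V a = 0 from h,
    show ∑ a, n a * V' a = 0 from h', add_zero]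

theorem neg (h : Tan1 V) : Tan1 fun a => -V a := by
  simp only [Tan1, mul_neg, Finset.sum_neg_distrib, show ∑ a, n a * V a = 0 from h, neg_zero]

theorem sub (h : Tan1 V) (h' : Tan1 V') : Tan1 fun a => V a - V' a := by
  simpa only [sub_eq_add_neg] using h.add h'.neg

theorem const_mul (u : SF) (h : Tan1 V) : Tan1 fun a => u * V a := sum_n_mul_left h u

theorem mul_const (h : Tan1 V) (u : SF) : Tan1 fun a => V a * u := by
  simpa only [mul_comm] using h.const_mul u

theorem smul (c : ℝ) (h : Tan1 V) : Tan1 fun a => c • V a := by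
  simp only [Tan1, mul_smul_comm, ← Finset.smul_sum, show ∑ a, n a * V a = 0 from h, smul_zero]

theorem sum {V : Fin 3 → Fin 3 → SF} (h : ∀ m, Tan1 (V m)) : Tan1 fun a => ∑ m, V m a := by
  simp only [Tan1, Finset.mul_sum]
  rw [Finset.sum_comm]
  exact Finset.sum_eq_zero fun m _ => h m

end Tan1

theorem Tan2.of_symm {k : Ten2} (h : ∀ b, Tan1 fun a => k a b) (sk : ∀ i j, k i j = k j i) :
    Tan2 k := ⟨h, fun a => by
  rw [show k a = fun c => k c a from funext (sk a)]
  exact h a⟩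

theorem D1_D0_comm (u : SF) (a c : Fin 3) : D1 (D0 u) a c = D1 (D0 u) c a := by
  simp only [D1, D0, d_mul, d_r, d_comm a c]; ring

theorem D2_symm {k : Ten2} (sk : ∀ i j, k i j = k j i) (m a c : Fin 3) :
    D2 k m a c = D2 k m c a := by
  rw [D2, D2, sk a c, sk m c, sk a m]; ring

theorem D3_symm {t : Fin 3 → Ten2} (st : ∀ m i j, t m i j = t m j i) (e m a c : Fin 3) :
    D3 t e m a c = D3 t e m c a := by
  rw [D3, D3, st m a c, st e a c, st m e c, st m a e]; ring

theorem lieDens_sub (Y : Fin 3 → SF) (u v : SF) :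
    lieDens Y (2 * (u - v)) = 2 * (lieDens Y u - lieDens Y v) := by
  simp only [lieDens, lieFn, D0, d_mul, d_two, map_sub, Fin.sum_univ_three]
  ring

/-- For a Killing field the terms in `D1 Y` contract a symmetric tensor with an antisymmetric one,
so the trace commutes with the Lie derivative. -/
theorem tr_lieConDens {Y : Fin 3 → SF} {s : Ten2} (ss : ∀ i j, s i j = s j i) (ts : Tan2 s)
    (kil : ∀ i j, D1 Y i j + D1 Y j i = 0) : tr (lieConDens Y s) = lieDens Y (tr s) := by
  have h := sum_D2_trace ts
  have e : ∀ i j, s i j * D1 Y j i = -(s i j * D1 Y i j) := fun i j => by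
    linear_combination s i j * kil i j
  have e1 : ∑ a, ∑ c, s c a * D1 Y c a = 0 := two_smul_inj <| by
    have : ∑ a, ∑ c, s c a * D1 Y c a = ∑ a, ∑ c, -(s c a * D1 Y c a) := by
      conv_lhs => rw [Finset.sum_comm]
      refine Finset.sum_congr rfl fun a _ => Finset.sum_congr rfl fun c _ => ?_
      rw [ss, ← e]
    rw [two_mul]
    nth_rewrite 1 [this]
    simp [Finset.sum_neg_distrib]
  have e2 : tr (lieConDens Y s) = (∑ c, Y c * ∑ a, D2 s c a a) - 2 * (∑ a, ∑ c, s c a * D1 Y c a)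
      + divS Y * tr s := by
    simp only [tr, lieConDens, Fin.sum_univ_three, ss 1 0, ss 2 0, ss 2 1]
    ring
  rw [e2, e1, lieDens, lieFn]
  simp only [h, D0]
  ring

end SF

namespace LeadData

/-- The coefficient `λ`. -/
def lam (D : LeadData) : SF := (1 / 2 : ℝ) • D.hrr

/-- The coefficient `k`. -/
def k (D : LeadData) : Ten2 := fun a c => (1 / 2 : ℝ) • D.hAB a c + D.lam * γ a c

/-- The coefficient `p`. -/
def p (D : LeadData) : SF := 2 * (D.prr - tr D.pAB)

theorem hrr_eq (D : LeadData) : D.hrr = 2 * D.lam := by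
  rw [lam]; algebra

/-- Substitution of $h_{AB}=2k-2\lambda\gamma$, $h_{rr}=2\lambda$ and $\gamma=\delta-n\,n$. -/
theorem metric_eq (D : LeadData) (i j : Fin 3) : D.metric i j = sphQ D.lam D.k i j := by
  have h : D.hAB i j = 2 * ((1 / 2 : ℝ) • D.hAB i j) := by algebra
  rw [metric, dec, hrr_eq, sphQ, k, γ]
  linear_combination ri * h

variable (D : LeadData) (b W T : SF) (Y : Fin 3 → SF)

/-- Variation of `λ`. -/
def varLam : SF := (1 / 2 : ℝ) • (b * (D.prr - tr D.pAB)) + SF.lieFn Y D.lam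

/-- Variation of `k`. -/
def varK : Ten2 := fun a c =>
  SF.lieCov Y D.k a c + SF.D1 (SF.D0 W) a c + W * γ a c + b * (D.pAB a c - γ a c * tr D.pAB)
    + SF.D1 (fun e => b * D.prA e) a c + SF.D1 (fun e => b * D.prA e) c a

/-- Variation of `p`. -/
def varP : SF := SF.lieDens Y D.p + (4 * b * SF.lapS D.lam + 4 * ∑ c, SF.D0 b c * SF.D0 D.lam c + 12 * b * D.lam)

/-- Variation of the mixed components of the momentum. -/
def varPrA : Fin 3 → SF := fun a =>
  SF.lieVecDens Y D.prA a
    + ((∑ c, SF.D2 (fun e m => b * D.k e m) c c a) + SF.D0 b a * tr D.k - SF.D0 T a)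

/-- Variation of the tangential components of the momentum. -/
def varPAB : Ten2 := fun a c =>
  SF.lieConDens Y D.pAB a c
    + (SF.D1 (SF.D0 T) a c - γ a c * SF.lapS T)
    + 3 * b * (D.k a c - γ a c * tr D.k)
    + b * (γ a c * SF.lapS (tr D.k)
        + ∑ m, (SF.D3 (SF.D2 D.k) m m a c - SF.D3 (SF.D2 D.k) m a m c - SF.D3 (SF.D2 D.k) m c m a))
    + (-(SF.D0 b a * SF.D0 (tr D.k) c) - SF.D0 b c * SF.D0 (tr D.k) a
        + γ a c * ∑ m, SF.D0 b m * SF.D0 (tr D.k) m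
        + 2 * γ a c * ∑ m, ∑ e, SF.D2 D.k e m e * SF.D0 b m
        - ∑ m, SF.D2 D.k a c m * SF.D0 b m
        - ∑ m, SF.D2 D.k c a m * SF.D0 b m
        + ∑ m, SF.D2 D.k m a c * SF.D0 b m)

/-- Variation of the boundary data. -/
def variation : LeadData where
  -- The entries `hrr`, `hAB` and `prr` come from inverting the definitions of `lam`, `k` and `p`.
  hrr := 2 * D.varLam b Y
  hAB a c := 2 * (D.varK b W Y a c - D.varLam b Y * γ a c)
  prr := (1 / 2 : ℝ) • D.varP b Y + tr (D.varPAB b T Y)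
  prA := D.varPrA b T Y
  pAB := D.varPAB b T Y

theorem lam_variation : (D.variation b W T Y).lam = D.varLam b Y := by
  rw [lam, variation]; algebra

theorem k_variation (a c : Fin 3) : (D.variation b W T Y).k a c = D.varK b W Y a c := by
  rw [k, lam_variation, variation]; algebra

theorem p_variation : (D.variation b W T Y).p = D.varP b Y := by
  rw [p, variation]; algebra

variable {D b W T Y} (hD : D.IsSphere) (hb : Hom 0 b) (hW : Hom 0 W) (hT : Hom 0 T)
  (hY : ∀ a, Hom 0 (Y a)) (tY : Tan1 Y)

include hD

theorem hom_lam : Hom 0 D.lam := hD.hom_hrr.smul _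

theorem hom_k (a c : Fin 3) : Hom 0 (D.k a c) :=
  ((hD.hom_hAB a c).smul _).add (((hom_lam hD).mul (hom_γ a c)).congr (add_zero 0))

theorem k_symm (a c : Fin 3) : D.k a c = D.k c a := by rw [k, k, hD.symm_hAB, γ_comm]

theorem tan_k : Tan2 D.k := Tan2.of_symm (fun c =>
  ((hD.tan_hAB.1 c).smul _).add (Tan1.const_mul _ (sum_n_γ c))) (k_symm hD)

theorem varK_symm (a c : Fin 3) : D.varK b W Y a c = D.varK b W Y c a := by
  have h : SF.lieCov Y D.k a c = SF.lieCov Y D.k c a := Finset.sum_congr rfl fun m _ => by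
    rw [D2_symm (k_symm hD) m a c, k_symm hD a m, k_symm hD c m]; ring
  rw [varK, varK, h, D1_D0_comm W, γ_comm a c, hD.symm_pAB a c]
  ring

theorem varPAB_symm (a c : Fin 3) : D.varPAB b T Y a c = D.varPAB b T Y c a := by
  have h : SF.lieConDens Y D.pAB a c = SF.lieConDens Y D.pAB c a := by
    rw [SF.lieConDens, SF.lieConDens, hD.symm_pAB a c]
    congr 1
    exact Finset.sum_congr rfl fun m _ => by
      rw [D2_symm hD.symm_pAB m a c, hD.symm_pAB a m, hD.symm_pAB c m]; ring
  have h1 : ∀ m, SF.D3 (SF.D2 D.k) m m a c = SF.D3 (SF.D2 D.k) m m c a := fun m =>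
    D3_symm (D2_symm (k_symm hD)) m m a c
  have h2 : ∀ m, SF.D2 D.k m a c = SF.D2 D.k m c a := fun m => D2_symm (k_symm hD) m a c
  simp only [varPAB, h, D1_D0_comm T a c, γ_comm a c, k_symm hD a c, h1, h2,
    Finset.sum_sub_distrib]
  ring

include hb hY hW in
theorem tan_varK (tY : Tan1 Y) : Tan2 (D.varK b W Y) := by
  have hbq : ∀ e, Hom 0 (b * D.prA e) := fun e => (hb.mul (hD.hom_prA e)).congr (add_zero 0)
  have tbq : Tan1 fun e => b * D.prA e := hD.tan_prA.const_mul b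
  refine Tan2.of_symm (fun c => ?_) (varK_symm hD)
  have h1 : Tan1 fun a => SF.lieCov Y D.k a c := Tan1.sum (V := fun m a => Y m * SF.D2 D.k m a c +
      D.k m c * SF.D1 Y a m + D.k a m * SF.D1 Y c m) fun m =>
    ((((tan_D2 (hom_k hD) (tan_k hD)).2 m).1 c).const_mul _ |>.add
      (((tan_D1 hY tY).1 m).const_mul _)).add (((tan_k hD).1 m).mul_const _)
  exact ((((h1.add ((tan_D1 (fun a => hW.D0 a) (tan_D0 hW)).1 c)).add
    (Tan1.const_mul _ (sum_n_γ c))).add (Tan1.const_mul _ ((hD.tan_pAB.1 c).sub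
      (Tan1.mul_const (sum_n_γ c) _)))).add ((tan_D1 hbq tbq).1 c)).add ((tan_D1 hbq tbq).2 c)

include hb hY tY hT in
theorem tan_varPrA : Tan1 (D.varPrA b T Y) := by
  have hk := hom_k hD
  have tk := tan_k hD
  have hbk : ∀ e m, Hom 0 (b * D.k e m) := fun e m => (hb.mul (hk e m)).congr (add_zero 0)
  have tbk : Tan2 fun e m => b * D.k e m :=
    ⟨fun c => (tk.1 c).const_mul b, fun a => (tk.2 a).const_mul b⟩
  have h1 : Tan1 fun a => ∑ c, (Y c * SF.D1 D.prA c a - D.prA c * SF.D1 Y c a) :=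
    Tan1.sum (V := fun c a => Y c * SF.D1 D.prA c a - D.prA c * SF.D1 Y c a) fun c =>
      (((tan_D1 hD.hom_prA hD.tan_prA).2 c).const_mul _).sub (((tan_D1 hY tY).2 c).const_mul _)
  exact (h1.add (hD.tan_prA.const_mul _)).add (((Tan1.sum
    (V := fun c a => SF.D2 (fun e m => b * D.k e m) c c a) fun c => ((tan_D2 hbk tbk).2 c).2 c).add
      ((tan_D0 hb).mul_const _)).sub (tan_D0 hT))

include hb hY tY hT in
theorem tan_varPAB : Tan2 (D.varPAB b T Y) := by
  have hk := hom_k hD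
  have tk := tan_k hD
  have t2 := tan_D2 hk tk
  have t3 := tan_D3 t2
  have tκ := tan_D0 (Hom.tr hk)
  refine Tan2.of_symm (fun c => ?_) (varPAB_symm hD)
  have h1 : Tan1 fun a => ∑ m, (Y m * SF.D2 D.pAB m a c - D.pAB m c * SF.D1 Y m a
      - D.pAB a m * SF.D1 Y m c) :=
    Tan1.sum (V := fun m a => Y m * SF.D2 D.pAB m a c - D.pAB m c * SF.D1 Y m a
      - D.pAB a m * SF.D1 Y m c) fun m =>
    (((((tan_D2 hD.hom_pAB hD.tan_pAB).2 m).1 c).const_mul _).sub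
      (((tan_D1 hY tY).2 m).const_mul _)).sub ((hD.tan_pAB.1 m).mul_const _)
  have h2 : Tan1 fun a => ∑ m, (SF.D3 (SF.D2 D.k) m m a c - SF.D3 (SF.D2 D.k) m a m c
      - SF.D3 (SF.D2 D.k) m c m a) :=
    Tan1.sum (V := fun m a => SF.D3 (SF.D2 D.k) m m a c - SF.D3 (SF.D2 D.k) m a m c
      - SF.D3 (SF.D2 D.k) m c m a) fun m =>
    ((((t3 m).2 m).1 c).sub ((t3 m).1 m c)).sub (((t3 m).2 c).2 m)
  have tγ : Tan1 fun a => γ a c := sum_n_γ c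
  have h3 : Tan1 fun a => ∑ m, SF.D2 D.k a c m * SF.D0 b m :=
    Tan1.sum (V := fun m a => SF.D2 D.k a c m * SF.D0 b m) fun m => (t2.1 c m).mul_const _
  have h4 : Tan1 fun a => ∑ m, SF.D2 D.k c a m * SF.D0 b m :=
    Tan1.sum (V := fun m a => SF.D2 D.k c a m * SF.D0 b m) fun m => ((t2.2 c).1 m).mul_const _
  have h5 : Tan1 fun a => ∑ m, SF.D2 D.k m a c * SF.D0 b m :=
    Tan1.sum (V := fun m a => SF.D2 D.k m a c * SF.D0 b m) fun m => ((t2.2 m).1 c).mul_const _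
  exact ((((h1.add ((hD.tan_pAB.1 c).const_mul _)).add
    (((tan_D1 (fun a => hT.D0 a) (tan_D0 hT)).1 c).sub (tγ.mul_const _))).add
    (((tk.1 c).sub (tγ.mul_const _)).const_mul _)).add
    (((tγ.mul_const _).add h2).const_mul _)).add
    ((((((((tan_D0 hb).mul_const _).neg.sub (tκ.const_mul _)).add (tγ.mul_const _)).add
      ((tγ.const_mul 2).mul_const _)).sub h3).sub h4).add h5)

end LeadData

end AsympFlat
end

/-! ### Identification of the leading variations with the transformation laws -/

noncomputable section
namespace AsympFlat

open SF

namespace LeadData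

variable {D : LeadData} {b W T : SF} {Y : Fin 3 → SF} (hD : D.IsSphere) (hb : Hom 0 b)
  (hW : Hom 0 W) (hT : Hom 0 T) (hY : ∀ a, Hom 0 (Y a)) (tY : Tan1 Y)

include hD tY in
/-- The variation of the metric in terms of the variation of the boundary data. -/
theorem leadMetric_eq (kil : ∀ i j, d i (r * Y j) + d j (r * Y i) = 0) (i j : Fin 3) :
    leadMetric D.metric D.momentum (r * b) (fun m => r * Y m)
      (fun m => W * n m + 2 * b * D.prA m + r * d m W) i j =
      sphQ (D.varLam b Y) (D.varK b W Y) i j := by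
  have h1 := lie_sphQ tY (lam := D.lam) (tan_k hD) kil i j
  have h2 : ∑ m, D.momentum m m = ri * ri * (tr D.pAB + D.prr) := by
    have a := sum_n_sq
    have c : ∑ m, n m * D.prA m = 0 := hD.tan_prA
    simp only [momentum, dec, tr, Fin.sum_univ_three] at *
    linear_combination ri * ri * D.prr * a + 2 * ri * ri * c
  have h3 : 2 * ((1 / 2 : ℝ) • (b * (D.prr - tr D.pAB))) = b * (D.prr - tr D.pAB) := by algebra
  have h4 : D.momentum i j - (1 / 2 : ℝ) • (δ i j * ∑ m, D.momentum m m) =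
      D.momentum i j - (1 / 2 : ℝ) • (δ i j * (ri * ri * (tr D.pAB + D.prr))) := by rw [h2]
  have h5 : 2 * ((1 / 2 : ℝ) • (δ i j * (ri * ri * (tr D.pAB + D.prr)))) =
      δ i j * (ri * ri * (tr D.pAB + D.prr)) := by algebra
  simp only [leadMetric, h4, metric_eq]
  rw [h1]
  -- The part $2b\,\pi^{rm}+r\,\partial_mW$ of the tangential deformation cancels the mixed
  -- components coming from the boost and from the radial shift $W n$.
  simp only [sphQ, varLam, varK, SF.D1, SF.D0, momentum, dec, d_mul, map_add, d_n, d_r, d_two, γ]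
  rw [d_comm j i W, δ_comm j i]
  linear_combination (-(r * b)) * h5 - ri * (2 * n i * n j - δ i j) * h3 + (ri * b * (2 * D.pAB i j
    + 2 * n i * D.prA j + 2 * n j * D.prA i + 2 * n i * n j * D.prr - δ i j * (D.prr + tr D.pAB))
    - 2 * b * (d i (D.prA j) + d j (D.prA i)) - 2 * (n i * d j W + n j * d i W
    + D.prA j * d i b + D.prA i * d j b) - 2 * r * d i (d j W)) * r_mul_ri

include hD hb hT in
-- The factor $r^2$ brings the tensor to degree zero, and the Lie derivative is subtracted because
-- `boostMomentum` omits the rotation.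
theorem boostMomentum_eqTan_varPAB (boost : ∀ i j, d i (d j (r * b)) = 0) :
    EqTan (fun i j => r * r * boostMomentum (sphQ D.lam D.k) (r * b)
        (T - b * D.lam - b * tr D.k) i j)
      fun i j => D.varPAB b T Y i j - SF.lieConDens Y D.pAB i j := by
  have hk := hom_k hD
  have sk := k_symm hD
  have tk := tan_k hD
  refine ((boostMomentum_eqTan (hom_lam hD) hb sk tk hk rfl boost rfl).const_mul (r * r)).trans ?_
  refine ⟨fun j => r * b * d j (tr D.k) - r * d j T, fun i => r * b * d i (tr D.k) - r * d i T
    - n i * (r * r * lap T + 3 * b * tr D.k - b * r * r * lap (tr D.k) - r * r * dot (tr D.k) b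
      - 2 * r * r * ∑ m, dv D.k m * d m b), fun i j => ?_⟩
  simp only [varPAB, Finset.sum_sub_distrib, sum_D3_lap hk sk tk, sum_D3_div hk sk tk, lapS_eq hT,
    lapS_eq (Hom.tr hk), sum_D0_mul_D0, sum_D2_mul_D0 sk hb, sum_D2_mul_D0' sk,
    sum_sum_D2_mul_D0 sk tk hb]
  simp only [SF.D1, SF.D0, d_mul, d_r, γ]
  rw [sk j i, dot_comm b]
  linear_combination (r * ri + 1) * (b * D.k i j - 3 * b * tr D.k * δ i j) * r_mul_ri

include hD hb hT hY tY in
-- `eq_dec` rebuilds the tensor from its tangential part and its contraction with `n`, with radial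
-- entry `C`. This entry still contains the trace `H` of the Hessian. By the Hamiltonian constraint
-- the full trace is $-2r^2H$ plus Lie terms, and comparing the two eliminates `H` and shows that
-- `C` is the entry `prr` of the variation.
theorem leadMomentum_eq (boost : ∀ i j, d i (d j (r * b)) = 0)
    (kil : ∀ i j, d i (r * Y j) + d j (r * Y i) = 0) (hham : leadHam D.metric = 0) (i j : Fin 3) :
    leadMomentum D.metric D.momentum (r * b) (T - b * D.lam - b * tr D.k) (fun m => r * Y m) i j =
      (D.variation b W T Y).momentum i j := by
  have hk := hom_k hD
  have sk := k_symm hD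
  have tk := tan_k hD
  have hl := hom_lam hD
  have hQ : D.metric = sphQ D.lam D.k := funext fun i => funext fun j => metric_eq D i j
  have hR : ∑ m, linRic (sphQ D.lam D.k) m m = 0 := by rw [← hQ]; exact hham
  have e0 : ∀ i j, leadMomentum D.metric D.momentum (r * b) (T - b * D.lam - b * tr D.k)
      (fun m => r * Y m) i j = boostMomentum (sphQ D.lam D.k) (r * b)
        (T - b * D.lam - b * tr D.k) i j + ri * ri * dec (SF.lieConDens Y D.pAB)
        (SF.lieVecDens Y D.prA) (SF.lieDens Y D.prr) i j := fun i j => by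
    rw [← lie_dec tY hY hD.tan_pAB hD.tan_prA, leadMomentum, hQ, hR, mul_zero, smul_zero, sub_zero,
      boostMomentum]
    simp only [momentum]
    ring
  set H := ∑ m, leadHess (sphQ D.lam D.k) (r * b) (T - b * D.lam - b * tr D.k) m m with hH
  set C : SF := SF.lieDens Y D.prr + r * r * (b * lap D.lam + dot D.lam b - H) + 3 * b * D.lam
    with hC
  have slie : ∀ i j, SF.lieConDens Y D.pAB i j = SF.lieConDens Y D.pAB j i := fun i j => by
    rw [SF.lieConDens, SF.lieConDens, hD.symm_pAB i j]
    congr 1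
    exact Finset.sum_congr rfl fun m _ => by
      rw [D2_symm hD.symm_pAB m i j, hD.symm_pAB i m, hD.symm_pAB j m]; ring
  have tlv : Tan1 (SF.lieVecDens Y D.prA) :=
    (Tan1.sum (V := fun c a => Y c * SF.D1 D.prA c a - D.prA c * SF.D1 Y c a) fun c =>
      (((tan_D1 hD.hom_prA hD.tan_prA).2 c).const_mul _).sub
        (((tan_D1 hY tY).2 c).const_mul _)).add (hD.tan_prA.const_mul _)
  have tlc : Tan2 (SF.lieConDens Y D.pAB) := Tan2.of_symm (fun c =>
    (Tan1.sum (V := fun m a => Y m * SF.D2 D.pAB m a c - D.pAB m c * SF.D1 Y m a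
      - D.pAB a m * SF.D1 Y m c) fun m =>
    (((((tan_D2 hD.hom_pAB hD.tan_pAB).2 m).1 c).const_mul _).sub
      (((tan_D1 hY tY).2 m).const_mul _)).sub ((hD.tan_pAB.1 m).mul_const _)).add
      ((hD.tan_pAB.1 c).const_mul _)) slie
  have hr2 : r * r * (ri * ri) = 1 := by linear_combination (r * ri + 1) * r_mul_ri
  have key : ∀ i j, r * r * leadMomentum D.metric D.momentum (r * b)
      (T - b * D.lam - b * tr D.k) (fun m => r * Y m) i j =
      dec (D.varPAB b T Y) (D.varPrA b T Y) C i j := by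
    refine eq_dec (fun i j => ?_) (tan_varPAB hD hb hT hY tY) (tan_varPrA hD hb hT hY tY)
      (((boostMomentum_eqTan_varPAB (Y := Y) hD hb hT boost).add ⟨SF.lieVecDens Y D.prA, fun i =>
        SF.lieVecDens Y D.prA i + SF.lieDens Y D.prr * n i, fun i j => rfl⟩).congr
        (A := fun i j => r * r * boostMomentum (sphQ D.lam D.k) (r * b)
          (T - b * D.lam - b * tr D.k) i j + (SF.lieConDens Y D.pAB i j +
          n i * SF.lieVecDens Y D.prA j + (SF.lieVecDens Y D.prA i + SF.lieDens Y D.prr * n i) * n j))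
        (fun i j => ?_) (fun i j => ?_)) (fun j => ?_)
    · have h1 : leadHess (sphQ D.lam D.k) (r * b) (T - b * D.lam - b * tr D.k) i j =
          leadHess (sphQ D.lam D.k) (r * b) (T - b * D.lam - b * tr D.k) j i := by
        rw [leadHess, leadHess, d_comm i j]
        simp only [linΓ_symm (sphQ_symm sk) _ i j]
      rw [e0, e0, boostMomentum, boostMomentum, h1, linRic_symm (sphQ_symm sk) i j, δ_comm i j,
        dec_symm slie i j]
    · simp only [e0, dec]
      linear_combination (SF.lieConDens Y D.pAB i j + n i * SF.lieVecDens Y D.prA j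
        + n j * SF.lieVecDens Y D.prA i + SF.lieDens Y D.prr * (n i * n j)) * hr2
    · ring
    · have h1 := sum_n_boostMomentum hl hb hk sk tk rfl hT rfl j
      have h2 := sum_n_dec (C := SF.lieDens Y D.prr) tlc tlv j
      have h3 : ∀ i, n i * (r * r * leadMomentum D.metric D.momentum (r * b)
          (T - b * D.lam - b * tr D.k) (fun m => r * Y m) i j) =
          r * r * (n i * boostMomentum (sphQ D.lam D.k) (r * b)
          (T - b * D.lam - b * tr D.k) i j) + n i * dec (SF.lieConDens Y D.pAB)
        (SF.lieVecDens Y D.prA) (SF.lieDens Y D.prr) j i := fun i => by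
        rw [e0, dec_symm slie i j]
        linear_combination n i * dec (SF.lieConDens Y D.pAB)
          (SF.lieVecDens Y D.prA) (SF.lieDens Y D.prr) j i * hr2
      simp only [h3, Finset.sum_add_distrib, ← Finset.mul_sum, h1, h2, varPrA, sum_D2_mul tk]
      simp only [SF.D0, hC]
      linear_combination (r * (b * dv D.k j + cd D.k b j + tr D.k * d j b - d j T)) * r_mul_ri +
        (3 * D.lam * b + b * tr D.k) * n j * hr2
  have hprr : C = (D.variation b W T Y).prr := by
    have t1 : ∑ i, dec (D.varPAB b T Y) (D.varPrA b T Y) C i i = tr (D.varPAB b T Y) + C := by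
      have a := sum_n_sq
      have c : ∑ m, n m * D.varPrA b T Y m = 0 := tan_varPrA hD hb hT hY tY
      simp only [dec, tr, Fin.sum_univ_three] at *
      linear_combination C * a + 2 * c
    have t2 : ∑ i, dec (SF.lieConDens Y D.pAB) (SF.lieVecDens Y D.prA) (SF.lieDens Y D.prr) i i =
        tr (SF.lieConDens Y D.pAB) + SF.lieDens Y D.prr := by
      have a := sum_n_sq
      have c : ∑ m, n m * SF.lieVecDens Y D.prA m = 0 := tlv
      simp only [dec, tr, Fin.sum_univ_three] at *
      linear_combination SF.lieDens Y D.prr * a + 2 * c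
    have t3 : ∑ i, boostMomentum (sphQ D.lam D.k) (r * b) (T - b * D.lam - b * tr D.k) i i =
        -(2 * H) := by
      have : ∑ i : Fin 3, δ i i * H = 3 * H := by
        simp only [δ_self, Fin.sum_univ_three]; ring
      simp only [boostMomentum, Finset.sum_sub_distrib, ← Finset.mul_sum, hR, ← hH, this]
      ring
    have t4 : tr (D.varPAB b T Y) + C = -(2 * r * r * H) + SF.lieDens Y (tr D.pAB)
        + SF.lieDens Y D.prr := by
      rw [← t1, ← tr_lieConDens hD.symm_pAB hD.tan_pAB fun i j => ?_]
      · have : ∀ i, dec (D.varPAB b T Y) (D.varPrA b T Y) C i i = r * r * boostMomentum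
            (sphQ D.lam D.k) (r * b) (T - b * D.lam - b * tr D.k) i i + dec (SF.lieConDens Y D.pAB)
            (SF.lieVecDens Y D.prA) (SF.lieDens Y D.prr) i i := fun i => by
          rw [← key, e0]
          linear_combination dec (SF.lieConDens Y D.pAB)
            (SF.lieVecDens Y D.prA) (SF.lieDens Y D.prr) i i * hr2
        simp only [this, Finset.sum_add_distrib, ← Finset.mul_sum, t2, t3]
        ring
      · have := kil i j
        simp only [d_mul, d_r] at this
        rw [SF.D1, SF.D1]
        linear_combination this
    have t5 : 2 * ((1 / 2 : ℝ) • D.varP b Y) = D.varP b Y := by algebra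
    have t6 : D.varP b Y = 2 * (SF.lieDens Y D.prr - SF.lieDens Y (tr D.pAB)) + (4 * b * (r * r *
        lap D.lam) + 4 * (r * r * dot D.lam b) + 12 * b * D.lam) := by
      rw [varP, p, lieDens_sub, lapS_eq hl, sum_D0_mul_D0, dot_comm]
    apply two_smul_inj
    rw [variation]
    simp only
    linear_combination 2 * hC - t5 - t6 - 2 * t4
  have h := key i j
  rw [hprr] at h
  rw [momentum, variation]
  rw [variation] at h
  simp only at h ⊢
  linear_combination ri * ri * h - (leadMomentum D.metric D.momentum (r * b)
      (T - b * D.lam - b * tr D.k) (fun m => r * Y m) i j) * hr2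

end LeadData

end AsympFlat
end

/-! ### Return to functions on the sphere -/

noncomputable section
namespace AsympFlat

open SF

namespace Rep

variable {u v : E → ℝ} {U V : SF}

theorem const (c : ℝ) : Rep (fun _ => c) (algebraMap ℝ SF c) :=
  ⟨Hom.const c, fun _ hx => (algebraMap_apply c hx).symm⟩

theorem ofNat (m : ℕ) [m.AtLeastTwo] : Rep (fun _ => (OfNat.ofNat m : ℝ)) (OfNat.ofNat m) :=
  (const _).lead (map_ofNat _ m)

theorem half (hu : Rep u U) : Rep (fun x => u x / 2) ((1 / 2 : ℝ) • U) :=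
  ⟨hu.1.smul _, fun x hx => by simp only [smul_apply, hu.2 x hx]; ring⟩

theorem unique (hu : Rep u U) (hv : Rep v U) {x : E} (hx : x ≠ 0) : u x = v x :=
  (hu.2 x hx).trans (hv.2 x hx).symm

theorem trS {k : Field2} {K : Ten2} (hk : ∀ a c, Rep (k a c) (K a c)) : Rep (trS k) (tr K) :=
  sum (s := Finset.univ) fun m => hk m m

theorem lapS (hu : Rep u U) : Rep (lapS u) (SF.lapS U) :=
  sum (s := Finset.univ) fun a => D1 (fun a => hu.D0 a) (tan_D0 hu.1) a a

section lie

variable {y q : VecField} {k : Field2} {Y Q : Fin 3 → SF} {K : Ten2} (hy : ∀ a, Rep (y a) (Y a))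

theorem lieFn (hy : ∀ a, Rep (y a) (Y a)) (hu : Rep u U) : Rep (lieFn y u) (SF.lieFn Y U) :=
  sum (s := Finset.univ) fun c => (hy c).mul (hu.D0 c)

variable (tY : Tan1 Y)
include hy tY

theorem divS : Rep (divS y) (SF.divS Y) := sum (s := Finset.univ) fun c => D1 hy tY c c

theorem lieDens (hu : Rep u U) : Rep (lieDens y u) (SF.lieDens Y U) :=
  (lieFn hy hu).add ((divS hy tY).mul hu)

theorem lieCov (hk : ∀ a c, Rep (k a c) (K a c)) (tK : Tan2 K) (a c : Fin 3) :
    Rep (lieCov y k a c) (SF.lieCov Y K a c) :=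
  sum (s := Finset.univ) fun m => (((hy m).mul (D2 hk tK m a c)).add
    ((hk m c).mul (D1 hy tY a m))).add ((hk a m).mul (D1 hy tY c m))

theorem lieVecDens (hq : ∀ a, Rep (q a) (Q a)) (tQ : Tan1 Q) (a : Fin 3) :
    Rep (lieVecDens y q a) (SF.lieVecDens Y Q a) :=
  (sum (s := Finset.univ) fun c => ((hy c).mul (D1 hq tQ c a)).sub ((hq c).mul (D1 hy tY c a))).add
    ((divS hy tY).mul (hq a))

theorem lieConDens (hk : ∀ a c, Rep (k a c) (K a c)) (tK : Tan2 K) (a c : Fin 3) :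
    Rep (lieConDens y k a c) (SF.lieConDens Y K a c) :=
  (sum (s := Finset.univ) fun m => (((hy m).mul (D2 hk tK m a c)).sub
    ((hk m c).mul (D1 hy tY m a))).sub ((hk a m).mul (D1 hy tY m c))).add
    ((divS hy tY).mul (hk a c))

end lie

end Rep

namespace LeadData

namespace Represents

variable {D : LeadData} {d : BoundaryData} (h : D.Represents d)
include h

theorem lam : Rep d.lam D.lam := h.hrr.half

theorem k (a c : Fin 3) : Rep (d.k a c) (D.k a c) :=
  (h.hAB a c).half.add (h.lam.mul (Rep.proj a c))

theorem p : Rep d.p D.p := (Rep.ofNat 2).mul (h.prr.sub (Rep.trS h.pAB))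

end Represents

section laws

variable {D : LeadData} {d : BoundaryData} {B W T : SF} {Y : Fin 3 → SF} {b w t : E → ℝ}
  {y : VecField} (hD : D.IsSphere) (h : D.Represents d) (hb : Rep b B) (hw : Rep w W)
  (ht : Rep t T) (hy : ∀ a, Rep (y a) (Y a)) (tY : Tan1 Y)

include h hb hy in
theorem rep_varLam : Rep (fun x => b x / 4 * d.p x + ∑ c, y c x * D0 d.lam c x)
    (D.varLam B Y) := by
  have h1 : Rep (fun x => b x / 4 * d.p x) ((1 / 2 : ℝ) • (B * (D.prr - tr D.pAB))) := by
    refine (hb.half.half.mul h.p).lead ?_ |> fun a => ⟨a.1, fun x hx => ?_⟩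
    · rw [p]; algebra
    · rw [← a.2 x hx]; ring
  exact h1.add (Rep.lieFn hy h.lam)

include hD h hb hw hy tY in
theorem rep_varK (a c : Fin 3) : Rep (fun x =>
    lieCov y d.k a c x + D1 (D0 w) a c x + w x * proj a c x
      + b x * (d.pAB a c x - proj a c x * trS d.pAB x)
      + D1 (fun e y => b y * d.prA e y) a c x + D1 (fun e y => b y * d.prA e y) c a x)
    (D.varK B W Y a c) := by
  have hbq : ∀ e, Rep (fun y => b y * d.prA e y) (B * D.prA e) := fun e => hb.mul (h.prA e)
  have tbq : Tan1 fun e => B * D.prA e := hD.tan_prA.const_mul B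
  exact (((((Rep.lieCov hy tY h.k (tan_k hD) a c).add
    (Rep.D1 (fun a => hw.D0 a) (tan_D0 hw.1) a c)).add (hw.mul (Rep.proj a c))).add
    (hb.mul ((h.pAB a c).sub ((Rep.proj a c).mul (Rep.trS h.pAB))))).add
    (Rep.D1 hbq tbq a c)).add (Rep.D1 hbq tbq c a)

include h hb hy tY in
theorem rep_varP : Rep (fun x =>
    lieDens y d.p x + (4 * b x * lapS d.lam x + 4 * ∑ c, D0 b c x * D0 d.lam c x
      + 12 * b x * d.lam x)) (D.varP B Y) :=
  (Rep.lieDens hy tY h.p).add (((((Rep.ofNat 4).mul hb).mul (Rep.lapS h.lam)).add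
    ((Rep.ofNat 4).mul (Rep.sum fun c => (hb.D0 c).mul (h.lam.D0 c)))).add
    (((Rep.ofNat 12).mul hb).mul h.lam))

include hD h hb ht hy tY in
theorem rep_varPrA (a : Fin 3) : Rep (fun x =>
    lieVecDens y d.prA a x
      + ((∑ c, D2 (fun e m y => b y * d.k e m y) c c a x) + D0 b a x * trS d.k x - D0 t a x))
    (D.varPrA B T Y a) := by
  have tk := tan_k hD
  have hbk : ∀ e m, Rep (fun y => b y * d.k e m y) (B * D.k e m) := fun e m => hb.mul (h.k e m)
  have tbk : Tan2 fun e m => B * D.k e m :=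
    ⟨fun c => (tk.1 c).const_mul B, fun a => (tk.2 a).const_mul B⟩
  exact (Rep.lieVecDens hy tY h.prA hD.tan_prA a).add (((Rep.sum fun c =>
    Rep.D2 hbk tbk c c a).add ((hb.D0 a).mul (Rep.trS h.k))).sub (ht.D0 a))

include hD h hb ht hy tY in
theorem rep_varPAB (a c : Fin 3) : Rep (fun x =>
    lieConDens y d.pAB a c x
      + (D1 (D0 t) a c x - proj a c x * lapS t x)
      + 3 * b x * (d.k a c x - proj a c x * trS d.k x)
      + b x * (proj a c x * lapS (trS d.k) x
          + ∑ m, (D3 (D2 d.k) m m a c x - D3 (D2 d.k) m a m c x - D3 (D2 d.k) m c m a x))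
      + (-(D0 b a x * D0 (trS d.k) c x) - D0 b c x * D0 (trS d.k) a x
          + proj a c x * ∑ m, D0 b m x * D0 (trS d.k) m x
          + 2 * proj a c x * ∑ m, ∑ e, D2 d.k e m e x * D0 b m x
          - ∑ m, D2 d.k a c m x * D0 b m x
          - ∑ m, D2 d.k c a m x * D0 b m x
          + ∑ m, D2 d.k m a c x * D0 b m x)) (D.varPAB B T Y a c) := by
  have tk := tan_k hD
  have hk := h.k
  have g := Rep.proj a c
  have hκ := Rep.trS hk
  have h2 : ∀ m a c, Rep (D2 d.k m a c) (SF.D2 D.k m a c) := fun m a c => Rep.D2 hk tk m a c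
  have h3 := fun m e a c => Rep.D3 h2 (tan_D2 (hom_k hD) tk) m e a c
  exact ((((Rep.lieConDens hy tY h.pAB hD.tan_pAB a c).add
    ((Rep.D1 (fun a => ht.D0 a) (tan_D0 ht.1) a c).sub (g.mul (Rep.lapS ht)))).add
    (((Rep.ofNat 3).mul hb).mul ((hk a c).sub (g.mul hκ)))).add
    (hb.mul ((g.mul (Rep.lapS hκ)).add (Rep.sum fun m =>
      ((h3 m m a c).sub (h3 m a m c)).sub (h3 m c m a))))).add
    ((((((((hb.D0 a).mul (hκ.D0 c)).neg.sub ((hb.D0 c).mul (hκ.D0 a))).add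
      (g.mul (Rep.sum fun m => (hb.D0 m).mul (hκ.D0 m)))).add
      (((Rep.ofNat 2).mul g).mul (Rep.sum fun m => Rep.sum fun e => (h2 e m e).mul (hb.D0 m)))).sub
      (Rep.sum fun m => (h2 a c m).mul (hb.D0 m))).sub
      (Rep.sum fun m => (h2 c a m).mul (hb.D0 m))).add
      (Rep.sum fun m => (h2 m a c).mul (hb.D0 m)))

include hD h hb hw ht hy tY

theorem isSphere_variation : (D.variation B W T Y).IsSphere := by
  have hL := (rep_varLam h hb hy).1
  have hK := fun a c => (rep_varK hD h hb hw hy tY a c).1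
  have hS := fun a c => (rep_varPAB hD h hb ht hy tY a c).1
  have hA : ∀ a c, Hom 0 ((D.variation B W T Y).hAB a c) := fun a c =>
    (hom_two.mul ((hK a c).sub ((hL.mul (hom_γ a c)).congr (add_zero 0)))).congr (add_zero 0)
  have sA : ∀ a c, (D.variation B W T Y).hAB a c = (D.variation B W T Y).hAB c a := fun a c => by
    simp only [variation, varK_symm hD a c, γ_comm a c]
  exact {
    hom_hrr := (hom_two.mul hL).congr (add_zero 0)
    hom_hAB := hA
    hom_prr := ((rep_varP h hb hy tY).1.smul _).add (Hom.tr hS)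
    hom_prA := fun a => (rep_varPrA hD h hb ht hy tY a).1
    hom_pAB := hS
    symm_hAB := sA
    symm_pAB := varPAB_symm hD
    tan_hAB := Tan2.of_symm (fun c => Tan1.const_mul 2 (((tan_varK hD hb.1 hw.1
      (fun a => (hy a).1) tY).1 c).sub (Tan1.const_mul _ (sum_n_γ c)))) sA
    tan_prA := tan_varPrA hD hb.1 ht.1 (fun a => (hy a).1) tY
    tan_pAB := tan_varPAB hD hb.1 ht.1 (fun a => (hy a).1) tY }

/-- The variation of the boundary data obeys the transformation laws. -/
theorem transformationLaws {d' : BoundaryData} (h' : (D.variation B W T Y).Represents d') :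
    TransformationLaws d b w t y d' where
  lam _ hx := (h'.lam.lead (lam_variation D B W T Y)).unique (rep_varLam h hb hy) hx
  k a c _ hx := ((h'.k a c).lead (k_variation D B W T Y a c)).unique
    (rep_varK hD h hb hw hy tY a c) hx
  p _ hx := (h'.p.lead (p_variation D B W T Y)).unique (rep_varP h hb hy tY) hx
  prA a _ hx := (h'.prA a).unique (rep_varPrA hD h hb ht hy tY a) hx
  pAB a c _ hx := (h'.pAB a c).unique (rep_varPAB hD h hb ht hy tY a c) hx

end laws

end LeadData

end AsympFlat
end

/-! ### Exact symmetry of the varied fields -/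

noncomputable section
namespace AsympFlat

open Filter Asymptotics Bornology Topology

/-- Jacobi's formula, by expanding the determinant and matching its cofactors with the inverse. -/
theorem pd_log_det {g : Field2} {y : E} (hd : ∀ a b, DifferentiableAt ℝ (g a b) y)
    (h0 : (Matrix.of fun k l => g k l y).det ≠ 0) (i : Fin 3) :
    pd i (fun z => Real.log (Matrix.of fun k l => g k l z).det) y =
      ∑ k, ∑ l, invMetric g k l y * pd i (g l k) y := by
  have hdet : DifferentiableAt ℝ (fun z => (Matrix.of fun k l => g k l z).det) y := by
    simp only [det_eq, Fin.sum_univ_three]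
    fun_prop
  have h1 : pd i (fun z => Real.log (Matrix.of fun k l => g k l z).det) y =
      ((Matrix.of fun k l => g k l y).det)⁻¹ *
        pd i (fun z => (Matrix.of fun k l => g k l z).det) y := by
    simp only [pd]
    rw [fderiv.log hdet h0]
    simp
  have h2 : ∀ (a b c d e f : Fin 3), pd i (fun z => g a b z * (g c d z * g e f z)) y =
      g a b y * (g c d y * pd i (g e f) y + g e f y * pd i (g c d) y)
        + (g c d y * g e f y) * pd i (g a b) y := fun a b c d e f => by
    rw [pd_mul' (hd a b) ((hd c d).fun_mul (hd e f)), pd_mul' (hd c d) (hd e f)]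
  have h3 : pd i (fun z => (Matrix.of fun k l => g k l z).det) y =
      pd i (fun z => g 0 0 z * (g 1 1 z * g 2 2 z)) y - pd i (fun z => g 0 0 z * (g 1 2 z * g 2 1 z)) y
      - pd i (fun z => g 0 1 z * (g 1 0 z * g 2 2 z)) y + pd i (fun z => g 0 1 z * (g 1 2 z * g 2 0 z)) y
      + pd i (fun z => g 0 2 z * (g 1 0 z * g 2 1 z)) y
      - pd i (fun z => g 0 2 z * (g 1 1 z * g 2 0 z)) y := by
    have e : ∀ (a b c d e f : Fin 3), DifferentiableAt ℝ (fun z => g a b z * (g c d z * g e f z)) y :=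
      fun a b c d e f => (hd a b).fun_mul ((hd c d).fun_mul (hd e f))
    rw [← pd_sub' (e 0 0 1 1 2 2) (e 0 0 1 2 2 1),
      ← pd_sub' ((e 0 0 1 1 2 2).fun_sub (e 0 0 1 2 2 1)) (e 0 1 1 0 2 2),
      ← pd_add' (((e 0 0 1 1 2 2).fun_sub (e 0 0 1 2 2 1)).fun_sub (e 0 1 1 0 2 2)) (e 0 1 1 2 2 0),
      ← pd_add' ((((e 0 0 1 1 2 2).fun_sub (e 0 0 1 2 2 1)).fun_sub (e 0 1 1 0 2 2)).fun_add (e 0 1 1 2 2 0))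
        (e 0 2 1 0 2 1),
      ← pd_sub' (((((e 0 0 1 1 2 2).fun_sub (e 0 0 1 2 2 1)).fun_sub (e 0 1 1 0 2 2)).fun_add
        (e 0 1 1 2 2 0)).fun_add (e 0 2 1 0 2 1)) (e 0 2 1 1 2 0)]
    congr 1
    funext z
    rw [Matrix.det_fin_three]
    simp only [Matrix.of_apply]
    ring
  rw [h1, h3]
  simp only [h2, invMetric_eq, Fin.sum_univ_three, show (2 : Fin 3) + 1 = 0 from rfl,
    show (1 : Fin 3) + 2 = 0 from rfl, show (2 : Fin 3) + 2 = 1 from rfl,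
    show (1 : Fin 3) + 1 = 2 from rfl, zero_add]
  ring

theorem invMetric_symm {g : Field2} {x : E} (sym : ∀ i j, g i j x = g j i x) (a b : Fin 3) :
    invMetric g a b x = invMetric g b a x := by
  have : (Matrix.of fun k l => g k l x).transpose = Matrix.of fun k l => g k l x := by
    ext a b; exact sym b a
  have h2 := congrArg (fun M : Matrix (Fin 3) (Fin 3) ℝ => M⁻¹ a b) this
  simp only [← Matrix.transpose_nonsing_inv] at h2
  exact h2.symm

theorem pd_metric_symm {g : Field2} {U : Set E} (hU : IsOpen U)
    (sym : ∀ x ∈ U, ∀ i j, g i j x = g j i x) {x : E} (hx : x ∈ U) (m a b : Fin 3) :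
    pd m (g a b) x = pd m (g b a) x :=
  pd_congr (by filter_upwards [hU.mem_nhds hx] with z hz using sym z hz a b) m

theorem christoffel_symm {g : Field2} {U : Set E} (hU : IsOpen U)
    (sym : ∀ x ∈ U, ∀ i j, g i j x = g j i x) {x : E} (hx : x ∈ U) (m a b : Fin 3) :
    christoffel g m a b x = christoffel g m b a x := by
  have hpd := fun m a b => pd_metric_symm hU sym hx m a b
  simp only [christoffel]
  congr 1
  refine Finset.sum_congr rfl fun l _ => ?_
  rw [hpd a l b, hpd b a l, hpd l a b]; ring

/-- Symmetry of the Ricci tensor. -/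
theorem ricci_symm {g : Field2} {U : Set E} (hU : IsOpen U)
    (hs : ∀ i j, ContDiffOn ℝ ∞ (g i j) U) (sym : ∀ x ∈ U, ∀ i j, g i j x = g j i x)
    (hdet : ∀ x ∈ U, (Matrix.of fun k l => g k l x).det ≠ 0) {x : E} (hx : x ∈ U) (i j : Fin 3) :
    ricci g i j x = ricci g j i x := by
  have hinv : ∀ y ∈ U, ∀ a b, invMetric g a b y = invMetric g b a y := fun y hy =>
    invMetric_symm (sym y hy)
  have hΓ : ∀ y ∈ U, ∀ m a b, christoffel g m a b y = christoffel g m b a y := fun y hy =>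
    christoffel_symm hU sym hy
  have hca : ∀ y ∈ U, ∀ a b, ContDiffAt ℝ ∞ (g a b) y := fun y hy a b =>
    (hs a b).contDiffAt (hU.mem_nhds hy)
  have hdf : ∀ y ∈ U, ∀ a b, DifferentiableAt ℝ (g a b) y := fun y hy a b =>
    (hca y hy a b).differentiableAt (by simp)
  have hdt : ∀ y ∈ U, ContDiffAt ℝ ∞ (fun z => (Matrix.of fun k l => g k l z).det) y := fun y hy => by
    have := hca y hy
    simp only [det_eq, Fin.sum_univ_three]
    fun_prop
  -- The contracted Christoffel symbol is the gradient of $\frac12\log\det g$. Its derivative, the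
  -- one derivative term of the Ricci tensor that is not visibly symmetric, is therefore symmetric.
  have htr : ∀ y ∈ U, ∀ i, ∑ k, christoffel g k i k y =
      (1 / 2) * pd i (fun z => Real.log (Matrix.of fun k l => g k l z).det) y := fun y hy i => by
    rw [pd_log_det (hdf y hy) (hdet y hy)]
    simp only [christoffel, ← Finset.mul_sum]
    congr 1
    have e : ∑ k, ∑ l, invMetric g k l y * pd k (g i l) y =
        ∑ k, ∑ l, invMetric g k l y * pd l (g i k) y := by
      rw [Finset.sum_comm]
      exact Finset.sum_congr rfl fun k _ => Finset.sum_congr rfl fun l _ => by rw [hinv y hy l k]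
    simp only [mul_sub, mul_add, Finset.sum_sub_distrib, Finset.sum_add_distrib, e]
    ring
  have hlog : ContDiffAt ℝ ∞ (fun z => Real.log (Matrix.of fun k l => g k l z).det) x :=
    (hdt x hx).log (hdet x hx)
  have hΓs : ∀ m a b, DifferentiableAt ℝ (christoffel g m a b) x := fun m a b => by
    have h1 : ∀ a b, DifferentiableAt ℝ (invMetric g a b) x := fun a b => by
      rw [show invMetric g a b = _ from funext fun z => invMetric_eq g a b z]
      have := hdf x hx
      exact (((hdt x hx).differentiableAt (by simp)).inv (hdet x hx)).mul (by fun_prop)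
    have h2 : ∀ m a b, DifferentiableAt ℝ (pd m (g a b)) x := fun m a b =>
      (contDiffAt_pd (hca x hx a b) m).differentiableAt (by simp)
    unfold christoffel
    fun_prop
  have h1 : ∀ i j, ∑ k, pd j (christoffel g k i k) x =
      (1 / 2) * pd j (pd i fun z => Real.log (Matrix.of fun k l => g k l z).det) x := fun i j => by
    have e : pd j (fun y => ∑ k, christoffel g k i k y) x = ∑ k, pd j (christoffel g k i k) x := by
      simp only [Fin.sum_univ_three]
      rw [pd_add' ((hΓs 0 i 0).fun_add (hΓs 1 i 1)) (hΓs 2 i 2), pd_add' (hΓs 0 i 0) (hΓs 1 i 1)]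
    rw [← e, pd_congr (by filter_upwards [hU.mem_nhds hx] with z hz using htr z hz i) j,
      pd_mul' (differentiableAt_const _) ((contDiffAt_pd hlog i).differentiableAt (by simp)),
      pd_const, mul_zero, add_zero]
  have h2 : ∀ k, pd k (christoffel g k i j) x = pd k (christoffel g k j i) x := fun k =>
    pd_congr (by filter_upwards [hU.mem_nhds hx] with z hz using hΓ z hz k i j) k
  simp only [ricci, Finset.sum_sub_distrib, h1, h2]
  rw [pd_comm' hlog j i]
  have h3 : ∑ k, ∑ l, christoffel g k j l x * christoffel g l i k x =
      ∑ k, ∑ l, christoffel g k i l x * christoffel g l j k x := by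
    rw [Finset.sum_comm]
    exact Finset.sum_congr rfl fun k _ => Finset.sum_congr rfl fun l _ => mul_comm _ _
  simp only [h3, fun l => hΓ x hx l i j]

theorem raise_symm {g q : Field2} {x : E} (hq : ∀ i j, q i j x = q j i x) (i j : Fin 3) :
    raise g q i j x = raise g q j i x := by
  rw [raise, raise, Finset.sum_comm]
  exact Finset.sum_congr rfl fun k _ => Finset.sum_congr rfl fun l _ => by rw [hq]; ring

theorem lower_symm {g p : Field2} {x : E} (hp : ∀ i j, p i j x = p j i x) (i j : Fin 3) :
    lower g p i j x = lower g p j i x := by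
  rw [lower, lower, Finset.sum_comm]
  exact Finset.sum_congr rfl fun k _ => Finset.sum_congr rfl fun l _ => by rw [hp]; ring

theorem lieMetric_symm {X : VecField} {g : Field2} {U : Set E} (hU : IsOpen U)
    (sym : ∀ x ∈ U, ∀ i j, g i j x = g j i x) {x : E} (hx : x ∈ U) (i j : Fin 3) :
    lieMetric X g i j x = lieMetric X g j i x :=
  Finset.sum_congr rfl fun m _ => by
    rw [pd_metric_symm hU sym hx m i j, sym x hx i m, sym x hx m j]; ring

theorem lieMomentum_symm {X : VecField} {p : Field2} {U : Set E} (hU : IsOpen U)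
    (sym : ∀ x ∈ U, ∀ i j, p i j x = p j i x) {x : E} (hx : x ∈ U) (i j : Fin 3) :
    lieMomentum X p i j x = lieMomentum X p j i x :=
  Finset.sum_congr rfl fun m _ => by
    rw [pd_congr (v := fun y => p j i y * X m y)
      (by filter_upwards [hU.mem_nhds hx] with z hz using by rw [sym z hz i j]) m,
      sym x hx m j, sym x hx m i]; ring

theorem hess_symm {g : Field2} {ξ : E → ℝ} {U : Set E} (hU : IsOpen U)
    (sym : ∀ x ∈ U, ∀ i j, g i j x = g j i x) (hξ : ContDiffOn ℝ ∞ ξ U) {x : E} (hx : x ∈ U)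
    (i j : Fin 3) : hess g ξ i j x = hess g ξ j i x := by
  simp only [hess, pd_comm' (hξ.contDiffAt (hU.mem_nhds hx)) i j,
    fun k => christoffel_symm hU sym hx k i j]

theorem exists_far {q : E → Prop} (h : ∀ᶠ x in cobounded E, q x) : ∃ ρ : ℝ, ∀ x, ρ < ‖x‖ → q x := by
  obtain ⟨ρ, -, hρ⟩ := (Metric.hasBasis_cobounded_compl_closedBall (0 : E)).eventually_iff.1 h
  exact ⟨ρ, fun x hx => hρ (by simpa using hx)⟩

/-- The variations of the fields are symmetric. -/
theorem delta_symm {g p : Field2} {ξ : E → ℝ} {X : VecField} {N F : SF} {Y Z : Fin 3 → SF}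
    {Q : Ten2} (h : DefExp ξ X N F Y Z)
    (hg : ∀ i j, Exp (fun x => g i j x - kd i j) (-1) (Q i j))
    (sg : ∀ᶠ x in cobounded E, ∀ i j, g i j x = g j i x)
    (sp : ∀ᶠ x in cobounded E, ∀ i j, p i j x = p j i x) :
    (∀ᶠ x in cobounded E, ∀ i j, deltaMetric g p ξ X i j x = deltaMetric g p ξ X j i x) ∧
      ∀ᶠ x in cobounded E, ∀ i j, deltaMomentum g p ξ X i j x = deltaMomentum g p ξ X j i x := by
  have hdet := (DefExp.metricExp_const hg).det.base.eventually_half_lt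
  have hs : ∀ᶠ x in cobounded E, ∀ i j, ContDiffAt ℝ ∞ (g i j) x := by
    have e : ∀ i j, ∀ᶠ x in cobounded E, ContDiffAt ℝ ∞ (g i j) x := fun i j => by
      filter_upwards [contDiffAt_eventually (hg i j).isSymbol.1] with x hx
      simpa using hx.add (contDiffAt_const (c := kd i j))
    simpa only [eventually_all] using e
  -- Symmetry is required of the fields themselves far out, not only of their leading terms. All
  -- hypotheses are collected on the exterior of one ball, an open set on which they may be
  -- differentiated.
  have hall := ((hs.and (contDiffAt_eventually h.xi.isSymbol.1)).and (hdet.and (sg.and sp)))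
  obtain ⟨ρ, hρ⟩ := exists_far hall
  have hU := isOpen_far ρ
  have key : ∀ x : E, ρ < ‖x‖ → (∀ i j, deltaMetric g p ξ X i j x = deltaMetric g p ξ X j i x) ∧
      ∀ i j, deltaMomentum g p ξ X i j x = deltaMomentum g p ξ X j i x := fun x hx => by
    have s1 : ∀ x ∈ {x : E | ρ < ‖x‖}, ∀ i j, g i j x = g j i x := fun x hx => (hρ _ hx).2.2.1
    have s2 : ∀ x ∈ {x : E | ρ < ‖x‖}, ∀ i j, p i j x = p j i x := fun x hx => (hρ _ hx).2.2.2
    have c1 : ContDiffOn ℝ ∞ ξ {x : E | ρ < ‖x‖} := fun x hx => (hρ _ hx).1.2.contDiffWithinAt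
    have c2 : ∀ i j, ContDiffOn ℝ ∞ (g i j) {x : E | ρ < ‖x‖} := fun i j x hx =>
      ((hρ _ hx).1.1 i j).contDiffWithinAt
    have d0 : ∀ x ∈ {x : E | ρ < ‖x‖}, (Matrix.of fun k l => g k l x).det ≠ 0 := fun x hx => by
      exact ne_of_gt (by linarith [(hρ _ hx).2.1])
    refine ⟨fun i j => ?_, fun i j => ?_⟩
    · rw [deltaMetric, deltaMetric, lower_symm (s2 x hx), s1 x hx i j, lieMetric_symm hU s1 hx]
    · have e : ∑ m, ∑ l, p i m x * g m l x * p l j x = ∑ m, ∑ l, p j m x * g m l x * p l i x := by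
        rw [Finset.sum_comm]
        exact Finset.sum_congr rfl fun m _ => Finset.sum_congr rfl fun l _ => by
          rw [s2 x hx i l, s1 x hx l m, s2 x hx m j]; ring
      rw [deltaMomentum, deltaMomentum, raise_symm (ricci_symm hU c2 s1 d0 hx),
        raise_symm (hess_symm hU s1 c1 hx), invMetric_symm (s1 x hx) i j, s2 x hx i j, e,
        lieMomentum_symm hU s2 hx]
  exact ⟨(eventually_far ρ).mono fun x hx => (key x hx).1,
    (eventually_far ρ).mono fun x hx => (key x hx).2⟩

end AsympFlat
end

/-! ### Deformations in Cartesian form -/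

noncomputable section
namespace AsympFlat

open Filter Asymptotics Bornology Topology

namespace SF

/-- The boost equation on the sphere thus says that $rb$ has zero flat Hessian. -/
theorem d_d_mul_r {u : SF} (i j : Fin 3) :
    d i (d j (r * u)) = ri * (D1 (D0 u) i j + γ i j * u) := by
  simp only [D1, D0, γ, d_mul, d_r, map_add, d_n]
  linear_combination (-(n i * d j u) - r * d i (d j u) - n j * d i u) * r_mul_ri

/-- A Killing field $Y$ of the sphere corresponds to the flat Killing field $rY$. -/
theorem d_mul_r_killing (Y : Fin 3 → SF) (i j : Fin 3) :
    d i (r * Y j) + d j (r * Y i) = D1 Y i j + D1 Y j i := by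
  simp only [D1, d_mul, d_r]; ring

end SF

/-- A surface deformation has expansions in Cartesian components. -/
theorem IsDeformation.exists_defExp {D : LeadData} {d : BoundaryData} {b f W : E → ℝ}
    {Y : VecField} {ξ : E → ℝ} {X : VecField} (hR : D.Represents d)
    (h : IsDeformation d b f W Y ξ X) :
    ∃ (B F Ws : SF) (Ys : Fin 3 → SF), Rep b B ∧ Rep f F ∧ Rep W Ws ∧ (∀ a, Rep (Y a) (Ys a)) ∧
      SF.Tan1 Ys ∧ DefExp ξ X (SF.r * B) F (fun m => SF.r * Ys m)
        (fun m => Ws * SF.n m + 2 * B * D.prA m + SF.r * SF.d m Ws) := by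
  obtain ⟨B, hB⟩ := h.b_smooth.exists_rep
  obtain ⟨F, hF⟩ := h.f_smooth.exists_rep
  obtain ⟨Ws, hW⟩ := h.W_smooth.exists_rep
  choose Ys hY using fun a => (h.Y_smooth.sphereFn a).exists_rep
  have tY : SF.Tan1 Ys := SF.ext' fun x hx => by
    rw [SF.zero_apply, SF.sum_apply, ← h.Y_smooth.tangent x hx]
    exact Finset.sum_congr rfl fun a _ => by rw [SF.mul_apply, SF.n_apply a hx, (hY a).2 x hx]
  have hI : ∀ a, Rep (mixedCorrection d b W a) (2 * B * D.prA a + SF.D0 Ws a) := fun a =>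
    (((Rep.ofNat 2).mul hB).mul (hR.prA a)).add (hW.D0 a)
  refine ⟨B, F, Ws, Ys, hB, hF, hW, hY, tY, (SF.hom_r.mul hB.1).congr (by norm_num),
    fun i => (SF.hom_r.mul (hY i).1).congr (by norm_num), fun i j => ?_, fun i j => ?_, ?_,
    fun i => ?_⟩
  · have e := (Rep.D1 (fun a => hB.D0 a) (SF.tan_D0 hB.1) i j).add ((Rep.proj i j).mul hB)
    rw [SF.d_d_mul_r, show SF.D1 (SF.D0 B) i j + SF.γ i j * B = 0 from SF.ext' fun x hx => by
      rw [SF.zero_apply, ← e.2 x hx]; exact h.boost i j x hx, mul_zero]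
  · have e := (Rep.D1 hY tY i j).add (Rep.D1 hY tY j i)
    rw [SF.d_mul_r_killing]
    exact SF.ext' fun x hx => by
      rw [SF.zero_apply, ← e.2 x hx]; exact h.killing i j x hx
  · refine ((h.normal.exp hF).lead (by rw [SF.rz_zero, one_mul])).congr ?_
    filter_upwards [eventually_far 0] with x hx
    have hx0 := norm_pos_iff.1 hx
    rw [SF.mul_apply, SF.r_apply hx0, hB.2 x hx0]
  -- `X` is rebuilt from its radial part, which contributes `W`, and its tangential part, which
  -- contributes `Y` and the mixed correction.
  · have e1 := (exp_nrm i).mul (h.radial.exp hW)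
    have e2 := exp_norm.mul ((h.angular i).exp (hI i))
    refine (((e1.cast (l := 0) (by norm_num)).add (e2.cast (by norm_num))).lead ?_).congr ?_
    · rw [SF.rz_zero, SF.rz_neg_one, SF.D0]
      linear_combination (2 * B * D.prA i + SF.r * SF.d i Ws) * SF.r_mul_ri
    · filter_upwards [eventually_far 0] with x hx
      have hx0 := norm_pos_iff.1 hx
      have e : ∑ j, proj i j x * X j x = X i x - nrm i x * ∑ j, nrm j x * X j x := by
        simp only [proj, sub_mul, Finset.sum_sub_distrib, mul_assoc, ← Finset.mul_sum]
        simp [kd]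
      rw [SF.mul_apply, SF.r_apply hx0, (hY i).2 x hx0, e]
      field_simp
      ring

/-- Fall-off, transformation laws and variation of the constraints. -/
theorem falloff_of_defExp {g p : Field2} {D : LeadData} (hD : D.IsSphere) {d : BoundaryData}
    (hR : D.Represents d)
    (hg : ∀ i j, Exp (fun x => g i j x - kd i j) (-1) (D.metric i j))
    (hp : ∀ i j, Exp (p i j) (-2) (D.momentum i j))
    (sg : ∀ᶠ x in cobounded E, ∀ i j, g i j x = g j i x)
    (sp : ∀ᶠ x in cobounded E, ∀ i j, p i j x = p j i x)
    (hcon : ConstraintFalloff (hamConstraint g p) (momConstraint g p))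
    {ξ : E → ℝ} {X : VecField} {B T W : SF} {Y : Fin 3 → SF} {b t w : E → ℝ} {y : VecField}
    (hb : Rep b B) (ht : Rep t T) (hw : Rep w W) (hy : ∀ a, Rep (y a) (Y a)) (tY : SF.Tan1 Y)
    (h : DefExp ξ X (SF.r * B) (T - B * D.lam - B * SF.tr D.k) (fun m => SF.r * Y m)
        (fun m => W * SF.n m + 2 * B * D.prA m + SF.r * SF.d m W)) :
    HasFalloff (deltaMetric g p ξ X) (deltaMomentum g p ξ X)
        (D.variation B W T Y).toBoundaryData ∧
      TransformationLaws d b w t y (D.variation B W T Y).toBoundaryData ∧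
      ConstraintFalloff (varHam g p (deltaMetric g p ξ X) (deltaMomentum g p ξ X))
        (varMom g p (deltaMetric g p ξ X) (deltaMomentum g p ξ X)) := by
  obtain ⟨hham, hdiv⟩ := (constraints_iff hg hp).1 hcon
  have hV := LeadData.isSphere_variation hD hR hb hw ht hy tY
  have e1 : ∀ i j, leadMetric D.metric D.momentum (SF.r * B) (fun m => SF.r * Y m)
      (fun m => W * SF.n m + 2 * B * D.prA m + SF.r * SF.d m W) i j =
      (D.variation B W T Y).metric i j := fun i j => by
    rw [LeadData.leadMetric_eq hD tY h.killing, LeadData.metric_eq, LeadData.lam_variation,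
      show (D.variation B W T Y).k = D.varK B W Y from funext fun a => funext fun c =>
        LeadData.k_variation D B W T Y a c]
  have e2 := LeadData.leadMomentum_eq (W := W) hD hb.1 ht.1 (fun a => (hy a).1) tY h.boost
    h.killing hham
  have d1 := h.deltaMetric hg hp
  have d2 := h.deltaMomentum hg hp
  obtain ⟨s1, s2⟩ := delta_symm h hg sg sp
  refine ⟨hasFalloff_of_exp hV (fun i j => (d1 i j).lead (e1 i j))
    (fun i j => (d2 i j).lead (e2 i j)) s1 s2,
    LeadData.transformationLaws hD hR hb hw ht hy tY (LeadData.represents_toBoundaryData hV),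
    (varConstraints_iff hg hp d1 d2).2 ⟨?_, fun i => ?_⟩⟩
  · exact leadHam_leadMetric h.boost h.killing (LeadData.metric_symm hD)
      (LeadData.momentum_symm hD) hham hdiv
  · exact leadDiv_leadMomentum h.boost h.killing (LeadData.metric_symm hD) hham hdiv i

end AsympFlat
end

/-! ### Parity under the antipodal map -/

noncomputable section
namespace AsympFlat

open Filter Asymptotics Bornology Topology

namespace SF

theorem contDiffOn_comp_neg (u : SF) : ContDiffOn ℝ ∞ (fun x => u (-x)) {x | x ≠ 0} :=
  u.smooth.comp contDiff_neg.contDiffOn fun _ hx => neg_ne_zero.2 hx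

/-- The pullback along the antipodal map. -/
def σ : SF →ₐ[ℝ] SF :=
  AlgHom.ofLinearMap
    { toFun := fun u => of (fun x => u (-x)) (contDiffOn_comp_neg u)
      map_add' := fun u v => ext' fun x hx => by
        simp only [add_apply, of_apply _ hx]
      map_smul' := fun c u => ext' fun x hx => by
        simp only [smul_apply, of_apply _ hx, RingHom.id_apply] }
    (ext' fun x hx => by
      simp only [LinearMap.coe_mk, AddHom.coe_mk, of_apply _ hx, one_apply hx,
        one_apply (neg_ne_zero.2 hx)])
    fun u v => ext' fun x hx => by
      simp only [LinearMap.coe_mk, AddHom.coe_mk, mul_apply, of_apply _ hx]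

theorem σ_apply (u : SF) {x : E} (hx : x ≠ 0) : σ u x = u (-x) :=
  of_apply (contDiffOn_comp_neg u) hx

theorem σ_σ (u : SF) : σ (σ u) = u := ext' fun x hx => by
  rw [σ_apply _ hx, σ_apply _ (neg_ne_zero.2 hx), neg_neg]

theorem σ_d (i : Fin 3) (u : SF) : σ (d i u) = -d i (σ u) := ext' fun x hx => by
  rw [neg_apply, σ_apply _ hx, d_apply i _ hx, d_apply i _ (neg_ne_zero.2 hx),
    pd_congr (eventuallyEq_of (fun y hy => σ_apply u hy) hx)]
  have h := (u.differentiableAt (neg_ne_zero.2 hx)).hasFDerivAt.comp x ((hasFDerivAt_id x).neg)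
  simp only [pd]
  rw [show fderiv ℝ (fun y => u (-y)) x = _ from h.fderiv]
  simp

/-- Functions of parity `ε = ± 1`. -/
def Par (ε : ℝ) (u : SF) : Prop := σ u = ε • u

theorem par_n (i : Fin 3) : Par (-1) (n i) := ext' fun x hx => by
  rw [σ_apply _ hx, smul_apply, n_apply i hx, n_apply i (neg_ne_zero.2 hx)]
  simp [nrm, neg_div]

theorem par_r : Par 1 r := ext' fun x hx => by
  rw [σ_apply _ hx, smul_apply, r_apply hx, r_apply (neg_ne_zero.2 hx), norm_neg, one_mul]

theorem par_ofNat (m : ℕ) [m.AtLeastTwo] : Par 1 (OfNat.ofNat m : SF) := by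
  rw [Par, map_ofNat, one_smul]

namespace Par

variable {ε ε' : ℝ} {u v : SF}

theorem cast (h : Par ε u) (e : ε = ε') : Par ε' u := e ▸ h

theorem add (h : Par ε u) (h' : Par ε v) : Par ε (u + v) := by
  rw [Par, map_add, h, h', smul_add]

theorem neg (h : Par ε u) : Par ε (-u) := by rw [Par, map_neg, h, smul_neg]

theorem sub (h : Par ε u) (h' : Par ε v) : Par ε (u - v) := by
  rw [Par, map_sub, h, h', smul_sub]

theorem mul (h : Par ε u) (h' : Par ε' v) : Par (ε * ε') (u * v) := by
  rw [Par, map_mul, h, h', smul_mul_smul_comm]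

theorem smul (c : ℝ) (h : Par ε u) : Par ε (c • u) := by rw [Par, map_smul, h, smul_comm]

theorem sum {ι : Type*} {s : Finset ι} {u : ι → SF} (h : ∀ i, Par ε (u i)) :
    Par ε (∑ i ∈ s, u i) := by
  rw [Par, map_sum, Finset.smul_sum]
  exact Finset.sum_congr rfl fun i _ => h i

theorem d (h : Par ε u) (i : Fin 3) : Par (-ε) (d i u) := by
  rw [Par, σ_d, h, Derivation.map_smul, neg_smul]

theorem D0 (h : Par ε u) (a : Fin 3) : Par (-ε) (D0 u a) := (par_r.mul (h.d a)).cast (by ring)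

variable {V Y : Fin 3 → SF} {k : Ten2} {t : Fin 3 → Ten2}

theorem D1 (h : ∀ a, Par ε (V a)) (c a : Fin 3) : Par (-ε) (D1 V c a) :=
  ((h a).D0 c).add (((par_n a).mul (h c)).cast (by ring))

theorem D2 (h : ∀ a b, Par ε (k a b)) (c a b : Fin 3) : Par (-ε) (D2 k c a b) :=
  (((h a b).D0 c).add (((par_n a).mul (h c b)).cast (by ring))).add
    (((par_n b).mul (h a c)).cast (by ring))

theorem D3 (h : ∀ c a b, Par ε (t c a b)) (m c a b : Fin 3) : Par (-ε) (D3 t m c a b) :=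
  ((((h c a b).D0 m).add (((par_n c).mul (h m a b)).cast (by ring))).add
    (((par_n a).mul (h c m b)).cast (by ring))).add (((par_n b).mul (h c a m)).cast (by ring))

theorem γ (i j : Fin 3) : Par 1 (γ i j) :=
  Par.sub (by rw [Par, one_smul]; exact σ.commutes _) (((par_n i).mul (par_n j)).cast (by norm_num))

theorem tr (h : ∀ a b, Par ε (k a b)) : Par ε (tr k) := sum fun m => h m m

theorem lapS (h : Par ε u) : Par ε (lapS u) :=
  sum fun a => (D1 (fun a => h.D0 a) a a).cast (neg_neg ε)

section lie

variable (hY : ∀ a, Par (-1) (Y a))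
include hY

theorem divS : Par 1 (divS Y) := sum fun c => (D1 hY c c).cast (neg_neg 1)

theorem lieFn (h : Par ε u) : Par ε (lieFn Y u) :=
  sum fun c => ((hY c).mul (h.D0 c)).cast (by ring)

theorem lieDens (h : Par ε u) : Par ε (lieDens Y u) :=
  (lieFn hY h).add (((divS hY).mul h).cast (one_mul ε))

theorem lieCov (h : ∀ a b, Par ε (k a b)) (a c : Fin 3) : Par ε (lieCov Y k a c) :=
  sum fun m => ((((hY m).mul (D2 h m a c)).cast (by ring)).add
    (((h m c).mul (D1 hY a m)).cast (by ring))).add (((h a m).mul (D1 hY c m)).cast (by ring))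

theorem lieVecDens (h : ∀ a, Par ε (V a)) (a : Fin 3) : Par ε (lieVecDens Y V a) :=
  (sum fun c => (((hY c).mul (D1 h c a)).cast (by ring)).sub
    (((h c).mul (D1 hY c a)).cast (by ring))).add (((divS hY).mul (h a)).cast (one_mul ε))

theorem lieConDens (h : ∀ a b, Par ε (k a b)) (a c : Fin 3) : Par ε (lieConDens Y k a c) :=
  (sum fun m => ((((hY m).mul (D2 h m a c)).cast (by ring)).sub
    (((h m c).mul (D1 hY m a)).cast (by ring))).sub (((h a m).mul (D1 hY m c)).cast (by ring))).add
    (((divS hY).mul (h a c)).cast (one_mul ε))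

end lie

theorem eq_zero_of_even_of_odd (h : Par 1 u) (h' : Par (-1) u) : u = 0 := by
  have e : u = -u := by rw [Par, one_smul] at h; rw [Par, h, neg_smul, one_smul] at h'; exact h'
  exact two_smul_inj (by rw [mul_zero, two_mul]; nth_rewrite 1 [e]; ring)

end Par

/-- Functions with vanishing gradient are even. -/
theorem par_one_of_d_eq_zero {u : SF} (h : ∀ i, d i u = 0) : Par 1 u := ext' fun x hx => by
  rw [smul_apply, one_mul, σ_apply _ hx]
  -- In three dimensions the punctured space is connected, so a zero gradient forces a constant.
  have hc : IsPreconnected {x : E | x ≠ 0} := by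
    refine (isConnected_compl_singleton_of_one_lt_rank ?_ (0 : E)).isPreconnected
    rw [← Module.finrank_eq_rank]
    simp
  refine isOpen_punctured.is_const_of_fderiv_eq_zero hc
    (fun y hy => (u.differentiableAt hy).differentiableWithinAt) (fun y hy => ?_)
    (neg_ne_zero.2 hx) hx
  refine ContinuousLinearMap.coe_injective <|
    (EuclideanSpace.basisFun (Fin 3) ℝ).toBasis.ext fun i => ?_
  have := congrArg (fun v : SF => v y) (h i)
  simp only [d_apply i u hy, zero_apply, pd] at this
  simpa using this

/-- Homogeneous functions of degree one with vanishing Hessian are odd. -/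
theorem par_of_d_d_eq_zero {u : SF} (hu : Hom 0 u) (h : ∀ i j, d i (d j (r * u)) = 0) :
    Par (-1) u := by
  have hN : Hom 1 (r * u) := (hom_r.mul hu).congr (by norm_num)
  -- Euler's relation gives $ru=\sum_jX_j\,\partial_j(ru)$, where the factors $\partial_j(ru)$ have
  -- zero gradient and so are even.
  have e := hN.euler
  rw [Int.cast_one, one_smul] at e
  have h1 : Par (-1) (r * u) := by
    rw [← e]
    refine Par.sum fun j => ((par_r.mul (par_n j)).cast (one_mul _) |>.mul
      (par_one_of_d_eq_zero fun i => h i j)).cast (mul_one _) |> fun a => ?_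
    rwa [X_eq]
  have h2 : σ r * σ u = r * (-1 : ℝ) • u := by rw [← map_mul, h1, mul_smul_comm]
  rw [show σ r = r by simpa [Par] using par_r] at h2
  have h3 := congrArg (ri * ·) h2
  simp only [← mul_assoc, mul_comm ri r, r_mul_ri, one_mul] at h3
  exact h3

/-- The deformations `W` that preserve the parity of `k`. -/
theorem par_of_par_hessian {u : SF} (hu : Hom 0 u)
    (h : ∀ i j, Par (-1) (D1 (D0 u) i j + u * γ i j)) : Par (-1) u := by
  have hσ : Hom 0 (σ u) := fun t x ht hx => by
    rw [σ_apply _ hx, σ_apply _ (smul_ne_zero ht.ne' hx), ← smul_neg,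
      hu t (-x) ht (neg_ne_zero.2 hx)]
  -- Twice the even part of `u` solves the boost equation, so it is odd as well, and hence zero.
  have key : Par (-1) (u + σ u) := by
    refine par_of_d_d_eq_zero (hu.add hσ) fun i j => ?_
    have h1 := h i j
    simp only [Par, D1, D0, map_add, map_mul, σ_d,
      show σ r = r by simpa [Par] using par_r,
      show σ (n j) = -n j by simpa [Par] using par_n j,
      show σ (γ i j) = γ i j by simpa [Par] using Par.γ i j, neg_smul, one_smul] at h1
    rw [d_d_mul_r]
    simp only [D1, D0, map_add, d_mul, d_r] at h1 ⊢
    linear_combination ri * h1 + ri * r * r * (d i).map_neg (d j (σ u))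
  have h0 : u + σ u = 0 := Par.eq_zero_of_even_of_odd
    (by rw [Par, map_add, σ_σ, one_smul, add_comm]) key
  rw [Par, neg_smul, one_smul]
  linear_combination h0

/-- The deformations `T` that preserve the parity of the mixed momentum. -/
theorem par_of_par_gradient {u : SF} (h : ∀ i, Par (-1) (D0 u i)) : Par 1 u := by
  -- Twice the odd part of `u` has zero gradient, so it is even as well, and hence zero.
  have key : Par 1 (u - σ u) := par_one_of_d_eq_zero fun i => by
    have h1 := h i
    simp only [Par, D0, map_mul, σ_d, show σ r = r by simpa [Par] using par_r, neg_smul,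
      one_smul] at h1
    rw [map_sub]
    have : r * (d i u - d i (σ u)) = 0 := by linear_combination h1
    linear_combination ri * this - (d i u - d i (σ u)) * r_mul_ri
  have h0 : u - σ u = 0 := Par.eq_zero_of_even_of_odd key
    (by rw [Par, map_sub, σ_σ, neg_smul, one_smul, neg_sub])
  rw [Par, one_smul]
  linear_combination -h0

end SF

namespace Rep

variable {u : E → ℝ} {U : SF}

theorem isEven_iff (h : Rep u U) : IsEven u ↔ SF.Par 1 U := by
  rw [SF.Par, one_smul]
  refine ⟨fun e => SF.ext' fun x hx => ?_, fun e x hx => ?_⟩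
  · rw [SF.σ_apply _ hx, ← h.2 _ (neg_ne_zero.2 hx), ← h.2 x hx, e x hx]
  · rw [h.2 _ (neg_ne_zero.2 hx), h.2 x hx, ← SF.σ_apply _ hx, e]

theorem isOdd_iff (h : Rep u U) : IsOdd u ↔ SF.Par (-1) U := by
  rw [SF.Par, neg_smul, one_smul]
  refine ⟨fun e => SF.ext' fun x hx => ?_, fun e x hx => ?_⟩
  · rw [SF.σ_apply _ hx, SF.neg_apply, ← h.2 _ (neg_ne_zero.2 hx), ← h.2 x hx, e x hx]
  · rw [h.2 _ (neg_ne_zero.2 hx), h.2 x hx, ← SF.neg_apply, ← SF.σ_apply _ hx, e]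

end Rep

namespace LeadData

/-- The parity conditions. -/
structure HasParity (D : LeadData) : Prop where
  lam : SF.Par 1 D.lam
  pAB : ∀ a b, SF.Par 1 (D.pAB a b)
  p : SF.Par (-1) D.p
  k : ∀ a b, SF.Par (-1) (D.k a b)
  prA : ∀ a, SF.Par (-1) (D.prA a)

theorem Represents.newParity_iff {D : LeadData} {d : BoundaryData} (h : D.Represents d) :
    NewParity d ↔ D.HasParity :=
  ⟨fun e => ⟨h.lam.isEven_iff.1 e.lam, fun a b => (h.pAB a b).isEven_iff.1 (e.pAB a b),
    h.p.isOdd_iff.1 e.p, fun a b => (h.k a b).isOdd_iff.1 (e.k a b),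
    fun a => (h.prA a).isOdd_iff.1 (e.prA a)⟩,
  fun e => ⟨h.lam.isEven_iff.2 e.lam, fun a b => (h.pAB a b).isEven_iff.2 (e.pAB a b),
    h.p.isOdd_iff.2 e.p, fun a b => (h.k a b).isOdd_iff.2 (e.k a b),
    fun a => (h.prA a).isOdd_iff.2 (e.prA a)⟩⟩

/-- Parity of the variation of the boundary data. -/
theorem HasParity.variation_iff {D : LeadData} (h : D.HasParity) {b W T : SF} {Y : Fin 3 → SF}
    (hb : SF.Par (-1) b) (hY : ∀ a, SF.Par (-1) (Y a)) (hW : SF.Hom 0 W) :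
    (D.variation b W T Y).HasParity ↔ SF.Par 1 T ∧ SF.Par (-1) W := by
  have ten : ∀ {u : SF}, SF.Par (-1) u → SF.Par 1 (b * u) := fun hu => (hb.mul hu).cast (by norm_num)
  have hbq := fun a => ten (h.prA a)
  have hbk := fun a c => ten (h.k a c)
  -- Apart from the Hessian expression in `W`, the variation of `k` is odd: `b` and `Y` are odd and
  -- each covariant derivative flips parity.
  have eK : ∀ a c, SF.Par (-1) (D.varK b W Y a c - (SF.D1 (SF.D0 W) a c + W * SF.γ a c)) :=
    fun a c => by
      have := (((SF.Par.lieCov hY h.k a c).add ((hb.mul ((h.pAB a c).sub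
        (((SF.Par.γ a c).mul (SF.Par.tr h.pAB)).cast (mul_one 1)))).cast (mul_one _))).add
        (SF.Par.D1 hbq a c)).add (SF.Par.D1 hbq c a)
      convert this using 1
      rw [varK]; ring
  -- Likewise only the gradient of `T` can spoil the parity of the mixed momentum.
  have eP : ∀ a, SF.Par (-1) (D.varPrA b T Y a + SF.D0 T a) := fun a => by
    have := (SF.Par.lieVecDens hY h.prA a).add ((SF.Par.sum (s := Finset.univ) fun c => SF.Par.D2 hbk c c a).add
      (((hb.D0 a).mul (SF.Par.tr h.k)).cast (by norm_num)))
    convert this using 1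
    rw [varPrA]; ring
  constructor
  · intro e
    -- Necessity uses the mixed momentum alone for `T` and `k` alone for `W`.
    refine ⟨SF.par_of_par_gradient fun i => ?_, SF.par_of_par_hessian hW fun i j => ?_⟩
    · have := (eP i).sub (e.prA i)
      rwa [variation, add_sub_cancel_left] at this
    · have := (e.k i j).sub (eK i j)
      rwa [k_variation, sub_sub_cancel] at this
  · rintro ⟨hT, hW⟩
    have hκ := SF.Par.tr h.k
    have hD2 := SF.Par.D2 h.k
    have hD3 := SF.Par.D3 hD2
    have hpp : SF.Par (-1) (D.prr - SF.tr D.pAB) := by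
      have := h.p.smul (1 / 2)
      rwa [show (1 / 2 : ℝ) • D.p = D.prr - SF.tr D.pAB by rw [LeadData.p]; algebra] at this
    have mul1 : ∀ {u v : SF}, SF.Par 1 u → SF.Par 1 v → SF.Par 1 (u * v) := fun hu hv =>
      (hu.mul hv).cast (mul_one 1)
    have even : ∀ {u : SF}, SF.Par (-(-1)) u → SF.Par 1 u := fun hu => hu.cast (neg_neg 1)
    have hb0 := fun a => even (hb.D0 a)
    have hκ0 := fun a => even (hκ.D0 a)
    have h2 := fun a c e => even (hD2 a c e)
    refine ⟨?_, fun a c => ?_, ?_, fun a c => ?_, fun a => ?_⟩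
    · rw [lam_variation]
      exact ((ten hpp).smul _).add (SF.Par.lieFn hY h.lam)
    · refine ((((SF.Par.lieConDens hY h.pAB a c).add ?_).add ?_).add ?_).add ?_
      · exact (even (SF.Par.D1 (fun a => hT.D0 a) a c)).sub (mul1 (SF.Par.γ a c) (SF.Par.lapS hT))
      · rw [mul_assoc]
        exact mul1 (SF.par_ofNat 3) (ten ((h.k a c).sub (((SF.Par.γ a c).mul hκ).cast (one_mul _))))
      · exact ten ((((SF.Par.γ a c).mul (SF.Par.lapS hκ)).cast (one_mul _)).add (SF.Par.sum fun m =>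
          (((hD3 m m a c).sub (hD3 m a m c)).sub (hD3 m c m a)).cast (by norm_num)))
      · exact ((((((mul1 (hb0 a) (hκ0 c)).neg.sub (mul1 (hb0 c) (hκ0 a))).add
          (mul1 (SF.Par.γ a c) (SF.Par.sum fun m => mul1 (hb0 m) (hκ0 m)))).add
          (mul1 (mul1 (SF.par_ofNat 2) (SF.Par.γ a c)) (SF.Par.sum fun m => SF.Par.sum fun e =>
            mul1 (h2 e m e) (hb0 m)))).sub (SF.Par.sum fun m => mul1 (h2 a c m) (hb0 m))).sub
          (SF.Par.sum fun m => mul1 (h2 c a m) (hb0 m))).add (SF.Par.sum fun m => mul1 (h2 m a c) (hb0 m))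
    · rw [p_variation]
      refine (SF.Par.lieDens hY h.p).add ((SF.Par.add ?_ ?_).add ?_)
      · exact (((SF.par_ofNat 4).mul hb).mul (SF.Par.lapS h.lam)).cast (by norm_num)
      · exact ((SF.par_ofNat 4).mul (SF.Par.sum fun c => ((hb.D0 c).mul (h.lam.D0 c)))).cast (by norm_num)
      · exact (((SF.par_ofNat 12).mul hb).mul h.lam).cast (by norm_num)
    · rw [k_variation]
      have := (eK a c).add ((SF.Par.D1 (fun a => hW.D0 a) a c).cast (ε' := -1) (by norm_num) |>.add
        ((hW.mul (SF.Par.γ a c)).cast (mul_one _)))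
      rwa [sub_add_cancel] at this
    · have := (eP a).sub (hT.D0 a)
      rwa [add_sub_cancel_right] at this

end LeadData

end AsympFlat
end

/-! ### Uniqueness of the leading coefficients and the deformation theorem -/

noncomputable section
namespace AsympFlat

open Filter Asymptotics Bornology Topology

/-- Preservation only asserts that some boundary data exist; uniqueness of leading terms identifies
them with the computed variation. -/
theorem HasExpansion.rep_unique {F u v : E → ℝ} {k : ℤ} {U : SF} (h : HasExpansion F k u)
    (h' : HasExpansion F k v) (hU : Rep u U) (hv : IsSphereFn v) : Rep v U := by
  obtain ⟨V, hV⟩ := hv.exists_rep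
  have e := congrArg (SF.rz (-k) * ·) ((h.exp hU).unique (h'.exp hV))
  simp only [← mul_assoc, SF.rz_mul, neg_add_cancel, SF.rz_zero, one_mul] at e
  exact hV.lead e.symm

/-- The leading coefficients are unique. -/
theorem HasFalloff.represents_unique {q p : Field2} {d d' : BoundaryData} {D : LeadData}
    (h : HasFalloff q p d) (h' : HasFalloff q p d') (hD : D.Represents d) : D.Represents d' where
  hrr := h.rr.rep_unique h'.rr hD.hrr h'.smooth.hrr
  hAB a b := (h.AB a b).rep_unique (h'.AB a b) (hD.hAB a b) (h'.smooth.hAB.sphereFn a b)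
  prr := h.prr.rep_unique h'.prr hD.prr h'.smooth.prr
  prA a := (h.prA a).rep_unique (h'.prA a) (hD.prA a) (h'.smooth.prA.sphereFn a)
  pAB a b := (h.pAB a b).rep_unique (h'.pAB a b) (hD.pAB a b) (h'.smooth.pAB.sphereFn a b)

/-- Preservation of the boundary conditions under surface deformations and the transformation
laws of the leading coefficients. -/
theorem NewBoundaryConditions.deformation {g p : Field2} {d : BoundaryData}
    (hbc : NewBoundaryConditions g p d) {b f W : E → ℝ} {Y : VecField} {ξ : E → ℝ} {X : VecField}
    (h : IsDeformation d b f W Y ξ X) :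
    (PreservesNewBoundaryConditions g p ξ X ↔
      (∃ T : E → ℝ, IsSphereFn T ∧ IsEven T ∧
        ∀ x : E, x ≠ 0 → f x = -(b x * d.lam x) - b x * trS d.k x + T x) ∧ IsOdd W) ∧
    (∀ T : E → ℝ, IsSphereFn T →
      (∀ x : E, x ≠ 0 → f x = -(b x * d.lam x) - b x * trS d.k x + T x) →
      ∃ d' : BoundaryData,
        HasFalloff (deltaMetric g p ξ X) (deltaMomentum g p ξ X) d' ∧
        TransformationLaws d b W T Y d' ∧
        (IsEven T → IsOdd W → NewParity d')) := by
  obtain ⟨D, hD, hR, hg, hp⟩ := hbc.falloff.exists_lead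
  obtain ⟨B, F, Ws, Ys, hB, hF, hW, hY, tY, hdef⟩ := h.exists_defExp hR
  have sg : ∀ᶠ x in cobounded E, ∀ i j, g i j x = g j i x := by
    filter_upwards [hbc.falloff.symm_metric] with x hx i j
    have := hx i j
    rwa [show kd j i = kd i j by simp [kd, eq_comm], sub_left_inj] at this
  -- Both $rb$ and the components of $rY$ have zero Hessian, so `b` and `Y` are odd.
  have pB := SF.par_of_d_d_eq_zero hB.1 hdef.boost
  have pY : ∀ a, SF.Par (-1) (Ys a) := fun a =>
    SF.par_of_d_d_eq_zero (hY a).1 fun i j => killing_second hdef.killing i j a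
  have hT0 : Rep (fun x => f x + b x * d.lam x + b x * trS d.k x)
      (F + B * D.lam + B * SF.tr D.k) :=
    (hF.add (hB.mul hR.lam)).add (hB.mul (Rep.trS hR.k))
  have eF : F = F + B * D.lam + B * SF.tr D.k - B * D.lam - B * SF.tr D.k := by ring
  -- `f` determines `T₀`, which is therefore the only candidate for `T`; `rep` transfers the results
  -- to any `T` satisfying the relation.
  generalize F + B * D.lam + B * SF.tr D.k = T₀ at hT0 eF
  rw [eF] at hdef
  have rep : ∀ T : E → ℝ, (∀ x : E, x ≠ 0 → f x = -(b x * d.lam x) - b x * trS d.k x + T x) →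
      Rep T T₀ := fun T hf => ⟨hT0.1, fun x hx => by rw [← hT0.2 x hx]; simp only [hf x hx]; ring⟩
  have main := fun T (hT : Rep T T₀) =>
    falloff_of_defExp hD hR hg hp sg hbc.falloff.symm_momentum hbc.constraints hB hT hW hY tY hdef
  have hV := LeadData.isSphere_variation hD hR hB hW hT0 hY tY
  have hVR := LeadData.represents_toBoundaryData hV
  have par := (hR.newParity_iff.1 hbc.parity).variation_iff (T := T₀) pB pY hW.1
  refine ⟨⟨?_, ?_⟩, fun T _ hf => ?_⟩
  · rintro ⟨⟨d', hd', np⟩, -⟩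
    have hVd' := (main _ hT0).1.represents_unique hd' hVR
    obtain ⟨p1, p2⟩ := par.1 (hVd'.newParity_iff.1 np)
    have hT := Rep.coe _ hT0.1
    exact ⟨⟨T₀, Rep.isSphereFn _ hT0.1, hT.isEven_iff.2 p1, fun x hx => by
      rw [← hT0.2 x hx]; ring⟩, hW.isOdd_iff.2 p2⟩
  · rintro ⟨⟨T, -, eT, hf⟩, oW⟩
    have hT := rep T hf
    obtain ⟨m1, -, m3⟩ := main T hT
    exact ⟨⟨_, m1, hVR.newParity_iff.2 (par.2 ⟨hT.isEven_iff.1 eT, hW.isOdd_iff.1 oW⟩)⟩, m3⟩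
  · have hT := rep T hf
    obtain ⟨m1, m2, -⟩ := main T hT
    exact ⟨_, m1, m2, fun eT oW =>
      hVR.newParity_iff.2 (par.2 ⟨hT.isEven_iff.1 eT, hW.isOdd_iff.1 oW⟩)⟩

end AsympFlat
end

/-! ### The Schwarzschild and Kerr data -/

noncomputable section
namespace AsympFlat

open Filter Asymptotics Bornology Topology

namespace Exp

variable {F G : E → ℝ} {u v : SF}

theorem of_sub_one (hF : Exp (fun x => F x - 1) (-1) u) : Exp F 0 1 :=
  ((hF.weaken (l := 0) (by norm_num)).add one).lead (zero_add 1) |>.congr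
    (Eventually.of_forall fun x => by ring)

/-- Corrections of order -1 add under products, and by `inv_sub_one` change sign under inversion;
their own products have order -2. -/
theorem mul_sub_one (hF : Exp (fun x => F x - 1) (-1) u) (hG : Exp (fun x => G x - 1) (-1) v) :
    Exp (fun x => F x * G x - 1) (-1) (u + v) :=
  (((hF.mul hG.of_sub_one).cast (l := -1) (by norm_num)).add hG).lead (by rw [mul_one]) |>.congr
    (Eventually.of_forall fun x => by ring)

theorem inv_sub_one (hF : Exp (fun x => F x - 1) (-1) u) :
    Exp (fun x => (F x)⁻¹ - 1) (-1) (-u) :=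
  ((hF.mul hF.of_sub_one.inv).cast (l := -1) (by norm_num)).neg.lead (by rw [mul_one]) |>.congr <| by
    filter_upwards [hF.of_sub_one.eventually_half_lt] with x hx
    have : F x ≠ 0 := by linarith
    field_simp
    ring

end Exp

/-- Leading coefficients of the Schwarzschild metric. -/
def schwarzschildLead (m : ℝ) : LeadData where
  -- With $R=r-m$ one has $(1-2m/R)^{-1}=1+2m/r+\dots$ and $R^2=r^2-2mr+\dots$. The two
  -- contributions $-m\gamma$ and $\lambda\gamma=m\gamma$ to `k` then cancel, which is the purpose
  -- of the shift.
  hrr := algebraMap ℝ SF (2 * m)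
  hAB a b := (-(2 * m)) • SF.γ a b
  prr := 0
  prA _ := 0
  pAB _ _ := 0

section schwarzschildLead

variable (m : ℝ)

theorem tan_γ : SF.Tan2 SF.γ := SF.Tan2.of_symm SF.sum_n_γ SF.γ_comm

theorem isSphere_schwarzschildLead : (schwarzschildLead m).IsSphere where
  hom_hrr := SF.Hom.const _
  hom_hAB a b := (SF.hom_γ a b).smul _
  hom_prr := SF.Hom.zero 0
  hom_prA _ := SF.Hom.zero 0
  hom_pAB _ _ := SF.Hom.zero 0
  symm_hAB a b := by simp only [schwarzschildLead, SF.γ_comm a b]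
  symm_pAB _ _ := rfl
  tan_hAB := ⟨fun b => (tan_γ.1 b).smul _, fun a => (tan_γ.2 a).smul _⟩
  tan_prA := by simp [SF.Tan1, schwarzschildLead]
  tan_pAB := by simp [SF.Tan2, SF.Tan1, schwarzschildLead]

theorem schwarzschildLead_lam : (schwarzschildLead m).lam = algebraMap ℝ SF m := by
  rw [LeadData.lam, schwarzschildLead]
  algebra

theorem schwarzschildLead_k (a c : Fin 3) : (schwarzschildLead m).k a c = 0 := by
  rw [LeadData.k, schwarzschildLead_lam, schwarzschildLead]
  algebra

theorem schwarzschildLead_momentum (i j : Fin 3) : (schwarzschildLead m).momentum i j = 0 := by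
  simp [LeadData.momentum, schwarzschildLead, SF.dec]

theorem schwarzschildLead_hasParity : (schwarzschildLead m).HasParity where
  lam := by rw [schwarzschildLead_lam, SF.Par, one_smul]; exact SF.σ.commutes m
  pAB _ _ := by simp [SF.Par, schwarzschildLead]
  p := by simp [SF.Par, LeadData.p, schwarzschildLead, SF.tr]
  k a c := by simp [SF.Par, schwarzschildLead_k]
  prA _ := by simp [SF.Par, schwarzschildLead]

/-- With `k` zero and `lam` constant, the divergence of the metric is $6m\,n/r^2$, which is itself
divergence-free, and the trace $-2m/r$ is harmonic. -/
theorem leadHam_schwarzschildLead : leadHam (schwarzschildLead m).metric = 0 := by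
  have hk : (schwarzschildLead m).k = fun _ _ => 0 := funext fun a => funext fun c =>
    schwarzschildLead_k m a c
  have hQ : (schwarzschildLead m).metric = SF.sphQ (algebraMap ℝ SF m) fun _ _ => 0 :=
    funext fun i => funext fun j => by rw [LeadData.metric_eq, schwarzschildLead_lam, hk]
  have t0 : SF.Tan2 fun _ _ => 0 := by simp [SF.Tan2, SF.Tan1]
  have s : ∀ i j, (schwarzschildLead m).metric i j = (schwarzschildLead m).metric j i :=
    LeadData.metric_symm (isSphere_schwarzschildLead m)
  have h1 : ∀ i j, SF.d i ((algebraMap ℝ SF m) * j) = (algebraMap ℝ SF m) * SF.d i j :=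
    fun i j => by rw [SF.d_mul, Derivation.map_algebraMap]; ring
  rw [leadHam_eq s, hQ]
  have e : ∑ i, ∑ j, (SF.d i (SF.d j (SF.sphQ (algebraMap ℝ SF m) (fun _ _ => 0) i j)) -
      SF.d i (SF.d i (SF.sphQ (algebraMap ℝ SF m) (fun _ _ => 0) j j))) =
      ∑ i, SF.d i (∑ j, SF.d j (SF.sphQ (algebraMap ℝ SF m) (fun _ _ => 0) j i)) -
      SF.lap (∑ j, SF.sphQ (algebraMap ℝ SF m) (fun _ _ => 0) j j) := by
    simp only [Finset.sum_sub_distrib, map_sum, SF.lap]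
    congr 1
    · exact Finset.sum_congr rfl fun i _ => Finset.sum_congr rfl fun j _ => by
        rw [SF.sphQ_symm fun _ _ => rfl]
  rw [e, SF.tr_sphQ]
  simp only [SF.div_sphQ (SF.Hom.const m) t0]
  have d0 : ∀ j, SF.dv (fun _ _ => 0) j = 0 := fun j => by simp [SF.dv]
  have c0 : SF.tr (fun _ _ => 0) = 0 := by simp [SF.tr]
  have e2 : SF.lap (2 * SF.ri * (0 - algebraMap ℝ SF m)) = 0 := by
    have : 2 * SF.ri * (0 - algebraMap ℝ SF m) = (-(2 * m)) • SF.ri := by algebra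
    rw [this]
    simp only [SF.lap, Derivation.map_smul, ← Finset.smul_sum]
    rw [show ∑ i, SF.d i (SF.d i SF.ri) = 0 from SF.lap_ri, smul_zero]
  have e3 : ∀ i, SF.d i (6 * SF.ri * SF.ri * algebraMap ℝ SF m * SF.n i) =
      algebraMap ℝ SF (6 * m) * (SF.ri * SF.ri * SF.d i (SF.n i)
        - 2 * (SF.ri * SF.ri * SF.ri * (SF.n i * SF.n i))) := fun i => by
    have : 6 * SF.ri * SF.ri * algebraMap ℝ SF m * SF.n i =
      (6 * m) • (SF.ri * SF.ri * SF.n i) := by algebra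
    rw [this, Derivation.map_smul, Algebra.smul_def]
    simp only [SF.d_mul, SF.d_ri]
    ring
  simp only [Derivation.map_algebraMap, d0, c0, mul_zero, sub_zero, add_zero, e2, e3,
    ← Finset.mul_sum, Finset.sum_sub_distrib, SF.div_n, SF.sum_n_sq]
  ring

/-- Data with the leading terms of the Schwarzschild metric and no momentum at leading order
satisfy the new boundary conditions. -/
theorem newBoundaryConditions_of_exp {g p : Field2} {m : ℝ}
    (hg : ∀ i j, Exp (fun x => g i j x - kd i j) (-1) ((schwarzschildLead m).metric i j))
    (hp : ∀ i j, Exp (p i j) (-2) 0)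
    (sg : ∀ᶠ x in cobounded E, ∀ i j, g i j x = g j i x)
    (sp : ∀ᶠ x in cobounded E, ∀ i j, p i j x = p j i x) :
    ∃ d : BoundaryData, NewBoundaryConditions g p d ∧
      (∀ a c (x : E), x ≠ 0 → d.k a c x = 0) ∧ ∀ a (x : E), x ≠ 0 → d.prA a x = 0 := by
  have hD := isSphere_schwarzschildLead m
  have hR := LeadData.represents_toBoundaryData hD
  refine ⟨(schwarzschildLead m).toBoundaryData, ⟨hasFalloff_of_exp hD hg (fun i j =>
    (hp i j).lead (schwarzschildLead_momentum m i j).symm) ?_ sp,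
    hR.newParity_iff.2 (schwarzschildLead_hasParity m), (constraints_iff hg hp).2
      ⟨leadHam_schwarzschildLead m, fun i => by simp [leadDiv]⟩⟩, fun a c x hx => ?_,
    fun a x _ => SF.zero_apply x⟩
  · filter_upwards [sg] with x hx i j
    rw [hx i j, show kd i j = kd j i by simp [kd, eq_comm]]
  · rw [(hR.k a c).2 x hx, schwarzschildLead_k, SF.zero_apply]

end schwarzschildLead

section kerr

variable (m a : ℝ)

theorem exp_radius : Exp (fun x => (1 - m * ‖x‖⁻¹) - 1) (-1) ((-m) • SF.ri) :=
  (exp_norm_inv.const_mul (-m)).congr (Eventually.of_forall fun x => by ring)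

/-- The parameter `a` enters `kerrSigma`, `kerrDelta` and `kerrA` only at relative order $r^{-2}$,
so the first correction depends on `m` alone. -/
theorem exp_kerrSigma :
    Exp (fun x => ‖x‖⁻¹ ^ 2 * kerrSigma m a x - 1) (-1) ((-(2 * m)) • SF.ri) := by
  have h1 := (exp_radius m).mul_sub_one (exp_radius m)
  have h2 := (((exp_norm_inv.mul exp_norm_inv).mul ((exp_nrm 2).mul (exp_nrm 2))).const_mul
    (a ^ 2)).weaken (l := -1) (by norm_num)
  refine ((h1.add h2).lead (by algebra)).congr ?_
  filter_upwards [eventually_far 0] with x hx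
  rw [kerrSigma]; field_simp; ring

theorem exp_kerrDelta :
    Exp (fun x => ‖x‖⁻¹ ^ 2 * kerrDelta m a x - 1) (-1) ((-(4 * m)) • SF.ri) := by
  have h1 := (exp_radius m).mul_sub_one (exp_radius m)
  have h2 := ((exp_norm_inv.mul exp_norm_inv).const_mul (2 * m ^ 2 + a ^ 2)).weaken (l := -1)
    (by norm_num)
  refine (((h1.add h2).add (exp_norm_inv.const_mul (-(2 * m)))).lead (by algebra)).congr ?_
  filter_upwards [eventually_far 0] with x hx
  rw [kerrDelta]; field_simp; ring

theorem exp_kerrA : Exp (fun x => ‖x‖⁻¹ ^ 4 * kerrA m a x) 0 1 := by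
  have h1 := (exp_radius m).mul_sub_one (exp_radius m)
  have h0 := (exp_norm_inv.mul exp_norm_inv).const_mul (a ^ 2)
  have h2 := h1.add (h0.weaken (l := -1) (by norm_num))
  have h3 := h2.congr (G := fun x => ((1 - m * ‖x‖⁻¹) * (1 - m * ‖x‖⁻¹)
    + a ^ 2 * (‖x‖⁻¹ * ‖x‖⁻¹)) - 1) (Eventually.of_forall fun x => by ring)
  have h4 := (h0.mul (exp_kerrDelta m a).of_sub_one).mul
    (Exp.one.sub ((exp_nrm 2).mul (exp_nrm 2)))
  have h5 := (h4.weaken (l := -1) (by norm_num)).weaken (l := 0) (by norm_num)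
  refine (((h3.mul_sub_one h3).of_sub_one.sub h5).lead (sub_zero 1)).congr ?_
  filter_upwards [eventually_far 0] with x hx
  rw [kerrA]; field_simp

theorem exp_axialField (i : Fin 3) : ∃ u, Exp (axialField i) 1 u := by
  have hX : ∀ i : Fin 3, Exp (fun x => x i) 1 (SF.X i) := fun i =>
    (Exp.of_hom (SF.hom_X i)).congr <| (eventually_far 0).mono fun x hx =>
      SF.X_apply i (norm_pos_iff.1 hx)
  fin_cases i
  · exact ⟨_, (hX 1).neg⟩
  · exact ⟨_, hX 0⟩
  · exact ⟨_, Exp.zero 1⟩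

/-- The corrections of $\Sigma$ and $\Delta^{-1}$ add up to $-2m+4m=2m$ radially, and $\Sigma$ alone
gives $-2m$ tangentially, as for Schwarzschild. The axial term has order -2. -/
theorem exp_kerrMetric (i j : Fin 3) :
    Exp (fun x => kerrMetric m a i j x - kd i j) (-1) ((schwarzschildLead m).metric i j) := by
  have hS := exp_kerrSigma m a
  have hD := exp_kerrDelta m a
  have h1 := ((hS.mul_sub_one hD.inv_sub_one).mul ((exp_nrm i).mul (exp_nrm j))).cast (l := -1)
    (by norm_num)
  have h2 := (hS.mul (exp_proj i j)).cast (l := -1) (by norm_num)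
  obtain ⟨u, hu⟩ := exp_axialField i
  obtain ⟨v, hv⟩ := exp_axialField j
  have h3 := ((exp_norm_inv.mul (exp_radius m).of_sub_one).mul hS.of_sub_one.inv).const_mul (2 * m)
  have h4 := Exp.one.add (h3.weaken (l := 0) (by norm_num))
  have h5 := ((h4.mul ((exp_norm_inv.mul exp_norm_inv).mul hu)).mul
    ((exp_norm_inv.mul exp_norm_inv).mul hv)).const_mul (a ^ 2) |>.weaken (l := -1) (by norm_num)
  refine (((h1.add h2).add h5).lead ?_).congr ?_
  · rw [LeadData.metric, SF.dec, schwarzschildLead]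
    algebra
  · filter_upwards [eventually_far 0, hS.of_sub_one.eventually_half_lt,
      hD.of_sub_one.eventually_half_lt] with x hx hs hd
    have s0 : kerrSigma m a x ≠ 0 := fun h => by rw [h] at hs; norm_num at hs
    have d0 : kerrDelta m a x ≠ 0 := fun h => by rw [h] at hd; norm_num at hd
    rw [kerrMetric, proj]
    field_simp
    ring

theorem kerrMetric_symm (i j : Fin 3) (x : E) : kerrMetric m a i j x = kerrMetric m a j i x := by
  rw [kerrMetric, kerrMetric, proj, proj, show kd i j = kd j i by simp [kd, eq_comm]]
  ring

theorem exp_kerrLapse : Exp (kerrLapse m a) 0 1 := by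
  have h := ((exp_kerrSigma m a).of_sub_one.mul (exp_kerrDelta m a).of_sub_one).mul
    (exp_kerrA m a).inv
  refine ((h.lead (v := 1) (by ring)).cast (l := 0) (by norm_num)).sqrt.congr ?_
  filter_upwards [eventually_far 0] with x hx
  rw [kerrLapse]
  congr 1
  field_simp

theorem exp_kerrShift (i : Fin 3) : ∃ u, Exp (kerrShift m a i) (-2) u := by
  obtain ⟨u, hu⟩ := exp_axialField i
  have h := ((((exp_norm_inv.mul exp_norm_inv).mul exp_norm_inv).mul
    ((exp_radius m).of_sub_one.mul (exp_kerrA m a).inv)).const_mul (-(2 * m * a))).mul hu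
  refine ⟨_, (h.cast (l := -2) (by norm_num)).congr ?_⟩
  filter_upwards [eventually_far 0] with x hx
  rw [kerrShift]
  field_simp

/-- The momentum of a stationary slice whose shift decays is of lower order. -/
theorem exp_stationaryMomentum {g : Field2} {Q : Ten2} {N : E → ℝ} {β : VecField}
    (hg : ∀ i j, Exp (fun x => g i j x - kd i j) (-1) (Q i j)) (hN : Exp N 0 1)
    (hβ : ∀ i, ∃ u, Exp (β i) (-2) u) (i j : Fin 3) :
    Exp (stationaryMomentum g N β i j) (-2) 0 := by
  choose u hu using hβ
  have M := DefExp.metricExp_const hg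
  have hge : ∀ i j, Exp (g i j) 0 (SF.δ i j) := fun i j => (M.entry i j).base
  -- A shift of order -2 makes this Lie derivative, and with it the momentum, of order -3, one below
  -- the leading order of the momentum.
  have hL : ∀ i j, ∃ v, Exp (lieMetric β g i j) (-3) v := fun i j =>
    ⟨_, Exp.sum (s := Finset.univ) fun m _ =>
      (((((hu m).mul (M.pd m i j).base).weaken (l := -3) (by norm_num)).add
        (((hge m j).mul ((hu m).pd i)).cast (by norm_num))).add
        (((hge i m).mul ((hu m).pd j)).cast (by norm_num)))⟩
  choose v hv using hL
  have hq : ∀ i j, FExp (fun _ => lieMetric β g i j) (-3) (v i j) 0 := fun i j => FExp.const (hv i j)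
  have h1 := (M.raise hq i j).base.sub ((((M.inv i j).base.mul (M.trCov hq).base)).cast (by norm_num))
  have h2 := ((M.sqrtDet.base.mul hN.inv).const_mul (-(1 / 2))).mul h1
  refine (h2.weaken (l := -2) (by norm_num)).congr (Eventually.of_forall fun x => ?_)
  simp only [stationaryMomentum]
  -- Where the lapse is zero, division by zero makes both sides zero.
  by_cases h0 : N x = 0
  · simp [h0]
  · field_simp

theorem stationaryMomentum_symm {g : Field2} {N : E → ℝ} {β : VecField}
    (sg : ∀ i j x, g i j x = g j i x) (i j : Fin 3) (x : E) :
    stationaryMomentum g N β i j x = stationaryMomentum g N β j i x := by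
  rw [stationaryMomentum, stationaryMomentum, raise_symm fun i j =>
    lieMetric_symm isOpen_univ (fun x _ i j => sg i j x) (Set.mem_univ x) i j,
    invMetric_symm fun i j => sg i j x]

theorem kerr_newBoundaryConditions : ∃ d : BoundaryData,
    NewBoundaryConditions (kerrMetric m a) (kerrMomentum m a) d ∧
      (∀ e c (x : E), x ≠ 0 → d.k e c x = 0) ∧ ∀ e (x : E), x ≠ 0 → d.prA e x = 0 :=
  newBoundaryConditions_of_exp (exp_kerrMetric m a)
    (exp_stationaryMomentum (exp_kerrMetric m a) (exp_kerrLapse m a) (exp_kerrShift m a))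
    (Eventually.of_forall fun x i j => kerrMetric_symm m a i j x)
    (Eventually.of_forall fun x i j =>
      stationaryMomentum_symm (kerrMetric_symm m a) i j x)

theorem schwarzschild_newBoundaryConditions : ∃ d : BoundaryData,
    NewBoundaryConditions (schwarzschildMetric m) (fun _ _ _ => 0) d ∧
      (∀ a c (x : E), x ≠ 0 → d.k a c x = 0) ∧ ∀ a (x : E), x ≠ 0 → d.prA a x = 0 := by
  -- The Schwarzschild metric agrees far out with the Kerr metric at `a = 0`, so that expansion is
  -- reused.
  refine newBoundaryConditions_of_exp (fun i j => (exp_kerrMetric m 0 i j).congr ?_)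
    (fun _ _ => Exp.zero _) (Eventually.of_forall fun x i j => ?_)
    (Eventually.of_forall fun _ _ _ => rfl)
  -- Beyond these radii neither $R=r-m$ nor $1-2m/R=(r-3m)/(r-m)$ vanishes.
  · filter_upwards [eventually_far 0, eventually_far m, eventually_far (3 * m)] with x h0 h1 h2
    have r0 : ‖x‖ - m ≠ 0 := by linarith
    have r1 : 1 - 2 * m / (‖x‖ - m) = (‖x‖ - 3 * m) / (‖x‖ - m) := by field_simp; ring
    have r2 : ‖x‖ - 3 * m ≠ 0 := by linarith
    have r3 : kerrDelta m 0 x = (‖x‖ - m) * (‖x‖ - 3 * m) := by rw [kerrDelta]; ring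
    have r4 : kerrSigma m 0 x = (‖x‖ - m) ^ 2 := by rw [kerrSigma]; ring
    rw [kerrMetric, schwarzschildMetric, r1, r3, r4]
    field_simp
    ring
  · rw [schwarzschildMetric, schwarzschildMetric, proj, proj,
      show kd i j = kd j i by simp [kd, eq_comm]]
    ring

end kerr

end AsympFlat
end

theorem mainTheorem3 :
    -- Preservation of the new boundary conditions, and the transformation laws
    (∀ (g p : Field2) (d : BoundaryData), NewBoundaryConditions g p d →
      ∀ (b f W : E → ℝ) (Y : VecField) (ξ : E → ℝ) (X : VecField),
        IsDeformation d b f W Y ξ X →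
        (PreservesNewBoundaryConditions g p ξ X ↔
          (∃ T : E → ℝ, IsSphereFn T ∧ IsEven T ∧
            ∀ x : E, x ≠ 0 → f x = -(b x * d.lam x) - b x * trS d.k x + T x) ∧ IsOdd W) ∧
        (∀ T : E → ℝ, IsSphereFn T →
          (∀ x : E, x ≠ 0 → f x = -(b x * d.lam x) - b x * trS d.k x + T x) →
          ∃ d' : BoundaryData,
            HasFalloff (deltaMetric g p ξ X) (deltaMomentum g p ξ X) d' ∧
            TransformationLaws d b W T Y d' ∧
            (IsEven T → IsOdd W → NewParity d'))) ∧
    -- Schwarzschild after the radial redefinition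
    (∀ m : ℝ, ∃ d : BoundaryData,
      NewBoundaryConditions (schwarzschildMetric m) (fun _ _ _ => 0) d ∧
      (∀ a c (x : E), x ≠ 0 → d.k a c x = 0) ∧
      (∀ a (x : E), x ≠ 0 → d.prA a x = 0)) ∧
    -- Kerr after the radial redefinition
    (∀ m a : ℝ, ∃ d : BoundaryData,
      NewBoundaryConditions (kerrMetric m a) (kerrMomentum m a) d ∧
      (∀ e c (x : E), x ≠ 0 → d.k e c x = 0) ∧
      (∀ e (x : E), x ≠ 0 → d.prA e x = 0)) :=
  ⟨fun _ _ _ hbc _ _ _ _ _ _ h => hbc.deformation h, schwarzschild_newBoundaryConditions,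
    kerr_newBoundaryConditions⟩
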